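/- Let $p$ be a prime number, $n\ge 2$, and let $f,g\in\mathbb Z_p[x_1,\dots,x_n]$ be non-zero polynomials with $f(0)=g(0)=0$. Notation. For $f=\sum_\omega a_\omega x^\omega$ let $\Gamma_f\subset\mathbb R_{\ge0}^n$ be its Newton polyhedron, the convex hull of $\bigcup_{a_\omega\ne0}(\omega+\mathbb R_{\ge0}^n)$; a face of $\Gamma_f$ is $\Gamma_f$ itself or a nonempty intersection of $\Gamma_f$ with a supporting hyperplane, and $f_\tau=\sum_{\omega\in\tau}a_\omega x^\omega$ for a face $\tau$. For $k\in\mathbb R_{\ge0}^n$ put $m_f(k)=\inf_{x\in\Gamma_f}k\cdot x$, $F_f(k)=\{x\in\Gamma_f: k\cdot x=m_f(k)\}$ and $\sigma(k)=k_1+\dots+k_n$; put $\Delta_f(\tau)=\{k\in\mathbb R_{\ge0}^n: F_f(k)=\tau\}$. Let $\Delta_{f,g}$ be the partition of $\mathbb R_{\ge0}^n$ consisting of all nonempty sets $\Delta_f(\tau)\cap\Delta_g(\tau')$ with $\tau$ a face of $\Gamma_f$ and $\tau'$ a face of $\Gamma_g$. For $\delta=\Delta_f(\tau)\cap\Delta_g(\tau')\in\Delta_{f,g}$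 put $f_\delta=f_\tau$, $g_\delta=g_{\tau'}$. A bar denotes reduction modulo $p$. Set $$N_\delta=\#\{a\in(\mathbb F_p^\times)^n:\overline{f_\delta}(a)=0,\ \overline{g_\delta}(a)\neq0\},\quad P_\delta=\#\{a\in(\mathbb F_p^\times)^n:\overline{f_\delta}(a)\neq0,\ \overline{g_\delta}(a)=0\},$$ $$Q_\delta=\#\{a\in(\mathbb F_p^\times)^n:\overline{f_\delta}(a)=\overline{g_\delta}(a)=0\}.$$ Assumptions. (i) $f$ is non-degenerated over $\mathbb F_p$ with respect to all the faces of $\Gamma_f$: for every face $\tau$ of $\Gamma_f$ (including $\Gamma_f$) the polynomials $\overline{f_\tau}$ and $\partial\overline{f_\tau}/\partial x_i$ $(1\le i\le n)$ have no common zero in $(\mathbb F_p^\times)^n$; likewise for $g$ and $\Gamma_g$. (ii) $(f,g)$ is non-degenerated over $\mathbb F_p$ with respect to all the cones of $\Delta_{f,g}$: for every $\delta\in\Delta_{f,g}$ and every $a\in(\mathbb F_p^\times)^n$ with $\overline{f_\delta}(a)=\overline{g_\delta}(a)=0$, the Jacobian matrix of $(\overline{f_\delta},\overline{g_\delta})$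 at $a$ has rank $2$. Let $|dx|$ be the Haar measure on $\mathbb Z_p^n$ of total mass one and $|\cdot|$ the $p$-adic norm. Then: 1. $\Delta_{f,g}$ is finite, and for every $s\in\mathbb C$ with $\Re(s)>0$ (the integral and all series converging absolutely) $$Z_{f,g}(s):=\int_{\mathbb Z_p^n}|f(x)|^s|g(x)|\,|dx|=\sum_{\delta\in\Delta_{f,g}}L_\delta(s)S_\delta(s),$$ where $$L_\delta(s)=p^{-n}\left((p-1)^n-pN_\delta\frac{p^s-1}{p^{s+1}-1}-P_\delta\frac{p}{p+1}-pQ_\delta\frac{p^s(p+1)-2}{(p^{s+1}-1)(p+1)}\right),$$ $$S_\delta(s)=\sum_{k\in\mathbb N^n\cap\delta}p^{-m_f(k)s-m_g(k)-\sigma(k)}\qquad(\mathbb N=\{0,1,2,\dots\}).$$ 2. For a finite linearly independent set $K\subset\mathbb N^n\setminus\{0\}$ of primitive vectors (integer vectors whose entries have greatest common divisor one), the cone strictly positively spanned by $K$ is $\{\sum_{k\in K}\lambda_kk:\lambda_k>0\}$ (equal to $\{0\}$ if $K=\emptyset$). A ray of $\Delta_{f,g}$ is a one-dimensional cone in $\Delta_{f,g}$.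 Every $\delta\in\Delta_{f,g}$ has a finite partition into cones $\delta_i$ $(i\in I)$, $\delta_i$ strictly positively spanned by linearly independent primitive vectors $k_{i,1},\dots,k_{i,r_i}\in\mathbb N^n\setminus\{0\}$, without new rays, i.e. with every $k_{i,j}$ spanning a ray of $\Delta_{f,g}$. 3. The values of $m_f$ and $m_g$ on $\mathbb N^n$ are non-negative integers. For every $\delta\in\Delta_{f,g}$, every finite partition of $\delta$ into cones $\delta_i$ strictly positively spanned by linearly independent primitive vectors $k_{i,1},\dots,k_{i,r_i}\in\mathbb N^n\setminus\{0\}$ (with or without new rays), and every $s$ with $\Re(s)>0$, $$S_\delta(s)=\sum_{i\in I}\frac{\sum_hp^{m_f(h)s+m_g(h)+\sigma(h)}}{\prod_{j=1}^{r_i}\left(p^{m_f(k_{i,j})s+m_g(k_{i,j})+\sigma(k_{i,j})}-1\right)},$$ with non-zero denominators, where $h$ runs through $\mathbb Z^n\cap\{\sum_{j=1}^{r_i}\lambda_jk_{i,j}:0\le\lambda_j<1\}$. Thus $S_\delta$ is a rational expression in $p^{-s}$. 4. Choose for each $\delta\in\Delta_{f,g}$ a partition without new rays as in 2. Then $\sum_\delta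 L_\delta(s)S_\delta(s)$, with $S_\delta$ replaced by its closed expression in 3, is a meromorphic function of $s\in\mathbb C$ that extends $Z_{f,g}$. The candidate poles, i.e. the zeros of the denominators $p^{s+1}-1$ and $p^{m_f(k_{i,j})s+m_g(k_{i,j})+\sigma(k_{i,j})}-1$ of this expression, have as real parts exactly the numbers $$-1\qquad\text{and}\qquad-\frac{m_g(k)+\sigma(k)}{m_f(k)}$$ for $k$ a primitive generator of a ray of $\Delta_{f,g}$ with $m_f(k)\ne0$; the extended function is analytic at every $s$ whose real part is not one of these numbers. -/

import Mathlib

open MeasureTheory Set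

noncomputable section

namespace IgusaNewton

/-! ### The ring of p-adic integers as a measure space -/

instance instMeasurableSpacePadicInt (p : ℕ) [Fact p.Prime] : MeasurableSpace ℤ_[p] := borel _

instance instBorelSpacePadicInt (p : ℕ) [Fact p.Prime] : BorelSpace ℤ_[p] := ⟨rfl⟩

/-- The Haar measure `|dx|` on `ℤ_pⁿ`, normalized so that `ℤ_pⁿ` has measure one. -/
def haar (p : ℕ) [Fact p.Prime] (n : ℕ) : Measure (Fin n → ℤ_[p]) :=
  Measure.addHaarMeasure ⊤

/-- The integrand `|f(x)|^s |g(x)|` on `ℤ_pⁿ`. -/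
def igusaIntegrand {p : ℕ} [Fact p.Prime] {n : ℕ} (f g : MvPolynomial (Fin n) ℤ_[p]) (s : ℂ)
    (x : Fin n → ℤ_[p]) : ℂ :=
  ((‖MvPolynomial.eval x f‖ : ℝ) : ℂ) ^ s * ((‖MvPolynomial.eval x g‖ : ℝ) : ℂ)

/-- Igusa's local zeta function `Z_{f,g}(s) = ∫_{ℤ_pⁿ} |f(x)|^s |g(x)| |dx|`. -/
def igusaZeta {p : ℕ} [Fact p.Prime] {n : ℕ} (f g : MvPolynomial (Fin n) ℤ_[p]) (s : ℂ) : ℂ :=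
  ∫ x, igusaIntegrand f g s x ∂(haar p n)

/-! ### Newton polyhedra -/

/-- The inclusion of `ℕⁿ` in `ℝⁿ`. -/
def natVec {n : ℕ} (k : Fin n → ℕ) : Fin n → ℝ := fun i => (k i : ℝ)

/-- The inclusion of `ℤⁿ` in `ℝⁿ`. -/
def intVec {n : ℕ} (k : Fin n → ℤ) : Fin n → ℝ := fun i => (k i : ℝ)

/-- `σ(k) = k₁ + ⋯ + kₙ`. -/
def sigma {n : ℕ} (k : Fin n → ℝ) : ℝ := ∑ i, k i

section Newton

variable {R : Type*} [CommRing R] {n : ℕ}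

/-- The Newton polyhedron `Γ_f`: the convex hull of the union of the sets `ω + ℝ₊ⁿ`,
with `ω` in the support of `f`. -/
def newtonPolyhedron (f : MvPolynomial (Fin n) R) : Set (Fin n → ℝ) :=
  convexHull ℝ (⋃ ω ∈ f.support, {x | ∀ i, (ω i : ℝ) ≤ x i})

/-- `τ` is a face of `Γ_f`: either `Γ_f` itself (the zero functional) or a nonempty intersection of
`Γ_f` with a supporting hyperplane. -/
def IsFace (f : MvPolynomial (Fin n) R) (τ : Set (Fin n → ℝ)) : Prop :=
  τ.Nonempty ∧ IsExposed ℝ (newtonPolyhedron f) τ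

open Classical in
/-- The polynomial `f_τ = ∑_{ω ∈ τ} a_ω x^ω`. -/
def facePoly (f : MvPolynomial (Fin n) R) (τ : Set (Fin n → ℝ)) : MvPolynomial (Fin n) R :=
  ∑ ω ∈ f.support.filter (fun ω : Fin n →₀ ℕ => natVec (ω : Fin n → ℕ) ∈ τ),
    MvPolynomial.monomial ω (f.coeff ω)

/-- `m_f(k) = inf_{x ∈ Γ_f} k · x`. -/
def mf (f : MvPolynomial (Fin n) R) (k : Fin n → ℝ) : ℝ :=
  sInf ((fun x => k ⬝ᵥ x) '' newtonPolyhedron f)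

/-- The first meet locus `F_f(k)`. -/
def firstMeetLocus (f : MvPolynomial (Fin n) R) (k : Fin n → ℝ) : Set (Fin n → ℝ) :=
  {x ∈ newtonPolyhedron f | k ⬝ᵥ x = mf f k}

/-- The cone `Δ_f(τ) = {k ∈ ℝ₊ⁿ | F_f(k) = τ}`. -/
def coneOf (f : MvPolynomial (Fin n) R) (τ : Set (Fin n → ℝ)) : Set (Fin n → ℝ) :=
  {k | (∀ i, 0 ≤ k i) ∧ firstMeetLocus f k = τ}

/-- The partition `Δ_{f,g}` of `ℝ₊ⁿ`: all nonempty intersections `Δ_f(τ) ∩ Δ_g(τ')`. -/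
def conePartition (f g : MvPolynomial (Fin n) R) : Set (Set (Fin n → ℝ)) :=
  {δ | ∃ τ τ', IsFace f τ ∧ IsFace g τ' ∧ δ = coneOf f τ ∩ coneOf g τ' ∧ δ.Nonempty}

/-- The face of `Γ_f` associated to a cone `δ`: the common first meet locus of the points of `δ`
(see `faceOf_eq_left` and `faceOf_eq_right`). -/
def faceOf (f : MvPolynomial (Fin n) R) (δ : Set (Fin n → ℝ)) : Set (Fin n → ℝ) :=
  ⋂ k ∈ δ, firstMeetLocus f k

theorem faceOf_eq_of_subset (f : MvPolynomial (Fin n) R) {δ τ : Set (Fin n → ℝ)}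
    (hne : δ.Nonempty) (hδ : δ ⊆ coneOf f τ) : faceOf f δ = τ := by
  obtain ⟨k, hk⟩ := hne
  apply Subset.antisymm
  · intro x hx
    have h := mem_iInter₂.1 hx k hk
    rwa [(hδ hk).2] at h
  · intro x hx
    refine mem_iInter₂.2 fun l hl => ?_
    rwa [(hδ hl).2]

theorem faceOf_eq_left (f g : MvPolynomial (Fin n) R) {τ τ' : Set (Fin n → ℝ)}
    (h : (coneOf f τ ∩ coneOf g τ').Nonempty) : faceOf f (coneOf f τ ∩ coneOf g τ') = τ :=
  faceOf_eq_of_subset f h inter_subset_left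

theorem faceOf_eq_right (f g : MvPolynomial (Fin n) R) {τ τ' : Set (Fin n → ℝ)}
    (h : (coneOf f τ ∩ coneOf g τ').Nonempty) : faceOf g (coneOf f τ ∩ coneOf g τ') = τ' :=
  faceOf_eq_of_subset g h inter_subset_right

end Newton

/-! ### Reduction modulo `p`, non-degeneracy and point counts -/

section Reduction

variable {p : ℕ} [Fact p.Prime] {n : ℕ}

/-- The reduction of `f` modulo `p`. -/
def redPoly (f : MvPolynomial (Fin n) ℤ_[p]) : MvPolynomial (Fin n) (ZMod p) :=
  MvPolynomial.map PadicInt.toZMod f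

/-- The value of a polynomial over `𝔽_p` at a point of the torus `(𝔽_pˣ)ⁿ`. -/
def evalTorus (F : MvPolynomial (Fin n) (ZMod p)) (a : Fin n → (ZMod p)ˣ) : ZMod p :=
  MvPolynomial.eval (fun i => (a i : ZMod p)) F

/-- `f` is non-degenerated over `𝔽_p` with respect to all the faces of its Newton polyhedron. -/
def NonDegenerate (f : MvPolynomial (Fin n) ℤ_[p]) : Prop :=
  ∀ τ, IsFace f τ → ∀ a : Fin n → (ZMod p)ˣ,
    ¬ (evalTorus (redPoly (facePoly f τ)) a = 0 ∧
      ∀ i, evalTorus (MvPolynomial.pderiv i (redPoly (facePoly f τ))) a = 0)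

/-- The reduction modulo `p` of `f_δ`. -/
def conePoly (f : MvPolynomial (Fin n) ℤ_[p]) (δ : Set (Fin n → ℝ)) :
    MvPolynomial (Fin n) (ZMod p) :=
  redPoly (facePoly f (faceOf f δ))

/-- The Jacobian matrix of the pair `(F, G)` at a point of the torus. -/
def jacobian (F G : MvPolynomial (Fin n) (ZMod p)) (a : Fin n → (ZMod p)ˣ) :
    Matrix (Fin 2) (Fin n) (ZMod p) :=
  Matrix.of ![fun j => evalTorus (MvPolynomial.pderiv j F) a,
    fun j => evalTorus (MvPolynomial.pderiv j G) a]

/-- `(f, g)` is non-degenerated over `𝔽_p` with respect to all the cones in `Δ_{f,g}`. -/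
def PairNonDegenerate (f g : MvPolynomial (Fin n) ℤ_[p]) : Prop :=
  ∀ δ ∈ conePartition f g, ∀ a : Fin n → (ZMod p)ˣ,
    evalTorus (conePoly f δ) a = 0 → evalTorus (conePoly g δ) a = 0 →
      (jacobian (conePoly f δ) (conePoly g δ) a).rank = 2

/-- `N_δ`. -/
def countN (f g : MvPolynomial (Fin n) ℤ_[p]) (δ : Set (Fin n → ℝ)) : ℕ :=
  {a : Fin n → (ZMod p)ˣ | evalTorus (conePoly f δ) a = 0 ∧ evalTorus (conePoly g δ) a ≠ 0}.ncard

/-- `P_δ`. -/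
def countP (f g : MvPolynomial (Fin n) ℤ_[p]) (δ : Set (Fin n → ℝ)) : ℕ :=
  {a : Fin n → (ZMod p)ˣ | evalTorus (conePoly f δ) a ≠ 0 ∧ evalTorus (conePoly g δ) a = 0}.ncard

/-- `Q_δ`. -/
def countQ (f g : MvPolynomial (Fin n) ℤ_[p]) (δ : Set (Fin n → ℝ)) : ℕ :=
  {a : Fin n → (ZMod p)ˣ | evalTorus (conePoly f δ) a = 0 ∧ evalTorus (conePoly g δ) a = 0}.ncard

/-- The factor `L_δ(s)`. -/
def coneL (f g : MvPolynomial (Fin n) ℤ_[p]) (δ : Set (Fin n → ℝ)) (s : ℂ) : ℂ :=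
  ((p : ℂ) ^ n)⁻¹ *
    (((p : ℂ) - 1) ^ n
      - (p : ℂ) * (countN f g δ : ℂ) * (((p : ℂ) ^ s - 1) / ((p : ℂ) ^ (s + 1) - 1))
      - (countP f g δ : ℂ) * ((p : ℂ) / ((p : ℂ) + 1))
      - (p : ℂ) * (countQ f g δ : ℂ) *
          (((p : ℂ) ^ s * ((p : ℂ) + 1) - 2) / (((p : ℂ) ^ (s + 1) - 1) * ((p : ℂ) + 1))))

/-- The linear form `m_f(k) s + m_g(k) + σ(k)` in `s`. -/
def coneExponent (f g : MvPolynomial (Fin n) ℤ_[p]) (k : Fin n → ℝ) (s : ℂ) : ℂ :=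
  (mf f k : ℂ) * s + (mf g k : ℂ) + (sigma k : ℂ)

/-- The term `p^{-m_f(k)s - m_g(k) - σ(k)}` of the series `S_δ(s)`. -/
def coneTerm (f g : MvPolynomial (Fin n) ℤ_[p]) (k : Fin n → ℝ) (s : ℂ) : ℂ :=
  (p : ℂ) ^ (-coneExponent f g k s)

/-- The series `S_δ(s) = ∑_{k ∈ ℕⁿ ∩ δ} p^{-m_f(k)s - m_g(k) - σ(k)}`. -/
def coneS (f g : MvPolynomial (Fin n) ℤ_[p]) (δ : Set (Fin n → ℝ)) (s : ℂ) : ℂ :=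
  ∑' k : {k : Fin n → ℕ // natVec k ∈ δ}, coneTerm f g (natVec k.1) s

end Reduction

/-! ### Simplicial subdivisions and the closed formula -/

section Subdivision

variable {n : ℕ}

/-- A primitive vector of `ℕⁿ`. -/
def IsPrimitive (k : Fin n → ℕ) : Prop := Finset.univ.gcd k = 1

/-- The cone strictly positively spanned by the vectors in `K` (it is `{0}` for empty `K`). -/
def spannedCone (K : Finset (Fin n → ℕ)) : Set (Fin n → ℝ) :=
  {x | ∃ c : (Fin n → ℕ) → ℝ, (∀ k ∈ K, 0 < c k) ∧ x = ∑ k ∈ K, c k • natVec k}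

/-- The integral points of the half-open parallelepiped spanned by the vectors in `K`. -/
def boxPoints (K : Finset (Fin n → ℕ)) : Set (Fin n → ℤ) :=
  {h | ∃ c : (Fin n → ℕ) → ℝ, (∀ k ∈ K, 0 ≤ c k ∧ c k < 1) ∧
    intVec h = ∑ k ∈ K, c k • natVec k}

/-- `C` describes a finite partition of `δ` into rational simplicial cones: each member `K` of `C`
is a linearly independent set of primitive vectors in `ℕⁿ`, and the cones strictly positively
spanned by the members of `C` are pairwise disjoint and have union `δ`. -/
structure IsSimplicialSubdivision (δ : Set (Fin n → ℝ)) (C : Finset (Finset (Fin n → ℕ))) :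
    Prop where
  primitive : ∀ K ∈ C, ∀ k ∈ K, IsPrimitive k
  linearIndependent : ∀ K ∈ C, LinearIndependent ℝ (fun k : {k // k ∈ K} => natVec k.1)
  disjoint : (C : Set (Finset (Fin n → ℕ))).PairwiseDisjoint spannedCone
  cover : ⋃ K ∈ C, spannedCone K = δ

variable {p : ℕ} [Fact p.Prime]

/-- `k` is a primitive generator of a ray (a one-dimensional cone) in `Δ_{f,g}`. -/
def IsRayGenerator (f g : MvPolynomial (Fin n) ℤ_[p]) (k : Fin n → ℕ) : Prop :=
  IsPrimitive k ∧ spannedCone {k} ∈ conePartition f g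

/-- The subdivision `C` introduces no new rays: every generator spans a ray in `Δ_{f,g}`. -/
def NoNewRays (f g : MvPolynomial (Fin n) ℤ_[p]) (C : Finset (Finset (Fin n → ℕ))) : Prop :=
  ∀ K ∈ C, ∀ k ∈ K, IsRayGenerator f g k

/-- The closed expression for `S_δ(s)` attached to a simplicial subdivision `C` of `δ`. -/
def closedS (f g : MvPolynomial (Fin n) ℤ_[p]) (C : Finset (Finset (Fin n → ℕ))) (s : ℂ) : ℂ :=
  ∑ K ∈ C, (∑ᶠ h ∈ boxPoints K, (p : ℂ) ^ coneExponent f g (intVec h) s) /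
    ∏ k ∈ K, ((p : ℂ) ^ coneExponent f g (natVec k) s - 1)

/-- The real parts of the candidate poles: `-1` and the numbers `-(m_g(k) + σ(k)) / m_f(k)` for `k`
a primitive generator of a ray in `Δ_{f,g}` with `m_f(k) ≠ 0`. -/
def candidateRealParts (f g : MvPolynomial (Fin n) ℤ_[p]) : Set ℝ :=
  insert (-1) {r | ∃ k : Fin n → ℕ, IsRayGenerator f g k ∧ mf f (natVec k) ≠ 0 ∧
    r = -((mf g (natVec k) + sigma (natVec k)) / mf f (natVec k))}

/-- The expression `∑_δ L_δ(s) S_δ(s)`, with each `S_δ` in its closed form for the subdivision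
`C δ` of `δ`. -/
def closedZeta (f g : MvPolynomial (Fin n) ℤ_[p])
    (C : Set (Fin n → ℝ) → Finset (Finset (Fin n → ℕ))) (s : ℂ) : ℂ :=
  ∑ᶠ δ ∈ conePartition f g, coneL f g δ s * closedS f g (C δ) s

end Subdivision

end IgusaNewton

end

noncomputable section

namespace IgusaNewton

/-! ### Haar measure on `ℤ_pⁿ` -/

section HaarGeneral

variable {G : Type*} [TopologicalSpace G] [AddGroup G] [IsTopologicalAddGroup G]
  [MeasurableSpace G] [BorelSpace G] [CompactSpace G] (μ : Measure G) [μ.IsAddHaarMeasure]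
  [IsProbabilityMeasure μ]

/-! Outside the null set of points with a vanishing coordinate, every `x` is uniquely `p ^ k u` with
`k ∈ ℕⁿ` and all coordinates of `u` units. On the piece belonging to `k` one has `f(p ^ k u) = p ^
m_f(k) F(u)`, where `F` reduces modulo `p` to the polynomial of the face `F_f(k)`, and similarly for
`g`. Scaling therefore contributes `p ^ (-m_f(k)s - m_g(k) - σ(k))`, and what remains is an integral
over the unit torus.

That integral is a sum over residue classes modulo `p`. Where both reductions are non-zero the
integrand is 1. Where one or both vanish, non-degeneracy allows the vanishing polynomials to be
completed to a coordinate system: the polynomial map `H` has a Jacobian invertible modulo `p`, so `u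
↦ H(a + p u) / p` is an isometry of `ℤ_pⁿ` (`exists_isometry_of_polyMap`), and isometries preserve
Haar measure (`Isometry.measurePreserving_of_ultrametric`). Only one-variable integrals `∫ |p y|^s
|dy|` are left (`setIntegral_residueClass_norm_mul_norm`). Counting classes gives `L_δ`, which
depends on `k` only through its cone; grouping the sum of `hasSum_igusaZeta` by cones gives the
formula.

A face of the Newton polyhedron is determined by finitely many data of `k`: its zero coordinates and
its minimizing exponents (`firstMeetLocus_eq_iff`). Hence there are finitely many cones, and each is
a relatively open face of a pointed cone cut out by integral forms (`coneClass_eq_openFace`). Such a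
face is subdivided inductively, by coning smaller faces from one of its own rays
(`exists_simplicialSubdivision_openFace`), which creates no new rays.

On a simplicial piece `m_f`, `m_g` and `σ` are linear, and its lattice points are uniquely `∑ (m_k +
1) k - h` with `h` in the half-open box (`exists_equiv_boxPoints_prod`), so the series is a finite
sum times a product of geometric series. The closed form is a quotient of exponential polynomials. A
denominator vanishes only where its exponent has real part zero. Every ray of the partition is
itself one of the cones, and any subdivision of it must use its primitive generator, so no candidate
is missed. -/

theorem comap_eq_smul_of_measurableEmbedding (φ : G →+ G) (hφ : MeasurableEmbedding φ) :
    μ.comap φ = μ (range φ) • μ := by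
  have := Measure.IsAddLeftInvariant.comap μ hφ
  have huniv : μ.comap φ univ = μ (range φ) := by rw [hφ.comap_apply, image_univ]
  have : IsFiniteMeasure (μ.comap φ) := ⟨by rw [huniv]; exact measure_lt_top _ _⟩
  -- Finite invariant measures on a compact group are proportional, so the total mass determines the
  -- factor.
  have h := Measure.isAddInvariant_eq_smul_of_compactSpace (μ.comap φ) μ
  have hc : (Measure.addHaarScalarFactor (μ.comap φ) μ : ENNReal) = μ (range φ) := by
    rw [← huniv]
    conv_rhs => rw [h, Measure.smul_apply, measure_univ, ENNReal.smul_def, smul_eq_mul, mul_one]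
  rw [← hc]
  exact h

theorem setIntegral_range_of_measurableEmbedding {E : Type*} [NormedAddCommGroup E]
    [NormedSpace ℝ E] (φ : G →+ G) (hφ : MeasurableEmbedding φ) (h : G → E) :
    ∫ x in range φ, h x ∂μ = μ.real (range φ) • ∫ u, h (φ u) ∂μ := by
  rw [← hφ.map_comap, hφ.integral_map, comap_eq_smul_of_measurableEmbedding μ φ hφ,
    integral_smul_measure]
  rfl

end HaarGeneral

/-! ### Isometries of compact ultrametric groups -/

section Isometry

/-- By compactness two iterates of `b` are close; cancelling the common iterates, which are
isometries, shows that `b` returns close to itself. So an isometry of a compact space has dense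
range, which replaces a proof of surjectivity. -/
theorem _root_.Isometry.exists_dist_lt_of_compactSpace {X : Type*} [MetricSpace X]
    [CompactSpace X] {T : X → X} (hT : Isometry T) (b : X)
    {r : ℝ} (hr : 0 < r) : ∃ x, dist (T x) b < r := by
  obtain ⟨a, -, φ, hφ, hlim⟩ := isCompact_univ.tendsto_subseq (x := fun m : ℕ => T^[m] b)
    (fun _ => mem_univ _)
  obtain ⟨N, hN⟩ := Metric.cauchySeq_iff.1 hlim.cauchySeq r hr
  have h := hN (N + 1) (by omega) N le_rfl
  have hlt : φ N < φ (N + 1) := hφ (by omega)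
  -- The gap between the two iterates is `d + 1`, so it is `T^[d] b` whose image lies near `b`.
  obtain ⟨d, hd⟩ := Nat.exists_eq_add_of_lt hlt
  refine ⟨T^[d] b, ?_⟩
  have hit : ∀ m, Isometry T^[m] := fun m => by
    induction m with
    | zero => exact isometry_id
    | succ m ih => exact ih.comp hT
  simp only [Function.comp] at h
  rw [hd, show φ N + d + 1 = φ N + (d + 1) by ring, Function.iterate_add_apply,
    (hit _).dist_eq, Function.iterate_succ_apply'] at h
  exact h

variable {X : Type*} [NormedAddCommGroup X] [CompactSpace X] [IsUltrametricDist X]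
  [MeasurableSpace X] [BorelSpace X]

/-- Translation invariance makes the measure of a ball depend only on its radius. In an ultrametric
space the balls form a π-system generating the Borel sets, so it suffices that the preimage of a
ball is a ball of the same radius. -/
theorem _root_.Isometry.measurePreserving_of_ultrametric [MeasurableAdd X] {T : X → X}
    (hT : Isometry T) (μ : Measure X) [μ.IsAddLeftInvariant] [IsFiniteMeasure μ] :
    MeasurePreserving T μ μ := by
  refine ⟨hT.continuous.measurable, ?_⟩
  have hball : ∀ (x y : X) (r : ℝ), μ (Metric.ball x r) = μ (Metric.ball y r) := by
    intro x y r
    have : (fun z => (x - y) + z) ⁻¹' Metric.ball x r = Metric.ball y r := by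
      ext z
      rw [mem_preimage, mem_ball_iff_norm, mem_ball_iff_norm, show x - y + z - x = z - y by abel]
    rw [← this, measure_preimage_add]
  let C : Set (Set X) := {s | ∃ x, ∃ r > 0, s = Metric.ball x r}
  have hbasis : TopologicalSpace.IsTopologicalBasis C := by
    refine TopologicalSpace.isTopologicalBasis_of_isOpen_of_nhds ?_ ?_
    · rintro _ ⟨x, r, -, rfl⟩
      exact Metric.isOpen_ball
    · intro a u ha hu
      obtain ⟨ε, hε, hsub⟩ := Metric.isOpen_iff.1 hu a ha
      exact ⟨_, ⟨a, ε, hε, rfl⟩, Metric.mem_ball_self hε, hsub⟩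
  refine ext_of_generate_finite C ?_ ?_ ?_ ?_
  · rw [‹BorelSpace X›.measurable_eq, hbasis.borel_eq_generateFrom]
  · rintro _ ⟨x, r, hr, rfl⟩ _ ⟨y, t, ht, rfl⟩ hne
    rcases IsUltrametricDist.ball_subset_trichotomy x y r t with h | h | h
    · rw [inter_eq_left.2 h]
      exact ⟨x, r, hr, rfl⟩
    · rw [inter_eq_right.2 h]
      exact ⟨y, t, ht, rfl⟩
    · exact absurd h.inter_eq hne.ne_empty
  · rintro _ ⟨b, r, hr, rfl⟩
    rw [Measure.map_apply hT.continuous.measurable Metric.isOpen_ball.measurableSet]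
    -- Every point of an ultrametric ball is a centre, so the ball can be recentred at a point of
    -- the range of `T`.
    obtain ⟨x, hx⟩ := hT.exists_dist_lt_of_compactSpace b hr
    rw [IsUltrametricDist.ball_eq_of_mem (Metric.mem_ball.2 hx), hT.preimage_ball]
    exact hball _ _ _
  · rw [Measure.map_apply hT.continuous.measurable MeasurableSet.univ, preimage_univ]

end Isometry

section Haar

variable (p : ℕ) [Fact p.Prime] (n : ℕ)

/-- The normalized Haar measure on `ℤ_p`. -/
def haarOne : Measure ℤ_[p] := Measure.addHaarMeasure ⊤

instance : (haarOne p).IsAddHaarMeasure := by unfold haarOne; infer_instance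

instance : IsProbabilityMeasure (haarOne p) :=
  ⟨Measure.addHaarMeasure_self (K₀ := (⊤ : TopologicalSpace.PositiveCompacts ℤ_[p]))⟩

instance : (haar p n).IsAddHaarMeasure := by unfold haar; infer_instance

instance : IsProbabilityMeasure (haar p n) :=
  ⟨Measure.addHaarMeasure_self (K₀ := (⊤ : TopologicalSpace.PositiveCompacts (Fin n → ℤ_[p])))⟩

theorem haar_eq_pi : haar p n = Measure.pi fun _ => haarOne p :=
  Measure.isAddHaarMeasure_eq_of_isProbabilityMeasure _ _

/-- The set is the kernel of reduction modulo `p ^ k`, a subgroup of index `p ^ k` whose cosets have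
equal measure. -/
theorem haarOne_range_pow_mul (k : ℕ) :
    haarOne p (range fun y : ℤ_[p] => (p : ℤ_[p]) ^ k * y) = ((p : ENNReal) ^ k)⁻¹ := by
  let H : AddSubgroup ℤ_[p] := (PadicInt.toZModPow (p := p) k).toAddMonoidHom.ker
  have hH : (H : Set ℤ_[p]) = range fun y : ℤ_[p] => (p : ℤ_[p]) ^ k * y := by
    ext x
    have h1 : x ∈ H ↔ x ∈ RingHom.ker (PadicInt.toZModPow (p := p) k) := Iff.rfl
    rw [SetLike.mem_coe, h1, PadicInt.ker_toZModPow, Ideal.mem_span_singleton, dvd_def]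
    simp [eq_comm]
  have hidx : H.index = p ^ k := by
    have : NeZero (p ^ k) := ⟨pow_ne_zero _ (Fact.out : p.Prime).ne_zero⟩
    have hs : Function.Surjective (PadicInt.toZModPow (p := p) k).toAddMonoidHom := by
      intro z
      exact ⟨(z.val : ℤ_[p]), by simp⟩
    rw [AddSubgroup.index_ker, AddMonoidHom.range_eq_top.2 hs]
    simp
  have : H.FiniteIndex := ⟨by rw [hidx]; exact pow_ne_zero _ (Fact.out : p.Prime).ne_zero⟩
  have hmeas : MeasurableSet (H : Set ℤ_[p]) := by
    rw [hH]
    exact (isCompact_range (by fun_prop)).isClosed.measurableSet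
  have h := H.index_mul_measure hmeas (haarOne p)
  rw [hidx, measure_univ, hH, mul_comm] at h
  push_cast at h
  exact ENNReal.eq_inv_of_mul_eq_one_left h

/-- Multiplication by `p ^ k`, coordinatewise. -/
def scaleHom (k : Fin n → ℕ) : (Fin n → ℤ_[p]) →+ (Fin n → ℤ_[p]) where
  toFun u i := (p : ℤ_[p]) ^ k i * u i
  map_zero' := by ext i; simp
  map_add' u v := by ext i; simp [mul_add]

variable {p n}

theorem scaleHom_apply (k : Fin n → ℕ) (u : Fin n → ℤ_[p]) (i : Fin n) :
    scaleHom p n k u i = (p : ℤ_[p]) ^ k i * u i := rfl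

theorem natCast_prime_ne_zero : (p : ℤ_[p]) ≠ 0 :=
  Nat.cast_ne_zero.2 (Fact.out : p.Prime).ne_zero

theorem continuous_scaleHom (k : Fin n → ℕ) : Continuous (scaleHom p n k) := by
  change Continuous fun (u : Fin n → ℤ_[p]) i => (p : ℤ_[p]) ^ k i * u i
  fun_prop

theorem scaleHom_injective (k : Fin n → ℕ) : Function.Injective (scaleHom p n k) := by
  intro u v h
  ext1 i
  exact mul_left_cancel₀ (pow_ne_zero _ natCast_prime_ne_zero) (congr_fun h i)

theorem measurableEmbedding_scaleHom (k : Fin n → ℕ) : MeasurableEmbedding (scaleHom p n k) :=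
  ((continuous_scaleHom k).isClosedEmbedding (scaleHom_injective k)).measurableEmbedding

theorem range_scaleHom (k : Fin n → ℕ) : range (scaleHom p n k) =
    Set.pi univ fun i => range fun y : ℤ_[p] => (p : ℤ_[p]) ^ k i * y := by
  ext x
  constructor
  · rintro ⟨u, rfl⟩ i -
    exact ⟨u i, rfl⟩
  · intro h
    choose u hu using fun i => h i (mem_univ i)
    exact ⟨u, funext hu⟩

theorem haar_real_range_scaleHom (k : Fin n → ℕ) :
    (haar p n).real (range (scaleHom p n k)) = ((p : ℝ) ^ ∑ i, k i)⁻¹ := by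
  rw [Measure.real, range_scaleHom, haar_eq_pi, Measure.pi_pi, ENNReal.toReal_prod]
  simp [haarOne_range_pow_mul, Finset.prod_pow_eq_pow_sum]

theorem setIntegral_range_scaleHom (k : Fin n → ℕ) (h : (Fin n → ℤ_[p]) → ℂ) :
    ∫ x in range (scaleHom p n k), h x ∂haar p n =
      ((p : ℂ) ^ ∑ i, k i)⁻¹ * ∫ u, h (scaleHom p n k u) ∂haar p n := by
  rw [setIntegral_range_of_measurableEmbedding _ _ (measurableEmbedding_scaleHom k),
    haar_real_range_scaleHom, Complex.real_smul]
  simp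

end Haar

/-! ### Polynomial maps on residue classes -/

section PolyMap

variable {p : ℕ} [Fact p.Prime] {n : ℕ}

theorem toZMod_eq_zero_iff_dvd {x : ℤ_[p]} : PadicInt.toZMod x = 0 ↔ (p : ℤ_[p]) ∣ x := by
  rw [← RingHom.mem_ker, PadicInt.ker_toZMod, PadicInt.maximalIdeal_eq_span_p,
    Ideal.mem_span_singleton]

theorem toZMod_eq_zero_iff_norm {x : ℤ_[p]} : PadicInt.toZMod x = 0 ↔ ‖x‖ ≤ (p : ℝ)⁻¹ := by
  rw [toZMod_eq_zero_iff_dvd]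
  have := PadicInt.norm_le_pow_iff_mem_span_pow x 1
  simp only [Nat.cast_one, pow_one, zpow_neg, zpow_one, Ideal.mem_span_singleton] at this
  exact this.symm

theorem toZMod_ne_zero_iff_norm {x : ℤ_[p]} : PadicInt.toZMod x ≠ 0 ↔ ‖x‖ = 1 := by
  rw [Ne, toZMod_eq_zero_iff_dvd, ← PadicInt.norm_lt_one_iff_dvd, not_lt]
  exact ⟨fun h => le_antisymm (PadicInt.norm_le_one x) h, fun h => h.ge⟩

theorem norm_sum_le_of_forall_le {ι : Type*} (s : Finset ι) (F : ι → ℤ_[p]) {C : ℝ} (hC : 0 ≤ C)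
    (h : ∀ i ∈ s, ‖F i‖ ≤ C) : ‖∑ i ∈ s, F i‖ ≤ C := by
  induction s using Finset.cons_induction with
  | empty => simpa using hC
  | cons a s ha ih =>
    rw [Finset.sum_cons]
    exact (PadicInt.nonarchimedean _ _).trans
      (max_le (h a (by simp)) (ih fun i hi => h i (by simp [hi])))

theorem norm_add_le_of_le {x y : ℤ_[p]} {C : ℝ} (hx : ‖x‖ ≤ C) (hy : ‖y‖ ≤ C) : ‖x + y‖ ≤ C :=
  (PadicInt.nonarchimedean _ _).trans (max_le hx hy)

theorem norm_eval_sub_eval_le (H : MvPolynomial (Fin n) ℤ_[p]) (x y : Fin n → ℤ_[p]) :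
    ‖MvPolynomial.eval x H - MvPolynomial.eval y H‖ ≤ ‖x - y‖ := by
  induction H using MvPolynomial.induction_on with
  | C a => simp
  | add P Q hP hQ =>
    rw [map_add, map_add, add_sub_add_comm]
    exact norm_add_le_of_le hP hQ
  | mul_X P i hP =>
    rw [map_mul, map_mul, MvPolynomial.eval_X, MvPolynomial.eval_X,
      show ∀ a b c d : ℤ_[p], a * b - c * d = (a - c) * b + c * (b - d) by intros; ring]
    refine norm_add_le_of_le ?_ ?_
    · rw [norm_mul]
      exact (mul_le_of_le_one_right (norm_nonneg _) (PadicInt.norm_le_one _)).trans hP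
    · rw [norm_mul]
      exact (mul_le_of_le_one_left (norm_nonneg _) (PadicInt.norm_le_one _)).trans
        (norm_le_pi_norm (x - y) i)

/-- A first-order expansion with the derivative frozen at `a`. Since `x` and `y` both lie in the
residue class of `a`, the error gains a factor `1/p` over the trivial bound. -/
theorem norm_eval_sub_linear_le (H : MvPolynomial (Fin n) ℤ_[p]) {a x y : Fin n → ℤ_[p]}
    (hx : ‖x - a‖ ≤ (p : ℝ)⁻¹) (hy : ‖y - a‖ ≤ (p : ℝ)⁻¹) :
    ‖MvPolynomial.eval x H - MvPolynomial.eval y H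
      - ∑ j, MvPolynomial.eval a (MvPolynomial.pderiv j H) * (x j - y j)‖
      ≤ (p : ℝ)⁻¹ * ‖x - y‖ := by
  have hp : (0 : ℝ) ≤ (p : ℝ)⁻¹ := by positivity
  induction H using MvPolynomial.induction_on with
  | C c =>
    simp only [MvPolynomial.eval_C, MvPolynomial.pderiv_C, map_zero, zero_mul,
      Finset.sum_const_zero, sub_self, norm_zero]
    positivity
  | add P Q hP hQ =>
    have := norm_add_le_of_le hP hQ
    simp only [map_add, add_mul, Finset.sum_add_distrib]
    convert this using 2
    ring
  | mul_X P i hP =>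
    have hsum : ∑ j, MvPolynomial.eval a (MvPolynomial.pderiv j (P * MvPolynomial.X i))
        * (x j - y j) = (∑ j, MvPolynomial.eval a (MvPolynomial.pderiv j P) * (x j - y j)) * a i
          + MvPolynomial.eval a P * (x i - y i) := by
      rw [Finset.sum_mul]
      simp only [MvPolynomial.pderiv_mul, MvPolynomial.pderiv_X, map_add, map_mul,
        MvPolynomial.eval_X, add_mul, Finset.sum_add_distrib]
      congr 1
      · exact Finset.sum_congr rfl fun j _ => by ring
      · rw [Finset.sum_eq_single i]
        · simp
        · intro j _ hj
          simp [hj.symm]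
        · simp
    rw [hsum, map_mul, map_mul, MvPolynomial.eval_X, MvPolynomial.eval_X]
    set L := ∑ j, MvPolynomial.eval a (MvPolynomial.pderiv j P) * (x j - y j) with hL
    -- The splitting leaves in each summand either the error already bounded for `P` or a difference
    -- from `a`, of norm at most `1/p`, times a difference of order `x - y`.
    have key : MvPolynomial.eval x P * x i - MvPolynomial.eval y P * y i
        - (L * a i + MvPolynomial.eval a P * (x i - y i))
        = (MvPolynomial.eval x P - MvPolynomial.eval y P - L) * a i
          + ((MvPolynomial.eval x P - MvPolynomial.eval y P) * (x i - a i)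
          + (MvPolynomial.eval y P - MvPolynomial.eval a P) * (x i - y i)) := by ring
    rw [key]
    refine norm_add_le_of_le ?_ (norm_add_le_of_le ?_ ?_)
    · rw [norm_mul]
      exact (mul_le_of_le_one_right (norm_nonneg _) (PadicInt.norm_le_one _)).trans hP
    · rw [norm_mul, mul_comm]
      exact mul_le_mul ((norm_le_pi_norm (x - a) i).trans hx) (norm_eval_sub_eval_le _ _ _)
        (norm_nonneg _) hp
    · rw [norm_mul]
      exact mul_le_mul ((norm_eval_sub_eval_le _ _ _).trans hy) (norm_le_pi_norm (x - y) i)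
        (norm_nonneg _) hp

theorem norm_mulVec_le (M : Matrix (Fin n) (Fin n) ℤ_[p]) (w : Fin n → ℤ_[p]) :
    ‖M.mulVec w‖ ≤ ‖w‖ := by
  refine (pi_norm_le_iff_of_nonneg (norm_nonneg _)).2 fun i => ?_
  refine norm_sum_le_of_forall_le _ _ (norm_nonneg _) fun j _ => ?_
  rw [norm_mul]
  exact (mul_le_of_le_one_left (norm_nonneg _) (PadicInt.norm_le_one _)).trans
    (norm_le_pi_norm w j)

/-- Injectivity modulo `p` makes the determinant a unit, so both `M` and its inverse are integral
and neither increases norms. -/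
theorem norm_mulVec_eq (M : Matrix (Fin n) (Fin n) ℤ_[p])
    (hM : ∀ v : Fin n → ZMod p, (M.map PadicInt.toZMod).mulVec v = 0 → v = 0)
    (w : Fin n → ℤ_[p]) : ‖M.mulVec w‖ = ‖w‖ := by
  have hdet : IsUnit M.det := by
    rw [PadicInt.isUnit_iff, ← toZMod_ne_zero_iff_norm, RingHom.map_det]
    intro h
    obtain ⟨v, hv, hv0⟩ := Matrix.exists_mulVec_eq_zero_iff.2 h
    exact hv (hM v hv0)
  refine le_antisymm (norm_mulVec_le M w) ?_
  have h := norm_mulVec_le M⁻¹ (M.mulVec w)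
  rwa [Matrix.mulVec_mulVec, Matrix.nonsing_inv_mul _ hdet, Matrix.one_mulVec] at h

/-- A form of Hensel's lemma: on the residue class of `a` the map is its linear part, which
preserves norms, plus a strictly smaller error. By the ultrametric inequality the error does not
change the norm of a difference. -/
theorem exists_isometry_of_polyMap (H : Fin n → MvPolynomial (Fin n) ℤ_[p]) (a : Fin n → ℤ_[p])
    (h0 : ∀ i, PadicInt.toZMod (MvPolynomial.eval a (H i)) = 0)
    (hM : ∀ v : Fin n → ZMod p,
      (∀ i, ∑ j, PadicInt.toZMod (MvPolynomial.eval a (MvPolynomial.pderiv j (H i))) * v j = 0) →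
        v = 0) :
    ∃ T : (Fin n → ℤ_[p]) → (Fin n → ℤ_[p]), Isometry T ∧
      ∀ u i, MvPolynomial.eval (fun j => a j + p * u j) (H i) = p * T u i := by
  have hp0 : (0 : ℝ) < (p : ℝ)⁻¹ := inv_pos.2 (Nat.cast_pos.2 (Fact.out : p.Prime).pos)
  have hp1 : (p : ℝ)⁻¹ < 1 := inv_lt_one_of_one_lt₀ (Nat.one_lt_cast.2 (Fact.out : p.Prime).one_lt)
  have hball : ∀ u : Fin n → ℤ_[p], ‖(fun j => a j + p * u j) - a‖ ≤ (p : ℝ)⁻¹ := by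
    intro u
    refine (pi_norm_le_iff_of_nonneg hp0.le).2 fun i => ?_
    rw [← toZMod_eq_zero_iff_norm]
    simp
  have hdvd : ∀ (u : Fin n → ℤ_[p]) (i : Fin n),
      (p : ℤ_[p]) ∣ MvPolynomial.eval (fun j => a j + p * u j) (H i) := by
    intro u i
    have h : PadicInt.toZMod (MvPolynomial.eval (fun j => a j + p * u j) (H i)
        - MvPolynomial.eval a (H i)) = 0 := toZMod_eq_zero_iff_norm.2 ?_
    · rwa [map_sub, h0 i, sub_zero, toZMod_eq_zero_iff_dvd] at h
    exact (norm_eval_sub_eval_le _ _ _).trans (hball u)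
  choose T hT using hdvd
  refine ⟨T, Isometry.of_dist_eq fun u v => ?_, hT⟩
  have hpnorm : ∀ w : Fin n → ℤ_[p], ‖fun j => (p : ℤ_[p]) * w j‖ = (p : ℝ)⁻¹ * ‖w‖ := by
    intro w
    have : (fun j => (p : ℤ_[p]) * w j) = (p : ℤ_[p]) • w := rfl
    rw [this, norm_smul, PadicInt.norm_p]
  let M : Matrix (Fin n) (Fin n) ℤ_[p] :=
    Matrix.of fun i j => MvPolynomial.eval a (MvPolynomial.pderiv j (H i))
  have hMw := norm_mulVec_eq M (fun v hv => hM v fun i => congr_fun hv i)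
    (fun j => (p : ℤ_[p]) * (u - v) j)
  rw [hpnorm] at hMw
  have hdiff : ‖(fun i => (p : ℤ_[p]) * (T u - T v) i)
      - M.mulVec (fun j => (p : ℤ_[p]) * (u - v) j)‖ ≤ (p : ℝ)⁻¹ * ((p : ℝ)⁻¹ * ‖u - v‖) := by
    refine (pi_norm_le_iff_of_nonneg (by positivity)).2 fun i => ?_
    have h := norm_eval_sub_linear_le (H i) (hball u) (hball v)
    have hsub : (fun j => a j + p * u j) - (fun j => a j + p * v j)
        = fun j => (p : ℤ_[p]) * (u - v) j := by
      ext j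
      simp [mul_sub]
    rw [hsub, hpnorm, hT, hT] at h
    have hi : ((fun i => (p : ℤ_[p]) * (T u - T v) i)
        - M.mulVec (fun j => (p : ℤ_[p]) * (u - v) j)) i
        = p * T u i - p * T v i - ∑ j, MvPolynomial.eval a (MvPolynomial.pderiv j (H i))
          * (a j + p * u j - (a j + p * v j)) := by
      simp [Matrix.mulVec, dotProduct, M, mul_sub]
    rw [hi]
    exact h
  rw [dist_eq_norm, dist_eq_norm]
  have hTe := hpnorm (T u - T v)
  rcases eq_or_ne u v with rfl | huv
  · simp
  have hpos : 0 < ‖u - v‖ := norm_pos_iff.2 (sub_ne_zero.2 huv)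
  have hlt : ‖(fun i => (p : ℤ_[p]) * (T u - T v) i)
      - M.mulVec (fun j => (p : ℤ_[p]) * (u - v) j)‖
      < ‖M.mulVec (fun j => (p : ℤ_[p]) * (u - v) j)‖ := by
    rw [hMw]
    refine hdiff.trans_lt ?_
    have : 0 < (p : ℝ)⁻¹ * ‖u - v‖ := by positivity
    nlinarith
  have heq := IsUltrametricDist.norm_add_eq_max_of_norm_ne_norm hlt.ne
  rw [sub_add_cancel, max_eq_right hlt.le, hTe, hMw] at heq
  exact mul_left_cancel₀ hp0.ne' heq

theorem integral_polyMap (H : Fin n → MvPolynomial (Fin n) ℤ_[p]) (a : Fin n → ℤ_[p])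
    (h0 : ∀ i, PadicInt.toZMod (MvPolynomial.eval a (H i)) = 0)
    (hM : ∀ v : Fin n → ZMod p,
      (∀ i, ∑ j, PadicInt.toZMod (MvPolynomial.eval a (MvPolynomial.pderiv j (H i))) * v j = 0) →
        v = 0) (φ : (Fin n → ℤ_[p]) → ℂ) :
    ∫ u, φ (fun i => MvPolynomial.eval (fun j => a j + p * u j) (H i)) ∂haar p n =
      ∫ y, φ (fun i => p * y i) ∂haar p n := by
  obtain ⟨T, hT, hTH⟩ := exists_isometry_of_polyMap H a h0 hM
  simp only [hTH]
  exact (hT.measurePreserving_of_ultrametric (haar p n)).integral_comp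
    hT.isClosedEmbedding.measurableEmbedding (fun y => φ fun i => p * y i)

theorem integral_haar_eval (i : Fin n) (φ : ℤ_[p] → ℂ) (hφ : Continuous φ) :
    ∫ y, φ (y i) ∂haar p n = ∫ y, φ y ∂haarOne p := by
  have h := measurePreserving_eval (fun _ : Fin n => haarOne p) i
  conv_rhs => rw [← h.map_eq]
  rw [haar_eq_pi, integral_map h.measurable.aemeasurable hφ.aestronglyMeasurable]

/-- Fubini for a product measure, with the constant 1 as integrand in every coordinate other than
`i` and `j`. -/
theorem integral_haar_eval_mul_eval {i j : Fin n} (hij : i ≠ j) (φ ψ : ℤ_[p] → ℂ) :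
    ∫ y, φ (y i) * ψ (y j) ∂haar p n = (∫ y, φ y ∂haarOne p) * ∫ y, ψ y ∂haarOne p := by
  have hprod : ∀ A B : ℂ, (∏ l : Fin n, if l = i then A else if l = j then B else 1) = A * B := by
    intro A B
    rw [← Finset.mul_prod_erase _ _ (Finset.mem_univ i), if_pos rfl]
    congr 1
    rw [← Finset.mul_prod_erase _ _ (Finset.mem_erase.2 ⟨hij.symm, Finset.mem_univ j⟩),
      if_neg hij.symm, if_pos rfl]
    rw [Finset.prod_eq_one, mul_one]
    intro l hl
    simp only [Finset.mem_erase] at hl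
    rw [if_neg hl.2.1, if_neg hl.1]
  have h := integral_fintype_prod_eq_prod (𝕜 := ℂ) (μ := fun _ : Fin n => haarOne p)
    (fun l y => if l = i then φ y else if l = j then ψ y else 1)
  rw [haar_eq_pi, ← hprod (∫ y, φ y ∂haarOne p)]
  convert h using 1
  · refine integral_congr_ae (Filter.Eventually.of_forall fun y => ?_)
    change φ (y i) * ψ (y j) = _
    rw [← hprod]
    refine Finset.prod_congr rfl fun l _ => ?_
    by_cases hi : l = i
    · simp [hi]
    · by_cases hj : l = j
      · simp [hj, hij.symm]
      · simp [hi, hj]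
  · refine Finset.prod_congr rfl fun l _ => ?_
    by_cases hi : l = i
    · simp [hi]
    · by_cases hj : l = j
      · simp [hj, hij.symm]
      · simp [hi, hj]

/-- The linear polynomials `x_l - a_l`. -/
def coordPoly (a : Fin n → ℤ_[p]) (l : Fin n) : MvPolynomial (Fin n) ℤ_[p] :=
  MvPolynomial.X l - MvPolynomial.C (a l)

theorem eval_coordPoly (a : Fin n → ℤ_[p]) (l : Fin n) :
    MvPolynomial.eval a (coordPoly a l) = 0 := by
  simp [coordPoly]

theorem sum_pderiv_coordPoly (a : Fin n → ℤ_[p]) (l : Fin n) (v : Fin n → ZMod p) :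
    ∑ j, PadicInt.toZMod (MvPolynomial.eval a (MvPolynomial.pderiv j (coordPoly a l))) * v j
      = v l := by
  rw [Finset.sum_eq_single l]
  · simp [coordPoly]
  · intro j _ hj
    simp [coordPoly, MvPolynomial.pderiv_X, hj.symm]
  · simp

/-- `F` takes the place of the `i`-th translated coordinate; the Jacobian of the resulting system is
then invertible because its only non-trivial diagonal entry is `∂F/∂x_i`. -/
theorem integral_comp_poly (F : MvPolynomial (Fin n) ℤ_[p]) (a : Fin n → ℤ_[p])
    (h0 : PadicInt.toZMod (MvPolynomial.eval a F) = 0) {i : Fin n}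
    (hi : PadicInt.toZMod (MvPolynomial.eval a (MvPolynomial.pderiv i F)) ≠ 0)
    (φ : ℤ_[p] → ℂ) (hφ : Continuous φ) :
    ∫ u, φ (MvPolynomial.eval (fun j => a j + p * u j) F) ∂haar p n =
      ∫ y, φ (p * y) ∂haarOne p := by
  have h := integral_polyMap (Function.update (coordPoly a) i F) a ?_ ?_ (fun y => φ (y i))
  · simp only [Function.update_self] at h
    rw [h]
    exact integral_haar_eval i (fun y => φ ((p : ℤ_[p]) * y)) (by fun_prop)
  · intro l
    rcases eq_or_ne l i with rfl | hl
    · simpa using h0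
    · simp [Function.update_of_ne hl, eval_coordPoly]
  · intro v hv
    have hl : ∀ l, l ≠ i → v l = 0 := by
      intro l hl
      have := hv l
      rwa [Function.update_of_ne hl, sum_pderiv_coordPoly] at this
    have h1 := hv i
    rw [Function.update_self, Finset.sum_eq_single i (fun j _ hj => by rw [hl j hj, mul_zero])
      (by simp)] at h1
    ext1 l
    rcases eq_or_ne l i with rfl | h
    · exact (mul_eq_zero.1 h1).resolve_left hi
    · exact hl l h

/-- `F` and `G` replace the coordinates `i` and `j`. Invertibility of the whole Jacobian reduces to
the given two-by-two minor, and the two values become independent variables. -/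
theorem integral_comp_poly_mul_comp_poly (F G : MvPolynomial (Fin n) ℤ_[p]) (a : Fin n → ℤ_[p])
    (hF : PadicInt.toZMod (MvPolynomial.eval a F) = 0)
    (hG : PadicInt.toZMod (MvPolynomial.eval a G) = 0) {i j : Fin n} (hij : i ≠ j)
    (hdet : PadicInt.toZMod (MvPolynomial.eval a (MvPolynomial.pderiv i F)) *
        PadicInt.toZMod (MvPolynomial.eval a (MvPolynomial.pderiv j G)) -
      PadicInt.toZMod (MvPolynomial.eval a (MvPolynomial.pderiv j F)) *
        PadicInt.toZMod (MvPolynomial.eval a (MvPolynomial.pderiv i G)) ≠ 0)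
    (φ ψ : ℤ_[p] → ℂ) :
    ∫ u, φ (MvPolynomial.eval (fun l => a l + p * u l) F) *
        ψ (MvPolynomial.eval (fun l => a l + p * u l) G) ∂haar p n =
      (∫ y, φ (p * y) ∂haarOne p) * ∫ y, ψ (p * y) ∂haarOne p := by
  have h := integral_polyMap (Function.update (Function.update (coordPoly a) i F) j G) a ?_ ?_
    (fun y => φ (y i) * ψ (y j))
  · simp only [Function.update_self, Function.update_of_ne hij] at h
    rw [h]
    exact integral_haar_eval_mul_eval hij (fun y => φ ((p : ℤ_[p]) * y))
      (fun y => ψ ((p : ℤ_[p]) * y))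
  · intro l
    rcases eq_or_ne l j with rfl | hl
    · simpa using hG
    · rcases eq_or_ne l i with rfl | hl'
      · simpa [Function.update_of_ne hl] using hF
      · simp [Function.update_of_ne hl, Function.update_of_ne hl', eval_coordPoly]
  · intro v hv
    have hl : ∀ l, l ≠ i → l ≠ j → v l = 0 := by
      intro l hi hj
      have := hv l
      rwa [Function.update_of_ne hj, Function.update_of_ne hi, sum_pderiv_coordPoly] at this
    have hsum : ∀ c : Fin n → ZMod p, ∑ l, c l * v l = c i * v i + c j * v j := by
      intro c
      rw [← Finset.add_sum_erase _ _ (Finset.mem_univ i), Finset.sum_eq_single j]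
      · intro l h1 h2
        rw [hl l (Finset.mem_erase.1 h1).1 h2, mul_zero]
      · intro h
        exact absurd (Finset.mem_erase.2 ⟨hij.symm, Finset.mem_univ j⟩) h
    have h1 := hv i
    have h2 := hv j
    rw [Function.update_of_ne hij, Function.update_self, hsum] at h1
    rw [Function.update_self, hsum] at h2
    have hvi : v i = 0 := by
      refine (mul_eq_zero.1 (?_ : _ * v i = 0)).resolve_left hdet
      linear_combination PadicInt.toZMod (MvPolynomial.eval a (MvPolynomial.pderiv j G)) * h1
        - PadicInt.toZMod (MvPolynomial.eval a (MvPolynomial.pderiv j F)) * h2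
    have hvj : v j = 0 := by
      refine (mul_eq_zero.1 (?_ : _ * v j = 0)).resolve_left hdet
      linear_combination PadicInt.toZMod (MvPolynomial.eval a (MvPolynomial.pderiv i F)) * h2
        - PadicInt.toZMod (MvPolynomial.eval a (MvPolynomial.pderiv i G)) * h1
    ext1 l
    by_cases hi : l = i
    · rw [hi, hvi]; rfl
    · by_cases hj : l = j
      · rw [hj, hvj]; rfl
      · exact hl l hi hj

end PolyMap

/-! ### The integral `∫ |y|^s |dy|` -/

section OneDim

variable {p : ℕ} [Fact p.Prime]

theorem natCast_prime_complex_ne_zero : (p : ℂ) ≠ 0 :=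
  Nat.cast_ne_zero.2 (Fact.out : p.Prime).ne_zero

theorem continuous_norm_cpow {s : ℂ} (hs : 0 < s.re) :
    Continuous fun y : ℤ_[p] => ((‖y‖ : ℝ) : ℂ) ^ s :=
  (Complex.continuous_ofReal_cpow_const hs).comp continuous_norm

theorem natCast_prime_cpow_eq_one_imp {z : ℂ} (h : (p : ℂ) ^ z = 1) : z.re = 0 := by
  have h1 := congr_arg norm h
  rw [Complex.norm_natCast_cpow_of_pos (Fact.out : p.Prime).pos, norm_one] at h1
  have hp : (1 : ℝ) < p := Nat.one_lt_cast.2 (Fact.out : p.Prime).one_lt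
  have h2 := congr_arg Real.log h1
  rw [Real.log_rpow (by positivity), Real.log_one] at h2
  exact (mul_eq_zero.1 h2).resolve_right (Real.log_pos hp).ne'

theorem norm_p_mul_cpow (s : ℂ) (y : ℤ_[p]) :
    ((‖(p : ℤ_[p]) * y‖ : ℝ) : ℂ) ^ s = (p : ℂ) ^ (-s) * ((‖y‖ : ℝ) : ℂ) ^ s := by
  rw [norm_mul, Complex.ofReal_mul, Complex.mul_cpow_ofReal_nonneg (norm_nonneg _) (norm_nonneg _),
    PadicInt.norm_p, Complex.ofReal_inv, Complex.ofReal_natCast, Complex.cpow_neg,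
    Complex.inv_cpow _ _ (by rw [Complex.natCast_arg]; exact Real.pi_pos.ne)]

/-- Write `I = ∫ |y|^s` and `J = ∫ |p y|^s`. Splitting `ℤ_p` into `p ℤ_p` and the units gives `I = J
/ p + (1 - 1 / p)`, while homogeneity gives `J = p ^ (-s) I`; these two equations determine `J`. -/
theorem integral_norm_p_mul_cpow {s : ℂ} (hs : 0 < s.re) :
    ∫ y, ((‖(p : ℤ_[p]) * y‖ : ℝ) : ℂ) ^ s ∂haarOne p =
      ((p : ℂ) - 1) / ((p : ℂ) ^ (s + 1) - 1) := by
  have hp : (p : ℂ) ≠ 0 := natCast_prime_complex_ne_zero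
  let φ : ℤ_[p] →+ ℤ_[p] := AddMonoidHom.mulLeft (p : ℤ_[p])
  have hφc : Continuous φ := continuous_const.mul continuous_id
  have hφ : MeasurableEmbedding φ :=
    (hφc.isClosedEmbedding (mul_right_injective₀ natCast_prime_ne_zero)).measurableEmbedding
  have hrange : (haarOne p).real (range φ) = (p : ℝ)⁻¹ := by
    have h := haarOne_range_pow_mul p 1
    simp only [pow_one] at h
    have hr : range φ = range fun y : ℤ_[p] => (p : ℤ_[p]) * y := rfl
    rw [Measure.real, hr, h]
    simp
  have hmeas : MeasurableSet (range φ) := (isCompact_range hφc).isClosed.measurableSet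
  have hint : Integrable (fun y : ℤ_[p] => ((‖y‖ : ℝ) : ℂ) ^ s) (haarOne p) :=
    (continuous_norm_cpow hs).integrable_of_hasCompactSupport
      (HasCompactSupport.of_compactSpace _)
  have hsplit := integral_add_compl hmeas hint
  rw [setIntegral_range_of_measurableEmbedding _ φ hφ, hrange] at hsplit
  have hcompl : ∫ y in (range φ)ᶜ, ((‖y‖ : ℝ) : ℂ) ^ s ∂haarOne p = 1 - (p : ℂ)⁻¹ := by
    have h1 : ∫ y in (range φ)ᶜ, ((‖y‖ : ℝ) : ℂ) ^ s ∂haarOne p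
        = ∫ y in (range φ)ᶜ, (1 : ℂ) ∂haarOne p := by
      refine setIntegral_congr_fun hmeas.compl fun y hy => ?_
      have : ‖y‖ = 1 := by
        rw [← toZMod_ne_zero_iff_norm, Ne, toZMod_eq_zero_iff_dvd]
        rintro ⟨c, rfl⟩
        exact hy ⟨c, rfl⟩
      simp [this]
    rw [h1, setIntegral_const, measureReal_compl hmeas, hrange]
    simp
  have hφy : ∀ y, φ y = (p : ℤ_[p]) * y := fun _ => rfl
  rw [hcompl] at hsplit
  simp only [hφy] at hsplit
  set J := ∫ y, ((‖(p : ℤ_[p]) * y‖ : ℝ) : ℂ) ^ s ∂haarOne p with hJ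
  have hJI : J = (p : ℂ) ^ (-s) * ∫ y, ((‖y‖ : ℝ) : ℂ) ^ s ∂haarOne p := by
    rw [hJ, ← integral_const_mul]
    simp only [norm_p_mul_cpow]
  have hne : (p : ℂ) ^ (s + 1) - 1 ≠ 0 := by
    intro h
    have := natCast_prime_cpow_eq_one_imp (sub_eq_zero.1 h)
    simp at this
    linarith
  rw [eq_div_iff hne]
  rw [← hsplit, Complex.cpow_neg, Complex.real_smul] at hJI
  have hps : (p : ℂ) ^ s ≠ 0 := by simp [Complex.cpow_eq_zero_iff, hp]
  rw [Complex.cpow_add _ _ hp, Complex.cpow_one]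
  push_cast at hJI
  field_simp at hJI
  linear_combination hJI

end OneDim

/-! ### First meet loci and the partition `Δ_{f,g}` -/

section NewtonFacts

variable {R : Type*} [CommRing R] {n : ℕ}

/-- The exponent `ω` as a real vector. -/
abbrev expVec (ω : Fin n →₀ ℕ) : Fin n → ℝ := natVec (ω : Fin n → ℕ)

theorem expVec_mem_newtonPolyhedron {f : MvPolynomial (Fin n) R} {ω : Fin n →₀ ℕ}
    (hω : ω ∈ f.support) {x : Fin n → ℝ} (hx : ∀ i, expVec ω i ≤ x i) :
    x ∈ newtonPolyhedron f :=
  subset_convexHull ℝ _ (mem_iUnion₂.2 ⟨ω, hω, hx⟩)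

theorem le_dotProduct_of_mem_newtonPolyhedron {f : MvPolynomial (Fin n) R} {k : Fin n → ℝ}
    (hk : ∀ i, 0 ≤ k i) {c : ℝ} (h : ∀ ω ∈ f.support, c ≤ k ⬝ᵥ expVec ω) {x : Fin n → ℝ}
    (hx : x ∈ newtonPolyhedron f) : c ≤ k ⬝ᵥ x := by
  have hconv : Convex ℝ {x : Fin n → ℝ | c ≤ k ⬝ᵥ x} :=
    convex_halfSpace_ge ⟨fun x y => dotProduct_add k x y, fun a x => dotProduct_smul a k x⟩ c
  refine convexHull_min ?_ hconv hx
  refine iUnion₂_subset fun ω hω y hy => (h ω hω).trans ?_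
  exact Finset.sum_le_sum fun i _ => mul_le_mul_of_nonneg_left (hy i) (hk i)

theorem mf_eq_of_forall_le {f : MvPolynomial (Fin n) R} {k : Fin n → ℝ} (hk : ∀ i, 0 ≤ k i)
    {ω₀ : Fin n →₀ ℕ} (hω₀ : ω₀ ∈ f.support)
    (h : ∀ ω ∈ f.support, k ⬝ᵥ expVec ω₀ ≤ k ⬝ᵥ expVec ω) : mf f k = k ⬝ᵥ expVec ω₀ := by
  have hleast : IsLeast ((fun x => k ⬝ᵥ x) '' newtonPolyhedron f) (k ⬝ᵥ expVec ω₀) := by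
    refine ⟨⟨_, expVec_mem_newtonPolyhedron hω₀ fun _ => le_rfl, rfl⟩, ?_⟩
    rintro _ ⟨x, hx, rfl⟩
    exact le_dotProduct_of_mem_newtonPolyhedron hk h hx
  exact hleast.csInf_eq

theorem exists_mf_eq {f : MvPolynomial (Fin n) R} (hf : f ≠ 0) {k : Fin n → ℝ}
    (hk : ∀ i, 0 ≤ k i) : ∃ ω₀ ∈ f.support, mf f k = k ⬝ᵥ expVec ω₀ ∧
      ∀ ω ∈ f.support, k ⬝ᵥ expVec ω₀ ≤ k ⬝ᵥ expVec ω := by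
  obtain ⟨ω₀, hω₀, h⟩ := f.support.exists_min_image (fun ω => k ⬝ᵥ expVec ω)
    (MvPolynomial.support_nonempty.2 hf)
  exact ⟨ω₀, hω₀, mf_eq_of_forall_le hk hω₀ h, h⟩

theorem mf_le {f : MvPolynomial (Fin n) R} {k : Fin n → ℝ} (hk : ∀ i, 0 ≤ k i)
    {ω : Fin n →₀ ℕ} (hω : ω ∈ f.support) : mf f k ≤ k ⬝ᵥ expVec ω := by
  have hf : f ≠ 0 := MvPolynomial.support_nonempty.1 ⟨ω, hω⟩
  obtain ⟨ω₀, -, h, hmin⟩ := exists_mf_eq hf hk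
  exact h ▸ hmin ω hω

theorem dotProduct_expVec_nonneg {k : Fin n → ℝ} (hk : ∀ i, 0 ≤ k i) (ω : Fin n →₀ ℕ) :
    0 ≤ k ⬝ᵥ expVec ω :=
  Finset.sum_nonneg fun i _ => mul_nonneg (hk i) (Nat.cast_nonneg _)

theorem mf_nonneg {f : MvPolynomial (Fin n) R} (hf : f ≠ 0) {k : Fin n → ℝ} (hk : ∀ i, 0 ≤ k i) :
    0 ≤ mf f k := by
  obtain ⟨ω₀, -, h, -⟩ := exists_mf_eq hf hk
  exact h ▸ dotProduct_expVec_nonneg hk ω₀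

theorem mf_le_dotProduct {f : MvPolynomial (Fin n) R} {k : Fin n → ℝ} (hk : ∀ i, 0 ≤ k i)
    {x : Fin n → ℝ} (hx : x ∈ newtonPolyhedron f) : mf f k ≤ k ⬝ᵥ x :=
  le_dotProduct_of_mem_newtonPolyhedron hk (fun _ hω => mf_le hk hω) hx

theorem mem_firstMeetLocus_expVec {f : MvPolynomial (Fin n) R} {k : Fin n → ℝ}
    {ω : Fin n →₀ ℕ} (hω : ω ∈ f.support) :
    expVec ω ∈ firstMeetLocus f k ↔ k ⬝ᵥ expVec ω = mf f k :=
  and_iff_right (expVec_mem_newtonPolyhedron hω fun _ => le_rfl)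

theorem isFace_firstMeetLocus {f : MvPolynomial (Fin n) R} (hf : f ≠ 0) {k : Fin n → ℝ}
    (hk : ∀ i, 0 ≤ k i) : IsFace f (firstMeetLocus f k) := by
  obtain ⟨ω₀, hω₀, h, -⟩ := exists_mf_eq hf hk
  refine ⟨⟨expVec ω₀, (mem_firstMeetLocus_expVec hω₀).2 h.symm⟩, fun _ => ?_⟩
  let l : (Fin n → ℝ) →L[ℝ] ℝ :=
    LinearMap.toContinuousLinearMap (-(dotProductBilin ℝ ℝ k))
  have hl : ∀ x, l x = -(k ⬝ᵥ x) := fun x => rfl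
  refine ⟨l, ?_⟩
  ext x
  simp only [firstMeetLocus, mem_ofPred_eq, hl, neg_le_neg_iff]
  refine and_congr_right fun hx => ⟨fun he y hy => he ▸ mf_le_dotProduct hk hy, fun hy => ?_⟩
  refine le_antisymm ?_ (mf_le_dotProduct hk hx)
  rw [h]
  exact hy _ (expVec_mem_newtonPolyhedron hω₀ fun _ => le_rfl)

theorem exists_nonneg_forall_le_mul {ι : Type*} (s : Finset ι) (u v : ι → ℝ)
    (hu : ∀ i ∈ s, 0 ≤ u i) (hv : ∀ i ∈ s, 0 ≤ v i) (h : ∀ i ∈ s, v i = 0 → u i = 0) :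
    ∃ C, 0 ≤ C ∧ ∀ i ∈ s, u i ≤ C * v i := by
  -- A single constant dominating every quotient; an index with `v i = 0` contributes `0` by the
  -- convention for division, and there `u i = 0` as well.
  refine ⟨∑ i ∈ s, u i / v i, Finset.sum_nonneg fun i hi => div_nonneg (hu i hi) (hv i hi), ?_⟩
  intro i hi
  rcases (hv i hi).eq_or_lt with h0 | hpos
  · rw [h i hi h0.symm, ← h0, mul_zero]
  · rw [← div_le_iff₀ hpos]
    exact Finset.single_le_sum (f := fun i => u i / v i)
      (fun j hj => div_nonneg (hu j hj) (hv j hj)) hi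

/-- The hypotheses say that `l` degenerates wherever `k` does, so for large `C` the vector `C k - l`
is non-negative and its values on the exponents are at least `C m_f(k) - m_f(l)`. This bound extends
to the whole polyhedron, and at a point minimal for `k` it reads `l · x ≤ m_f(l)`. -/
theorem firstMeetLocus_subset {f : MvPolynomial (Fin n) R} {k l : Fin n → ℝ}
    (hk : ∀ i, 0 ≤ k i) (hl : ∀ i, 0 ≤ l i) (hz : ∀ i, k i = 0 → l i = 0)
    (hA : ∀ ω ∈ f.support, k ⬝ᵥ expVec ω = mf f k → l ⬝ᵥ expVec ω = mf f l) :
    firstMeetLocus f k ⊆ firstMeetLocus f l := by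
  obtain ⟨C₁, hC₁, h₁⟩ := exists_nonneg_forall_le_mul f.support
    (fun ω => l ⬝ᵥ expVec ω - mf f l) (fun ω => k ⬝ᵥ expVec ω - mf f k)
    (fun ω hω => sub_nonneg.2 (mf_le hl hω)) (fun ω hω => sub_nonneg.2 (mf_le hk hω))
    (fun ω hω h => sub_eq_zero.2 (hA ω hω (sub_eq_zero.1 h)))
  obtain ⟨C₂, hC₂, h₂⟩ := exists_nonneg_forall_le_mul Finset.univ l k
    (fun i _ => hl i) (fun i _ => hk i) (fun i _ h => hz i h)
  have hkey : ∀ ω ∈ f.support, mf f k * (C₁ + C₂) - mf f l ≤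
      ((C₁ + C₂) • k - l) ⬝ᵥ expVec ω := by
    intro ω hω
    rw [sub_dotProduct, smul_dotProduct, smul_eq_mul]
    have h := h₁ ω hω
    have := mul_nonneg hC₂ (sub_nonneg.2 (mf_le hk hω))
    nlinarith
  have hpos : ∀ i, 0 ≤ ((C₁ + C₂) • k - l) i := by
    intro i
    have := h₂ i (Finset.mem_univ i)
    have := mul_nonneg hC₁ (hk i)
    simp only [Pi.sub_apply, Pi.smul_apply, smul_eq_mul]
    nlinarith
  rintro x ⟨hx, hxk⟩
  refine ⟨hx, le_antisymm ?_ (mf_le_dotProduct hl hx)⟩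
  have h := le_dotProduct_of_mem_newtonPolyhedron hpos hkey hx
  rw [sub_dotProduct, smul_dotProduct, smul_eq_mul, hxk] at h
  nlinarith

/-- If `k i = 0`, the first meet locus contains a translate of one of its points by the `i`-th unit
vector; `l` is constant on the same set, so it kills that direction. -/
theorem eq_zero_iff_of_firstMeetLocus_eq {f : MvPolynomial (Fin n) R} (hf : f ≠ 0)
    {k l : Fin n → ℝ} (hk : ∀ i, 0 ≤ k i) (h : firstMeetLocus f k = firstMeetLocus f l)
    {i : Fin n} (hki : k i = 0) : l i = 0 := by
  obtain ⟨ω₀, hω₀, hm, -⟩ := exists_mf_eq hf hk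
  have h0 : expVec ω₀ ∈ firstMeetLocus f l := h ▸ (mem_firstMeetLocus_expVec hω₀).2 hm.symm
  have h1 : expVec ω₀ + Pi.single i 1 ∈ firstMeetLocus f l := by
    rw [← h]
    refine ⟨expVec_mem_newtonPolyhedron hω₀ fun j => ?_, ?_⟩
    · rw [Pi.add_apply, Pi.single_apply]
      split_ifs <;> simp
    · rw [dotProduct_add, dotProduct_single, hki, hm]
      simp
  have h2 := h1.2
  rw [dotProduct_add, dotProduct_single, h0.2] at h2
  simpa using h2

/-- This replaces equality of faces by a finite combinatorial pattern, from which both the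
finiteness of the partition and its description by linear forms follow. -/
theorem firstMeetLocus_eq_iff {f : MvPolynomial (Fin n) R} (hf : f ≠ 0) {k l : Fin n → ℝ}
    (hk : ∀ i, 0 ≤ k i) (hl : ∀ i, 0 ≤ l i) : firstMeetLocus f k = firstMeetLocus f l ↔
      (∀ i, k i = 0 ↔ l i = 0) ∧
      ∀ ω ∈ f.support, (k ⬝ᵥ expVec ω = mf f k ↔ l ⬝ᵥ expVec ω = mf f l) := by
  constructor
  · intro h
    refine ⟨fun i => ⟨eq_zero_iff_of_firstMeetLocus_eq hf hk h,
      eq_zero_iff_of_firstMeetLocus_eq hf hl h.symm⟩, fun ω hω => ?_⟩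
    rw [← mem_firstMeetLocus_expVec hω, h, mem_firstMeetLocus_expVec hω]
  · rintro ⟨hz, hA⟩
    exact Subset.antisymm
      (firstMeetLocus_subset hk hl (fun i => (hz i).1) fun ω hω => (hA ω hω).1)
      (firstMeetLocus_subset hl hk (fun i => (hz i).2) fun ω hω => (hA ω hω).2)

/-- The cone in `Δ_{f,g}` that contains `k`. -/
def coneClass (f g : MvPolynomial (Fin n) R) (k : Fin n → ℝ) : Set (Fin n → ℝ) :=
  coneOf f (firstMeetLocus f k) ∩ coneOf g (firstMeetLocus g k)

theorem mem_coneClass_iff {f g : MvPolynomial (Fin n) R} {k l : Fin n → ℝ} :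
    l ∈ coneClass f g k ↔ (∀ i, 0 ≤ l i) ∧ firstMeetLocus f l = firstMeetLocus f k ∧
      firstMeetLocus g l = firstMeetLocus g k := by
  simp only [coneClass, coneOf, mem_inter_iff, mem_ofPred_eq]
  tauto

theorem self_mem_coneClass {f g : MvPolynomial (Fin n) R} {k : Fin n → ℝ} (hk : ∀ i, 0 ≤ k i) :
    k ∈ coneClass f g k :=
  mem_coneClass_iff.2 ⟨hk, rfl, rfl⟩

theorem coneClass_mem_conePartition {f g : MvPolynomial (Fin n) R} (hf : f ≠ 0) (hg : g ≠ 0)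
    {k : Fin n → ℝ} (hk : ∀ i, 0 ≤ k i) : coneClass f g k ∈ conePartition f g :=
  ⟨_, _, isFace_firstMeetLocus hf hk, isFace_firstMeetLocus hg hk, rfl, k, self_mem_coneClass hk⟩

theorem nonneg_of_mem_conePartition {f g : MvPolynomial (Fin n) R} {δ : Set (Fin n → ℝ)}
    (hδ : δ ∈ conePartition f g) {k : Fin n → ℝ} (hk : k ∈ δ) (i : Fin n) : 0 ≤ k i := by
  obtain ⟨τ, τ', -, -, rfl, -⟩ := hδ
  exact hk.1.1 i

theorem eq_coneClass_of_mem {f g : MvPolynomial (Fin n) R} {δ : Set (Fin n → ℝ)}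
    (hδ : δ ∈ conePartition f g) {k : Fin n → ℝ} (hk : k ∈ δ) : δ = coneClass f g k := by
  obtain ⟨τ, τ', -, -, rfl, -⟩ := hδ
  rw [coneClass, hk.1.2, hk.2.2]

theorem nonempty_of_mem_conePartition {f g : MvPolynomial (Fin n) R} {δ : Set (Fin n → ℝ)}
    (hδ : δ ∈ conePartition f g) : δ.Nonempty := by
  obtain ⟨τ, τ', -, -, -, h⟩ := hδ
  exact h

theorem faceOf_left_eq_firstMeetLocus {f g : MvPolynomial (Fin n) R} {δ : Set (Fin n → ℝ)}
    (hδ : δ ∈ conePartition f g) {k : Fin n → ℝ} (hk : k ∈ δ) :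
    faceOf f δ = firstMeetLocus f k := by
  rw [eq_coneClass_of_mem hδ hk]
  exact faceOf_eq_left f g ⟨k, self_mem_coneClass (nonneg_of_mem_conePartition hδ hk)⟩

theorem faceOf_right_eq_firstMeetLocus {f g : MvPolynomial (Fin n) R} {δ : Set (Fin n → ℝ)}
    (hδ : δ ∈ conePartition f g) {k : Fin n → ℝ} (hk : k ∈ δ) :
    faceOf g δ = firstMeetLocus g k := by
  rw [eq_coneClass_of_mem hδ hk]
  exact faceOf_eq_right f g ⟨k, self_mem_coneClass (nonneg_of_mem_conePartition hδ hk)⟩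

open Classical in
theorem finite_conePartition {f g : MvPolynomial (Fin n) R} (hf : f ≠ 0) (hg : g ≠ 0) :
    (conePartition f g).Finite := by
  have hne : ∀ δ : conePartition f g, ∃ k, k ∈ δ.1 := fun δ =>
    nonempty_of_mem_conePartition δ.2
  choose κ hκ using hne
  have h0 : ∀ δ i, 0 ≤ κ δ i := fun δ => nonneg_of_mem_conePartition δ.2 (hκ δ)
  -- The pattern of a representative of each cone: its zero coordinates and the exponents of `f` and
  -- of `g` that it minimizes.
  let t : conePartition f g → Finset (Fin n) × Finset f.support × Finset g.support := fun δ =>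
    (Finset.univ.filter fun i => κ δ i = 0,
      Finset.univ.filter fun ω => κ δ ⬝ᵥ expVec ω.1 = mf f (κ δ),
      Finset.univ.filter fun ω => κ δ ⬝ᵥ expVec ω.1 = mf g (κ δ))
  have hinj : Function.Injective t := by
    intro δ ε h
    have h1 : ∀ i, κ δ i = 0 ↔ κ ε i = 0 := fun i => by
      simpa [t] using Finset.ext_iff.1 (congr_arg Prod.fst h) i
    have h2 : ∀ ω (hω : ω ∈ f.support),
        κ δ ⬝ᵥ expVec ω = mf f (κ δ) ↔ κ ε ⬝ᵥ expVec ω = mf f (κ ε) := fun ω hω => by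
      simpa [t] using Finset.ext_iff.1 (congr_arg (fun z => z.2.1) h) ⟨ω, hω⟩
    have h3 : ∀ ω (hω : ω ∈ g.support),
        κ δ ⬝ᵥ expVec ω = mf g (κ δ) ↔ κ ε ⬝ᵥ expVec ω = mf g (κ ε) := fun ω hω => by
      simpa [t] using Finset.ext_iff.1 (congr_arg (fun z => z.2.2) h) ⟨ω, hω⟩
    have hF := (firstMeetLocus_eq_iff hf (h0 δ) (h0 ε)).2 ⟨h1, h2⟩
    have hG := (firstMeetLocus_eq_iff hg (h0 δ) (h0 ε)).2 ⟨h1, h3⟩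
    ext1
    rw [eq_coneClass_of_mem δ.2 (hκ δ), eq_coneClass_of_mem ε.2 (hκ ε), coneClass, coneClass,
      hF, hG]
  have := Finite.of_injective t hinj
  exact toFinite _

theorem natVec_nonneg (k : Fin n → ℕ) (i : Fin n) : 0 ≤ natVec k i := Nat.cast_nonneg _

theorem natVec_dotProduct_expVec (k : Fin n → ℕ) (ω : Fin n →₀ ℕ) :
    natVec k ⬝ᵥ expVec ω = ((∑ i, k i * ω i : ℕ) : ℝ) := by
  simp [dotProduct, natVec]

theorem exists_nat_mf_eq {f : MvPolynomial (Fin n) R} (hf : f ≠ 0) (k : Fin n → ℕ) :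
    ∃ a : ℕ, mf f (natVec k) = a := by
  obtain ⟨ω₀, -, h, -⟩ := exists_mf_eq hf (natVec_nonneg k)
  exact ⟨_, h.trans (natVec_dotProduct_expVec k ω₀)⟩

end NewtonFacts

/-! ### Simplicial subdivisions of the relatively open faces of a rational cone -/

section SignCone

variable {n : ℕ}

/-- The closed cone of the vectors on which all the forms in `L` are non-negative. -/
def dualCone (L : Finset (Fin n → ℤ)) : Set (Fin n → ℝ) :=
  {x | ∀ ℓ ∈ L, 0 ≤ intVec ℓ ⬝ᵥ x}

/-- The forms in `L` that vanish at `x`. -/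
def vanishing (L : Finset (Fin n → ℤ)) (x : Fin n → ℝ) : Finset (Fin n → ℤ) :=
  L.filter fun ℓ => intVec ℓ ⬝ᵥ x = 0

/-- The relatively open face of `dualCone L` on which exactly the forms in `V` vanish. -/
def openFace (L V : Finset (Fin n → ℤ)) : Set (Fin n → ℝ) :=
  {x ∈ dualCone L | vanishing L x = V}

theorem intVec_single_dotProduct (i : Fin n) (x : Fin n → ℝ) :
    intVec (Pi.single i 1 : Fin n → ℤ) ⬝ᵥ x = x i := by
  have hs : intVec (Pi.single i 1 : Fin n → ℤ) = Pi.single i 1 := by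
    ext j
    simp only [intVec, Pi.single_apply]
    split_ifs <;> simp
  rw [hs, single_dotProduct, one_mul]

theorem mem_vanishing {L : Finset (Fin n → ℤ)} {x : Fin n → ℝ} {ℓ : Fin n → ℤ} :
    ℓ ∈ vanishing L x ↔ ℓ ∈ L ∧ intVec ℓ ⬝ᵥ x = 0 :=
  Finset.mem_filter

theorem pos_of_mem_dualCone {L : Finset (Fin n → ℤ)} {x : Fin n → ℝ} (hx : x ∈ dualCone L)
    {ℓ : Fin n → ℤ} (hℓ : ℓ ∈ L) (h : ℓ ∉ vanishing L x) : 0 < intVec ℓ ⬝ᵥ x :=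
  lt_of_le_of_ne (hx ℓ hℓ) fun h0 => h (mem_vanishing.2 ⟨hℓ, h0.symm⟩)

theorem nonneg_of_mem_dualCone {L : Finset (Fin n → ℤ)} (hL : ∀ i, Pi.single i 1 ∈ L)
    {x : Fin n → ℝ} (hx : x ∈ dualCone L) (i : Fin n) : 0 ≤ x i := by
  have h := hx _ (hL i)
  rwa [intVec_single_dotProduct] at h

theorem add_mem_dualCone {L : Finset (Fin n → ℤ)} {x y : Fin n → ℝ} (hx : x ∈ dualCone L)
    (hy : y ∈ dualCone L) : x + y ∈ dualCone L := fun ℓ hℓ => by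
  rw [dotProduct_add]
  exact add_nonneg (hx ℓ hℓ) (hy ℓ hℓ)

theorem smul_mem_dualCone {L : Finset (Fin n → ℤ)} {x : Fin n → ℝ} (hx : x ∈ dualCone L)
    {t : ℝ} (ht : 0 ≤ t) : t • x ∈ dualCone L := fun ℓ hℓ => by
  rw [dotProduct_smul, smul_eq_mul]
  exact mul_nonneg ht (hx ℓ hℓ)

theorem vanishing_smul {L : Finset (Fin n → ℤ)} {x : Fin n → ℝ} {t : ℝ} (ht : t ≠ 0) :
    vanishing L (t • x) = vanishing L x := by
  ext ℓ
  simp [mem_vanishing, dotProduct_smul, ht]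

theorem vanishing_add {L : Finset (Fin n → ℤ)} {x y : Fin n → ℝ} (hx : x ∈ dualCone L)
    (hy : y ∈ dualCone L) : vanishing L (x + y) = vanishing L x ∩ vanishing L y := by
  ext ℓ
  simp only [mem_vanishing, dotProduct_add, Finset.mem_inter]
  constructor
  · rintro ⟨hℓ, h⟩
    have h1 := hx ℓ hℓ
    have h2 := hy ℓ hℓ
    exact ⟨⟨hℓ, by linarith⟩, hℓ, by linarith⟩
  · rintro ⟨⟨hℓ, h1⟩, -, h2⟩
    exact ⟨hℓ, by rw [h1, h2, add_zero]⟩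

/-- Moving from `x` in the direction `-v` one leaves `dualCone L` through a smaller face. -/
theorem exists_sub_smul_mem_dualCone {L : Finset (Fin n → ℤ)} (hL : ∀ i, Pi.single i 1 ∈ L)
    {x v : Fin n → ℝ} (hx : x ∈ dualCone L) (hv : v ∈ dualCone L) (hv0 : v ≠ 0)
    (hxv : vanishing L x ⊆ vanishing L v) : ∃ t : ℝ, 0 < t ∧ x - t • v ∈ dualCone L ∧
      ∃ ℓ ∈ vanishing L (x - t • v), 0 < intVec ℓ ⬝ᵥ v := by
  let P := L.filter fun ℓ => 0 < intVec ℓ ⬝ᵥ v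
  have hP : P.Nonempty := by
    by_contra hempty
    apply hv0
    have hneg : -v ∈ dualCone L := fun ℓ hℓ => by
      rw [dotProduct_neg, neg_nonneg]
      by_contra! h
      exact hempty ⟨ℓ, Finset.mem_filter.2 ⟨hℓ, h⟩⟩
    ext i
    have h1 := nonneg_of_mem_dualCone hL hneg i
    have h2 := nonneg_of_mem_dualCone hL hv i
    simp only [Pi.neg_apply] at h1
    simp only [Pi.zero_apply]
    linarith
  -- The smallest ratio is the first time at which some form positive on `v` vanishes along `x - t
  -- v`.
  obtain ⟨ℓ₀, hℓ₀, hmin⟩ := P.exists_min_image (fun ℓ => (intVec ℓ ⬝ᵥ x) / (intVec ℓ ⬝ᵥ v)) hP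
  obtain ⟨hℓ₀L, hℓ₀v⟩ := Finset.mem_filter.1 hℓ₀
  have hxpos : ∀ ℓ ∈ L, 0 < intVec ℓ ⬝ᵥ v → 0 < intVec ℓ ⬝ᵥ x := fun ℓ hℓ hℓv =>
    pos_of_mem_dualCone hx hℓ fun h => hℓv.ne' (mem_vanishing.1 (hxv h)).2
  refine ⟨(intVec ℓ₀ ⬝ᵥ x) / (intVec ℓ₀ ⬝ᵥ v), div_pos (hxpos ℓ₀ hℓ₀L hℓ₀v) hℓ₀v, ?_, ℓ₀, ?_,
    hℓ₀v⟩
  · intro ℓ hℓ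
    rw [dotProduct_sub, dotProduct_smul, smul_eq_mul, sub_nonneg]
    rcases (hv ℓ hℓ).eq_or_lt with h | h
    · rw [← h, mul_zero]
      exact hx ℓ hℓ
    · rw [← le_div_iff₀ h]
      exact hmin ℓ (Finset.mem_filter.2 ⟨hℓ, h⟩)
  · refine mem_vanishing.2 ⟨hℓ₀L, ?_⟩
    rw [dotProduct_sub, dotProduct_smul, smul_eq_mul, div_mul_cancel₀ _ hℓ₀v.ne', sub_self]

theorem vanishing_subset_sub_smul {L : Finset (Fin n → ℤ)} {x v : Fin n → ℝ}
    (hxv : vanishing L x ⊆ vanishing L v) (t : ℝ) :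
    vanishing L x ⊆ vanishing L (x - t • v) := fun ℓ hℓ => by
  obtain ⟨hℓL, h⟩ := mem_vanishing.1 hℓ
  refine mem_vanishing.2 ⟨hℓL, ?_⟩
  rw [dotProduct_sub, dotProduct_smul, h, (mem_vanishing.1 (hxv hℓ)).2, smul_zero, sub_zero]

/-- A non-zero point of `dualCone L` at which a maximal set of forms vanishes spans a ray. -/
theorem exists_maximal_vanishing {L : Finset (Fin n → ℤ)} (hL : ∀ i, Pi.single i 1 ∈ L)
    {x : Fin n → ℝ} (hx : x ∈ dualCone L) (hx0 : x ≠ 0) : ∃ v ∈ dualCone L, v ≠ 0 ∧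
      vanishing L x ⊆ vanishing L v ∧
      ∀ w ∈ dualCone L, w ≠ 0 → vanishing L v ⊆ vanishing L w → ∃ t : ℝ, 0 < t ∧ w = t • v := by
  classical
  let S := L.powerset.filter fun V =>
    ∃ v ∈ dualCone L, v ≠ 0 ∧ vanishing L x ⊆ vanishing L v ∧ vanishing L v = V
  have hS : S.Nonempty := ⟨vanishing L x, Finset.mem_filter.2
    ⟨Finset.mem_powerset.2 (Finset.filter_subset _ _), x, hx, hx0, subset_rfl, rfl⟩⟩
  obtain ⟨V, hV, hmax⟩ := S.exists_max_image Finset.card hS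
  obtain ⟨-, v, hv, hv0, hxv, rfl⟩ := Finset.mem_filter.1 hV
  refine ⟨v, hv, hv0, hxv, fun w hw hw0 hvw => ?_⟩
  have heq : ∀ u ∈ dualCone L, u ≠ 0 → vanishing L v ⊆ vanishing L u →
      vanishing L v = vanishing L u := fun u hu hu0 hvu =>
    Finset.eq_of_subset_of_card_le hvu (hmax _ (Finset.mem_filter.2
      ⟨Finset.mem_powerset.2 (Finset.filter_subset _ _), u, hu, hu0, hxv.trans hvu, rfl⟩))
  have hwv := (heq w hw hw0 hvw).symm
  -- If `w - t v` were non-zero, an additional form would vanish there, against maximality.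
  obtain ⟨t, ht, hmem, ℓ, hℓ, hpos⟩ := exists_sub_smul_mem_dualCone hL hw hv hv0 hwv.subset
  refine ⟨t, ht, ?_⟩
  by_contra hne
  have h := heq _ hmem (sub_ne_zero.2 hne) (hvw.trans (vanishing_subset_sub_smul hwv.subset t))
  rw [← h] at hℓ
  exact hpos.ne' (mem_vanishing.1 hℓ).2

/-- Adding a large multiple of `v` moves `u` into the cone without losing any form that vanishes at
`v`, so the ray property of `v` also controls vectors outside the cone. -/
theorem exists_eq_smul_of_vanishing {L : Finset (Fin n → ℤ)} {v : Fin n → ℝ}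
    (hv : v ∈ dualCone L)
    (hray : ∀ w ∈ dualCone L, w ≠ 0 → vanishing L v ⊆ vanishing L w →
      ∃ t : ℝ, 0 < t ∧ w = t • v)
    {u : Fin n → ℝ} (hu : ∀ ℓ ∈ vanishing L v, intVec ℓ ⬝ᵥ u = 0) : ∃ c : ℝ, u = c • v := by
  obtain ⟨C, hC, h⟩ := exists_nonneg_forall_le_mul L (fun ℓ => |intVec ℓ ⬝ᵥ u|)
    (fun ℓ => intVec ℓ ⬝ᵥ v) (fun _ _ => abs_nonneg _) hv
    (fun ℓ hℓ h0 => by rw [hu ℓ (mem_vanishing.2 ⟨hℓ, h0⟩), abs_zero])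
  have hw : C • v + u ∈ dualCone L := fun ℓ hℓ => by
    rw [dotProduct_add, dotProduct_smul, smul_eq_mul]
    linarith [h ℓ hℓ, neg_abs_le (intVec ℓ ⬝ᵥ u)]
  by_cases h0 : C • v + u = 0
  · exact ⟨-C, by rw [neg_smul]; exact (neg_eq_of_add_eq_zero_right h0).symm⟩
  · obtain ⟨t, -, ht⟩ := hray _ hw h0 fun ℓ hℓ => mem_vanishing.2 ⟨(mem_vanishing.1 hℓ).1, by
      rw [dotProduct_add, dotProduct_smul, (mem_vanishing.1 hℓ).2, hu ℓ hℓ, smul_zero, add_zero]⟩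
    exact ⟨t - C, by rw [sub_smul, ← ht, add_sub_cancel_left]⟩

/-- A line cut out by rational equations has a rational point. -/
theorem exists_rat_smul {V : Finset (Fin n → ℤ)} {v : Fin n → ℝ} (hv0 : v ≠ 0)
    (hV : ∀ ℓ ∈ V, intVec ℓ ⬝ᵥ v = 0)
    (hker : ∀ u : Fin n → ℝ, (∀ ℓ ∈ V, intVec ℓ ⬝ᵥ u = 0) → ∃ c : ℝ, u = c • v) :
    ∃ (u : Fin n → ℚ) (c : ℝ), c ≠ 0 ∧ ∀ i, (u i : ℝ) = c * v i := by
  obtain ⟨i, hi⟩ := Function.ne_iff.1 hv0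
  -- A `ℚ`-linear functional on `ℝ` applied to each coordinate respects equations with integral
  -- coefficients; it therefore produces a rational solution, non-zero because `φ (v i) ≠ 0`.
  obtain ⟨φ, hφ⟩ : ∃ φ : Module.Dual ℚ ℝ, φ (v i) ≠ 0 := by
    by_contra! h
    exact hi ((Module.forall_dual_apply_eq_zero_iff ℚ (v i)).1 h)
  obtain ⟨c, hc⟩ := hker (fun j => ((φ (v j) : ℚ) : ℝ)) fun ℓ hℓ => by
    have h := congr_arg φ (hV ℓ hℓ)
    simp only [dotProduct, intVec, map_sum, map_zero] at h ⊢
    have hterm : ∀ j, φ ((ℓ j : ℝ) * v j) = (ℓ j : ℚ) * φ (v j) := fun j => by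
      rw [← zsmul_eq_mul, map_zsmul, zsmul_eq_mul]
    simp only [hterm] at h
    exact_mod_cast congr_arg (Rat.cast (K := ℝ)) h
  refine ⟨fun j => φ (v j), c, ?_, fun j => congr_fun hc j⟩
  rintro rfl
  have := congr_fun hc i
  simp at this
  exact hφ this

theorem exists_primitive_smul {v : Fin n → ℝ} (hv0 : v ≠ 0) (hv : ∀ i, 0 ≤ v i) {u : Fin n → ℚ}
    {c : ℝ} (hc : c ≠ 0) (hu : ∀ i, (u i : ℝ) = c * v i) :
    ∃ (k : Fin n → ℕ) (t : ℝ), IsPrimitive k ∧ 0 < t ∧ natVec k = t • v := by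
  -- A common denominator. Passing to `|c|` removes the sign of `c`, and dividing by the greatest
  -- common divisor makes the vector primitive.
  let D : ℕ := ∏ i, (u i).den
  have hD : 0 < D := Finset.prod_pos fun i _ => (u i).den_pos
  have hm : ∀ i, ∃ m : ℕ, (m : ℝ) = (D * |c|) * v i := by
    intro i
    obtain ⟨e, he⟩ : (u i).den ∣ D := Finset.dvd_prod_of_mem _ (Finset.mem_univ i)
    refine ⟨e * (u i).num.natAbs, ?_⟩
    have h1 : ((u i).den : ℝ) * (u i : ℝ) = (u i).num := by exact_mod_cast Rat.den_mul_eq_num (u i)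
    have h2 : |(u i : ℝ)| = |c| * v i := by rw [hu, abs_mul, abs_of_nonneg (hv i)]
    rw [mul_assoc, ← h2, he]
    push_cast
    rw [Nat.cast_natAbs, Int.cast_abs, ← h1, abs_mul, Nat.abs_cast]
    ring
  choose m hm using hm
  obtain ⟨i, hi⟩ := Function.ne_iff.1 hv0
  have hDc : 0 < (D : ℝ) * |c| := mul_pos (Nat.cast_pos.2 hD) (abs_pos.2 hc)
  have hmi : m i ≠ 0 := by
    intro h
    have := hm i
    rw [h, Nat.cast_zero, eq_comm] at this
    exact hi ((mul_eq_zero.1 this).resolve_left hDc.ne')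
  let d := Finset.univ.gcd m
  have hd : 0 < d := Nat.pos_of_ne_zero fun h =>
    hmi (Finset.gcd_eq_zero_iff.1 h i (Finset.mem_univ i))
  refine ⟨fun j => m j / d, (D * |c|) / d, Finset.gcd_div_eq_one (Finset.mem_univ i) hmi,
    div_pos hDc (Nat.cast_pos.2 hd), ?_⟩
  ext j
  have hdvd : d ∣ m j := Finset.gcd_dvd (Finset.mem_univ j)
  simp only [natVec, Pi.smul_apply, smul_eq_mul]
  rw [Nat.cast_div hdvd (Nat.cast_ne_zero.2 hd.ne'), hm]
  ring

theorem mem_spannedCone_singleton {k : Fin n → ℕ} {x : Fin n → ℝ} :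
    x ∈ spannedCone {k} ↔ ∃ t : ℝ, 0 < t ∧ x = t • natVec k := by
  constructor
  · rintro ⟨c, hc, rfl⟩
    exact ⟨c k, hc k (Finset.mem_singleton_self k), by simp⟩
  · rintro ⟨t, ht, rfl⟩
    exact ⟨fun _ => t, fun _ _ => ht, by simp⟩

theorem natVec_ne_zero_of_isPrimitive {k : Fin n → ℕ} (hk : IsPrimitive k) : natVec k ≠ 0 := by
  intro h
  have : ∀ i ∈ Finset.univ, k i = 0 := fun i _ => Nat.cast_eq_zero.1 (congr_fun h i)
  rw [IsPrimitive, Finset.gcd_eq_zero_iff.2 this] at hk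
  exact zero_ne_one hk

/-- `k` is a primitive generator of a one-dimensional face of `dualCone L`. -/
def IsFaceRay (L : Finset (Fin n → ℤ)) (k : Fin n → ℕ) : Prop :=
  IsPrimitive k ∧ natVec k ∈ dualCone L ∧
    openFace L (vanishing L (natVec k)) = spannedCone {k}

/-- Supplies an apex for coning: the closed face of any non-zero point contains a ray, and the ray
is rational since integral equations cut out its line. -/
theorem exists_isFaceRay {L : Finset (Fin n → ℤ)} (hL : ∀ i, Pi.single i 1 ∈ L)
    {x : Fin n → ℝ} (hx : x ∈ dualCone L) (hx0 : x ≠ 0) :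
    ∃ k, IsFaceRay L k ∧ vanishing L x ⊆ vanishing L (natVec k) := by
  obtain ⟨v, hv, hv0, hxv, hray⟩ := exists_maximal_vanishing hL hx hx0
  obtain ⟨u, c, hc, hu⟩ := exists_rat_smul (V := vanishing L v) hv0
    (fun ℓ hℓ => (mem_vanishing.1 hℓ).2) fun u hu => exists_eq_smul_of_vanishing hv hray hu
  obtain ⟨k, t, hk, ht, hkv⟩ := exists_primitive_smul hv0 (nonneg_of_mem_dualCone hL hv) hc hu
  have hvan : vanishing L (natVec k) = vanishing L v := by rw [hkv, vanishing_smul ht.ne']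
  have hkm : natVec k ∈ dualCone L := hkv ▸ smul_mem_dualCone hv ht.le
  refine ⟨k, ⟨hk, hkm, ?_⟩, hxv.trans hvan.symm.subset⟩
  ext w
  rw [mem_spannedCone_singleton]
  constructor
  · rintro ⟨hw, hwv⟩
    have hw0 : w ≠ 0 := by
      rintro rfl
      have hall : vanishing L v = L := by
        rw [← hvan, ← hwv]
        exact Finset.filter_true_of_mem fun ℓ _ => dotProduct_zero _
      apply hv0
      have hneg : -v ∈ dualCone L := fun ℓ hℓ => by
        rw [dotProduct_neg, (mem_vanishing.1 (hall.symm ▸ hℓ : ℓ ∈ vanishing L v)).2, neg_zero]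
      ext i
      exact le_antisymm (neg_nonneg.1 (nonneg_of_mem_dualCone hL hneg i))
        (nonneg_of_mem_dualCone hL hv i)
    obtain ⟨r, hr, rfl⟩ := hray w hw hw0 (by rw [hwv, hvan])
    exact ⟨r / t, div_pos hr ht, by rw [hkv, smul_smul, div_mul_cancel₀ _ ht.ne']⟩
  · rintro ⟨r, hr, rfl⟩
    exact ⟨smul_mem_dualCone hkm hr.le, vanishing_smul hr.ne'⟩

theorem spannedCone_nonempty (K : Finset (Fin n → ℕ)) : (spannedCone K).Nonempty :=
  ⟨_, fun _ => 1, fun _ _ => one_pos, rfl⟩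

theorem add_smul_mem_spannedCone {K : Finset (Fin n → ℕ)} {x : Fin n → ℝ}
    (hx : x ∈ spannedCone K) {k : Fin n → ℕ} (hk : k ∈ K) {t : ℝ} (ht : 0 ≤ t) :
    x + t • natVec k ∈ spannedCone K := by
  classical
  obtain ⟨c, hc, rfl⟩ := hx
  refine ⟨fun l => c l + if l = k then t else 0, fun l hl => ?_, ?_⟩
  · have := hc l hl
    dsimp only
    split_ifs <;> linarith
  · simp [add_smul, Finset.sum_add_distrib, hk]

theorem dotProduct_natVec_eq_zero_of_spannedCone {K : Finset (Fin n → ℕ)} {a : Fin n → ℝ}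
    (h : ∀ x ∈ spannedCone K, a ⬝ᵥ x = 0) {k : Fin n → ℕ} (hk : k ∈ K) :
    a ⬝ᵥ natVec k = 0 := by
  obtain ⟨x, hx⟩ := spannedCone_nonempty K
  have h1 := h _ (add_smul_mem_spannedCone hx hk zero_le_one)
  rwa [dotProduct_add, h x hx, zero_add, one_smul] at h1

theorem mem_spannedCone_insert [DecidableEq (Fin n → ℕ)] {K : Finset (Fin n → ℕ)}
    {k : Fin n → ℕ} (hk : k ∉ K) {x : Fin n → ℝ} : x ∈ spannedCone (insert k K) ↔
      ∃ y ∈ spannedCone K, ∃ t : ℝ, 0 < t ∧ x = y + t • natVec k := by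
  constructor
  · rintro ⟨c, hc, rfl⟩
    refine ⟨_, ⟨c, fun l hl => hc l (Finset.mem_insert_of_mem hl), rfl⟩, c k,
      hc k (Finset.mem_insert_self k K), ?_⟩
    rw [Finset.sum_insert hk, add_comm]
  · rintro ⟨_, ⟨c, hc, rfl⟩, t, ht, rfl⟩
    refine ⟨Function.update c k t, fun l hl => ?_, ?_⟩
    · rcases eq_or_ne l k with rfl | hlk
      · simpa using ht
      · simpa [hlk] using hc l (Finset.mem_of_mem_insert_of_ne hl hlk)
    · rw [Finset.sum_insert hk, Function.update_self, add_comm]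
      congr 1
      refine Finset.sum_congr rfl fun l hl => ?_
      rw [Function.update_of_ne (ne_of_mem_of_not_mem hl hk)]

theorem linearIndependent_insert [DecidableEq (Fin n → ℕ)] {K : Finset (Fin n → ℕ)}
    (hK : LinearIndependent ℝ fun k : {k // k ∈ K} => natVec k.1) {k : Fin n → ℕ}
    {a : Fin n → ℝ} (ha : ∀ l ∈ K, a ⬝ᵥ natVec l = 0) (hak : a ⬝ᵥ natVec k ≠ 0) :
    LinearIndependent ℝ fun l : {l // l ∈ insert k K} => natVec l.1 := by
  have hK' : LinearIndepOn ℝ natVec (K : Set (Fin n → ℕ)) := hK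
  have h : LinearIndepOn ℝ natVec (insert k (K : Set (Fin n → ℕ))) := by
    refine hK'.insert fun hmem => hak ?_
    have hle : Submodule.span ℝ (natVec '' (K : Set (Fin n → ℕ))) ≤
        LinearMap.ker (dotProductBilin ℝ ℝ a) := by
      rw [Submodule.span_le]
      rintro _ ⟨l, hl, rfl⟩
      exact ha l hl
    exact hle hmem
  rw [← Finset.coe_insert] at h
  exact h

/-- Induction on the number of forms not vanishing on the face. With `k` a ray of the closed face,
each point of the open face is uniquely `y + t k` with `t > 0` and `y` in a smaller face that avoids
`k`; adjoining `k` to the cones subdividing those smaller faces gives the subdivision. -/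
theorem exists_simplicialSubdivision_openFace {L : Finset (Fin n → ℤ)}
    (hL : ∀ i, Pi.single i 1 ∈ L) (V : Finset (Fin n → ℤ)) (hV : V ⊆ L) :
    ∃ C : Finset (Finset (Fin n → ℕ)), IsSimplicialSubdivision (openFace L V) C ∧
      ∀ K ∈ C, ∀ k ∈ K, IsFaceRay L k := by
  classical
  induction hN : (L \ V).card using Nat.strong_induction_on generalizing V with
  | _ N ih =>
  subst hN
  have ih' : ∀ W : {W // V ⊂ W ∧ W ⊆ L}, ∃ C : Finset (Finset (Fin n → ℕ)),
      IsSimplicialSubdivision (openFace L W.1) C ∧ ∀ K ∈ C, ∀ k ∈ K, IsFaceRay L k := fun W =>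
    ih _ (by
      have h1 := Finset.card_lt_card W.2.1
      have h2 := Finset.card_le_card W.2.2
      rw [Finset.card_sdiff_of_subset hV, Finset.card_sdiff_of_subset W.2.2]
      omega) W.1 W.2.2 rfl
  choose C hC hCray using ih'
  rcases (openFace L V).eq_empty_or_nonempty with hempty | ⟨x₀, hx₀, hx₀V⟩
  · exact ⟨∅, ⟨by simp, by simp, by simp, by simp [hempty]⟩, by simp⟩
  -- If the origin lies in the open face, all forms vanish on it; since the cone is pointed the face
  -- is `{0}`, spanned by the empty set of generators.
  by_cases h0 : x₀ = 0
  · have hface : openFace L V = {0} := by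
      have hall : V = L := by
        rw [← hx₀V, h0]
        exact Finset.filter_true_of_mem fun ℓ _ => dotProduct_zero _
      ext x
      constructor
      · rintro ⟨hx, hxV⟩
        have hneg : -x ∈ dualCone L := fun ℓ hℓ => by
          have : ℓ ∈ vanishing L x := by rw [hxV, hall]; exact hℓ
          rw [dotProduct_neg, (mem_vanishing.1 this).2, neg_zero]
        ext i
        exact le_antisymm (neg_nonneg.1 (nonneg_of_mem_dualCone hL hneg i))
          (nonneg_of_mem_dualCone hL hx i)
      · rintro rfl
        exact ⟨h0 ▸ hx₀, h0 ▸ hx₀V⟩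
    refine ⟨{∅}, ⟨by simp, ?_, by simp, ?_⟩, by simp⟩
    · intro K hK
      rw [Finset.mem_singleton] at hK
      subst hK
      exact linearIndependent_empty_type
    · ext x
      simp [hface, spannedCone]
  obtain ⟨k, hk, hVk⟩ := exists_isFaceRay hL hx₀ h0
  rw [hx₀V] at hVk
  have hk0 := natVec_ne_zero_of_isPrimitive hk.1
  -- The smaller faces whose closure misses `k` but whose points enter the open face of `V` as soon
  -- as a positive multiple of `k` is added.
  let S : Finset {W // V ⊂ W ∧ W ⊆ L} := (Finset.subtype _ L.powerset).filter fun W =>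
    W.1 ∩ vanishing L (natVec k) = V ∧ ¬ W.1 ⊆ vanishing L (natVec k)
  have hS : ∀ W : {W // V ⊂ W ∧ W ⊆ L}, W ∈ S ↔
      W.1 ∩ vanishing L (natVec k) = V ∧ ¬ W.1 ⊆ vanishing L (natVec k) := fun W => by
    simp [S, W.2.2]
  have hsub : ∀ W, ∀ K ∈ C W, spannedCone K ⊆ openFace L W.1 := fun W K hK => by
    rw [← (hC W).cover]
    exact subset_biUnion_of_mem (u := spannedCone) hK
  have hform : ∀ W ∈ S, ∃ ℓ ∈ W.1, 0 < intVec ℓ ⬝ᵥ natVec k := fun W hW => by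
    obtain ⟨ℓ, hℓ, h⟩ := Finset.not_subset.1 ((hS W).1 hW).2
    exact ⟨ℓ, hℓ, pos_of_mem_dualCone hk.2.1 (W.2.2 hℓ) h⟩
  have hzero : ∀ W : {W // V ⊂ W ∧ W ⊆ L}, ∀ x ∈ openFace L W.1, ∀ ℓ ∈ W.1,
      intVec ℓ ⬝ᵥ x = 0 := fun W x hx ℓ hℓ =>
    (mem_vanishing.1 (hx.2.symm ▸ hℓ : ℓ ∈ vanishing L x)).2
  have hzeroK : ∀ W, ∀ K ∈ C W, ∀ l ∈ K, ∀ ℓ ∈ W.1, intVec ℓ ⬝ᵥ natVec l = 0 :=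
    fun W K hK l hl ℓ hℓ => dotProduct_natVec_eq_zero_of_spannedCone
      (fun x hx => hzero W x (hsub W K hK hx) ℓ hℓ) hl
  have hnot : ∀ W ∈ S, ∀ K ∈ C W, k ∉ K := fun W hW K hK hkK => by
    obtain ⟨ℓ, hℓ, hpos⟩ := hform W hW
    exact hpos.ne' (hzeroK W K hK k hkK ℓ hℓ)
  refine ⟨S.biUnion fun W => (C W).image (insert k), ⟨?_, ?_, ?_, ?_⟩, ?_⟩
  · intro K hK l hl
    simp only [Finset.mem_biUnion, Finset.mem_image] at hK
    obtain ⟨W, hW, K', hK', rfl⟩ := hK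
    rcases Finset.mem_insert.1 hl with rfl | hl
    · exact hk.1
    · exact (hC W).primitive K' hK' l hl
  · intro K hK
    simp only [Finset.mem_biUnion, Finset.mem_image] at hK
    obtain ⟨W, hW, K', hK', rfl⟩ := hK
    obtain ⟨ℓ, hℓ, hpos⟩ := hform W hW
    exact linearIndependent_insert ((hC W).linearIndependent K' hK')
      (fun l hl => hzeroK W K' hK' l hl ℓ hℓ) hpos.ne'
  · intro K₁ hK₁ K₂ hK₂ hne
    simp only [Finset.mem_coe, Finset.mem_biUnion, Finset.mem_image] at hK₁ hK₂
    obtain ⟨W₁, hW₁, K₁, hK₁, rfl⟩ := hK₁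
    obtain ⟨W₂, hW₂, K₂, hK₂, rfl⟩ := hK₂
    refine Set.disjoint_left.2 fun x hx₁ hx₂ => hne ?_
    obtain ⟨y₁, hy₁, t₁, ht₁, rfl⟩ := (mem_spannedCone_insert (hnot W₁ hW₁ K₁ hK₁)).1 hx₁
    obtain ⟨y₂, hy₂, t₂, ht₂, heq⟩ := (mem_spannedCone_insert (hnot W₂ hW₂ K₂ hK₂)).1 hx₂
    -- A form that vanishes on the face of `y` and is positive on `k` compares the two coefficients
    -- of `k`. Used in both directions it makes them equal, whence the base points agree.
    have key : ∀ W ∈ S, ∀ y ∈ openFace L W.1, ∀ z ∈ dualCone L, ∀ s t : ℝ,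
        y + s • natVec k = z + t • natVec k → t ≤ s := by
      intro W hW y hy z hz s t h
      obtain ⟨ℓ, hℓ, hpos⟩ := hform W hW
      have h' := congr_arg (fun w => intVec ℓ ⬝ᵥ w) h
      simp only [dotProduct_add, dotProduct_smul, smul_eq_mul, hzero W y hy ℓ hℓ] at h'
      have := hz ℓ (W.2.2 hℓ)
      nlinarith
    have hy₁' := hsub W₁ K₁ hK₁ hy₁
    have hy₂' := hsub W₂ K₂ hK₂ hy₂
    have ht : t₁ = t₂ := le_antisymm (key W₂ hW₂ y₂ hy₂' y₁ hy₁'.1 t₂ t₁ heq.symm)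
      (key W₁ hW₁ y₁ hy₁' y₂ hy₂'.1 t₁ t₂ heq)
    subst ht
    have hy : y₁ = y₂ := add_right_cancel heq
    subst hy
    have hW : W₁ = W₂ := Subtype.ext (hy₁'.2.symm.trans hy₂'.2)
    subst hW
    congr 1
    by_contra hKne
    exact Set.disjoint_left.1 ((hC W₁).disjoint hK₁ hK₂ hKne) hy₁ hy₂
  · ext x
    simp only [Finset.mem_biUnion, Finset.mem_image, mem_iUnion, exists_prop]
    constructor
    · rintro ⟨K, ⟨W, hW, K', hK', rfl⟩, hx⟩
      obtain ⟨y, hy, t, ht, rfl⟩ := (mem_spannedCone_insert (hnot W hW K' hK')).1 hx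
      have hy' := hsub W K' hK' hy
      have htk := smul_mem_dualCone hk.2.1 ht.le
      refine ⟨add_mem_dualCone hy'.1 htk, ?_⟩
      rw [vanishing_add hy'.1 htk, hy'.2, vanishing_smul ht.ne']
      exact ((hS W).1 hW).1
    · rintro ⟨hx, hxV⟩
      have hxk : vanishing L x ⊆ vanishing L (natVec k) := hxV ▸ hVk
      -- Moving from `x` against `k` until a form positive on `k` vanishes finds the base point `y`.
      obtain ⟨t, ht, hy, ℓ, hℓ, hpos⟩ := exists_sub_smul_mem_dualCone hL hx hk.2.1 hk0 hxk
      set y := x - t • natVec k with hydef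
      have hxy : x = y + t • natVec k := by rw [hydef, sub_add_cancel]
      have hinter : vanishing L y ∩ vanishing L (natVec k) = V := by
        rw [← hxV, hxy, vanishing_add hy (smul_mem_dualCone hk.2.1 ht.le), vanishing_smul ht.ne']
      have hℓk : ℓ ∉ vanishing L (natVec k) := fun h => hpos.ne' (mem_vanishing.1 h).2
      have hVy : V ⊂ vanishing L y := by
        refine ⟨hinter ▸ Finset.inter_subset_left, fun h => hℓk (hVk (h hℓ))⟩
      let W : {W // V ⊂ W ∧ W ⊆ L} := ⟨vanishing L y, hVy, Finset.filter_subset _ _⟩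
      have hW : W ∈ S := (hS W).2 ⟨hinter, fun h => hℓk (h hℓ)⟩
      have hyW : y ∈ ⋃ K ∈ C W, spannedCone K := by
        rw [(hC W).cover]
        exact ⟨hy, rfl⟩
      obtain ⟨K, hK, hyK⟩ := mem_iUnion₂.1 hyW
      exact ⟨_, ⟨W, hW, K, hK, rfl⟩,
        (mem_spannedCone_insert (hnot W hW K hK)).2 ⟨y, hyK, t, ht, hxy⟩⟩
  · intro K hK l hl
    simp only [Finset.mem_biUnion, Finset.mem_image] at hK
    obtain ⟨W, hW, K', hK', rfl⟩ := hK
    rcases Finset.mem_insert.1 hl with rfl | hl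
    · exact hk
    · exact hCray W K' hK' l hl

end SignCone

/-! ### The cones of `Δ_{f,g}` as relatively open faces of rational cones -/

section Forms

variable {R : Type*} [CommRing R] {n : ℕ}

/-- The differences `ω - ω'` of exponents of `f`, with `ω'` in the first meet locus of `k`. -/
def exponentDifferences (f : MvPolynomial (Fin n) R) (k : Fin n → ℝ) : Finset (Fin n → ℤ) :=
  open Classical in
  (f.support ×ˢ f.support.filter fun ω => k ⬝ᵥ expVec ω = mf f k).image
    fun z i => (z.1 i : ℤ) - z.2 i

/-- Integral linear forms whose signs cut out the cone of `k` in `Δ_{f,g}` and its faces. -/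
def coneForms (f g : MvPolynomial (Fin n) R) (k : Fin n → ℝ) : Finset (Fin n → ℤ) :=
  (Finset.univ.image fun i => Pi.single i 1) ∪
    (exponentDifferences f k ∪ exponentDifferences g k)

theorem single_mem_coneForms (f g : MvPolynomial (Fin n) R) (k : Fin n → ℝ) (i : Fin n) :
    Pi.single i 1 ∈ coneForms f g k :=
  Finset.mem_union_left _ (Finset.mem_image_of_mem _ (Finset.mem_univ i))

theorem intVec_sub_dotProduct (ω ω' : Fin n →₀ ℕ) (x : Fin n → ℝ) :
    intVec (fun i => (ω i : ℤ) - ω' i) ⬝ᵥ x = x ⬝ᵥ expVec ω - x ⬝ᵥ expVec ω' := by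
  simp only [dotProduct, intVec, natVec, ← Finset.sum_sub_distrib]
  refine Finset.sum_congr rfl fun i _ => ?_
  push_cast
  ring

theorem mem_exponentDifferences {f : MvPolynomial (Fin n) R} {k : Fin n → ℝ} {ℓ : Fin n → ℤ} :
    ℓ ∈ exponentDifferences f k ↔ ∃ ω ∈ f.support, ∃ ω' ∈ f.support,
      k ⬝ᵥ expVec ω' = mf f k ∧ (fun i => (ω i : ℤ) - ω' i) = ℓ := by
  simp only [exponentDifferences, Finset.mem_image, Finset.mem_product, Finset.mem_filter,
    Prod.exists]
  constructor
  · rintro ⟨ω, ω', ⟨h1, h2, h3⟩, h⟩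
    exact ⟨ω, h1, ω', h2, h3, h⟩
  · rintro ⟨ω, h1, ω', h2, h3, h⟩
    exact ⟨ω, ω', ⟨h1, h2, h3⟩, h⟩

/-- Non-negativity of all `ω - ω'` at `x` expresses that each exponent `ω'` minimizing `k` also
minimizes `x`. -/
theorem forall_mem_exponentDifferences_nonneg_iff {f : MvPolynomial (Fin n) R}
    {k x : Fin n → ℝ} (hx : ∀ i, 0 ≤ x i) :
    (∀ ℓ ∈ exponentDifferences f k, 0 ≤ intVec ℓ ⬝ᵥ x) ↔
      ∀ ω ∈ f.support, k ⬝ᵥ expVec ω = mf f k → x ⬝ᵥ expVec ω = mf f x := by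
  constructor
  · intro h ω' hω' hk
    refine (mf_eq_of_forall_le hx hω' fun ω hω => ?_).symm
    have := h _ (mem_exponentDifferences.2 ⟨ω, hω, ω', hω', hk, rfl⟩)
    rwa [intVec_sub_dotProduct, sub_nonneg] at this
  · intro h ℓ hℓ
    obtain ⟨ω, hω, ω', hω', hk, rfl⟩ := mem_exponentDifferences.1 hℓ
    rw [intVec_sub_dotProduct, sub_nonneg, h ω' hω' hk]
    exact mf_le hx hω

theorem mem_dualCone_coneForms_iff {f g : MvPolynomial (Fin n) R} {k x : Fin n → ℝ} :
    x ∈ dualCone (coneForms f g k) ↔ (∀ i, 0 ≤ x i) ∧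
      (∀ ω ∈ f.support, k ⬝ᵥ expVec ω = mf f k → x ⬝ᵥ expVec ω = mf f x) ∧
      ∀ ω ∈ g.support, k ⬝ᵥ expVec ω = mf g k → x ⬝ᵥ expVec ω = mf g x := by
  constructor
  · intro h
    have hx := nonneg_of_mem_dualCone (single_mem_coneForms f g k) h
    refine ⟨hx, (forall_mem_exponentDifferences_nonneg_iff hx).1 fun ℓ hℓ => h ℓ ?_,
      (forall_mem_exponentDifferences_nonneg_iff hx).1 fun ℓ hℓ => h ℓ ?_⟩
    · exact Finset.mem_union_right _ (Finset.mem_union_left _ hℓ)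
    · exact Finset.mem_union_right _ (Finset.mem_union_right _ hℓ)
  · rintro ⟨hx, h1, h2⟩ ℓ hℓ
    rcases Finset.mem_union.1 hℓ with hℓ | hℓ
    · obtain ⟨i, -, rfl⟩ := Finset.mem_image.1 hℓ
      rw [intVec_single_dotProduct]
      exact hx i
    · rcases Finset.mem_union.1 hℓ with hℓ | hℓ
      · exact (forall_mem_exponentDifferences_nonneg_iff hx).2 h1 ℓ hℓ
      · exact (forall_mem_exponentDifferences_nonneg_iff hx).2 h2 ℓ hℓ

/-- An exponent minimizing `k` minimizes `x` and `y` too, so it serves as a common reference: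
another exponent is minimal exactly when its difference from the reference vanishes. -/
theorem forall_mem_exponentDifferences_eq_zero_iff {f : MvPolynomial (Fin n) R} (hf : f ≠ 0)
    {k x y : Fin n → ℝ} (hk : ∀ i, 0 ≤ k i)
    (hx' : ∀ ω ∈ f.support, k ⬝ᵥ expVec ω = mf f k → x ⬝ᵥ expVec ω = mf f x)
    (hy' : ∀ ω ∈ f.support, k ⬝ᵥ expVec ω = mf f k → y ⬝ᵥ expVec ω = mf f y) :
    (∀ ℓ ∈ exponentDifferences f k, (intVec ℓ ⬝ᵥ x = 0 ↔ intVec ℓ ⬝ᵥ y = 0)) ↔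
      ∀ ω ∈ f.support, (x ⬝ᵥ expVec ω = mf f x ↔ y ⬝ᵥ expVec ω = mf f y) := by
  constructor
  · intro h ω hω
    obtain ⟨ω₀, hω₀, hm, -⟩ := exists_mf_eq hf hk
    have := h _ (mem_exponentDifferences.2 ⟨ω, hω, ω₀, hω₀, hm.symm, rfl⟩)
    rwa [intVec_sub_dotProduct, intVec_sub_dotProduct, hx' ω₀ hω₀ hm.symm, hy' ω₀ hω₀ hm.symm,
      sub_eq_zero, sub_eq_zero] at this
  · intro h ℓ hℓ
    obtain ⟨ω, hω, ω', hω', hk', rfl⟩ := mem_exponentDifferences.1 hℓ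
    rw [intVec_sub_dotProduct, intVec_sub_dotProduct, hx' ω' hω' hk', hy' ω' hω' hk',
      sub_eq_zero, sub_eq_zero]
    exact h ω hω

theorem vanishing_coneForms_eq_iff {f g : MvPolynomial (Fin n) R} (hf : f ≠ 0) (hg : g ≠ 0)
    {k x y : Fin n → ℝ} (hk : ∀ i, 0 ≤ k i) (hx : x ∈ dualCone (coneForms f g k))
    (hy : y ∈ dualCone (coneForms f g k)) :
    vanishing (coneForms f g k) x = vanishing (coneForms f g k) y ↔
      firstMeetLocus f x = firstMeetLocus f y ∧ firstMeetLocus g x = firstMeetLocus g y := by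
  obtain ⟨hx0, hxf, hxg⟩ := mem_dualCone_coneForms_iff.1 hx
  obtain ⟨hy0, hyf, hyg⟩ := mem_dualCone_coneForms_iff.1 hy
  rw [firstMeetLocus_eq_iff hf hx0 hy0, firstMeetLocus_eq_iff hg hx0 hy0,
    ← forall_mem_exponentDifferences_eq_zero_iff hf hk hxf hyf,
    ← forall_mem_exponentDifferences_eq_zero_iff hg hk hxg hyg, vanishing, vanishing,
    Finset.filter_inj']
  constructor
  · intro h
    have h1 : ∀ i, x i = 0 ↔ y i = 0 := fun i => by
      have := h (single_mem_coneForms f g k i)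
      rwa [intVec_single_dotProduct, intVec_single_dotProduct] at this
    exact ⟨⟨h1, fun ℓ hℓ => h (Finset.mem_union_right _ (Finset.mem_union_left _ hℓ))⟩, h1,
      fun ℓ hℓ => h (Finset.mem_union_right _ (Finset.mem_union_right _ hℓ))⟩
  · rintro ⟨⟨h1, h2⟩, -, h3⟩ ℓ hℓ
    rcases Finset.mem_union.1 hℓ with hℓ | hℓ
    · obtain ⟨i, -, rfl⟩ := Finset.mem_image.1 hℓ
      rw [intVec_single_dotProduct, intVec_single_dotProduct]
      exact h1 i
    · rcases Finset.mem_union.1 hℓ with hℓ | hℓ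
      · exact h2 ℓ hℓ
      · exact h3 ℓ hℓ

/-- Stated for every `x` in the closed cone, not only for `k`: the rays of the closed cone are
thereby members of the partition too, so the subdivision has no new rays. -/
theorem coneClass_eq_openFace {f g : MvPolynomial (Fin n) R} (hf : f ≠ 0) (hg : g ≠ 0)
    {k x : Fin n → ℝ} (hk : ∀ i, 0 ≤ k i) (hx : x ∈ dualCone (coneForms f g k)) :
    coneClass f g x = openFace (coneForms f g k) (vanishing (coneForms f g k) x) := by
  obtain ⟨hx0, hxf, hxg⟩ := mem_dualCone_coneForms_iff.1 hx
  ext y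
  rw [mem_coneClass_iff]
  constructor
  · rintro ⟨hy0, hF, hG⟩
    have hy : y ∈ dualCone (coneForms f g k) := mem_dualCone_coneForms_iff.2
      ⟨hy0, fun ω hω h => ((firstMeetLocus_eq_iff hf hy0 hx0).1 hF).2 ω hω |>.2 (hxf ω hω h),
        fun ω hω h => ((firstMeetLocus_eq_iff hg hy0 hx0).1 hG).2 ω hω |>.2 (hxg ω hω h)⟩
    exact ⟨hy, (vanishing_coneForms_eq_iff hf hg hk hy hx).2 ⟨hF, hG⟩⟩
  · rintro ⟨hy, hV⟩
    exact ⟨(mem_dualCone_coneForms_iff.1 hy).1, (vanishing_coneForms_eq_iff hf hg hk hy hx).1 hV⟩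

end Forms

/-! ### Subdivisions without new rays and uniqueness of ray generators -/

section Rays

variable {p : ℕ} [Fact p.Prime] {n : ℕ}

theorem exists_subdivision_noNewRays {f g : MvPolynomial (Fin n) ℤ_[p]} (hf : f ≠ 0) (hg : g ≠ 0)
    {δ : Set (Fin n → ℝ)} (hδ : δ ∈ conePartition f g) :
    ∃ C : Finset (Finset (Fin n → ℕ)), IsSimplicialSubdivision δ C ∧ NoNewRays f g C := by
  obtain ⟨k, hkδ⟩ := nonempty_of_mem_conePartition hδ
  have hk := nonneg_of_mem_conePartition hδ hkδ
  have hmem : k ∈ dualCone (coneForms f g k) :=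
    mem_dualCone_coneForms_iff.2 ⟨hk, fun _ _ h => h, fun _ _ h => h⟩
  obtain ⟨C, hC, hray⟩ := exists_simplicialSubdivision_openFace (single_mem_coneForms f g k)
    (vanishing (coneForms f g k) k) (Finset.filter_subset _ _)
  refine ⟨C, ?_, fun K hK l hl => ⟨(hray K hK l hl).1, ?_⟩⟩
  · rwa [eq_coneClass_of_mem hδ hkδ, coneClass_eq_openFace hf hg hk hmem]
  · obtain ⟨-, hl, hspan⟩ := hray K hK l hl
    rw [← hspan, ← coneClass_eq_openFace hf hg hk hl]
    exact coneClass_mem_conePartition hf hg (natVec_nonneg _)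

theorem eq_of_natVec_eq_smul {k l : Fin n → ℕ} (hk : IsPrimitive k) (hl : IsPrimitive l) {t : ℝ}
    (h : natVec l = t • natVec k) : l = k := by
  obtain ⟨i, hi⟩ := Function.ne_iff.1 (natVec_ne_zero_of_isPrimitive hk)
  -- Taking the greatest common divisor over `j` on both sides then gives `k i = l i`, since both
  -- vectors are primitive.
  have hcross : ∀ j, l j * k i = l i * k j := by
    intro j
    have h1 := congr_fun h i
    have h2 := congr_fun h j
    simp only [natVec, Pi.smul_apply, smul_eq_mul] at h1 h2
    have : (l j : ℝ) * k i = l i * k j := by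
      rw [h1, h2]
      ring
    exact_mod_cast this
  have hki : k i ≠ 0 := fun h => hi (by simp [natVec, h])
  have h1 : Finset.univ.gcd (fun j => l j * k i) = Finset.univ.gcd (fun j => l i * k j) := by
    simp only [hcross]
  rw [Finset.gcd_mul_right, Finset.gcd_mul_left] at h1
  have hk' : (Finset.univ.gcd fun j => k j) = 1 := hk
  have hl' : (Finset.univ.gcd fun j => l j) = 1 := hl
  rw [hk', hl', one_mul, mul_one, normalize_eq, normalize_eq] at h1
  ext j
  have := hcross j
  rw [← h1, mul_comm] at this
  exact Nat.eq_of_mul_eq_mul_left (Nat.pos_of_ne_zero hki) this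

/-- Take the piece containing `k` and a generator `l` of it. Then `k + l` stays in the ray, so `l`
is a multiple of `k`, and primitivity forces `l = k`. -/
theorem exists_mem_of_subdivision_spannedCone_singleton {k : Fin n → ℕ} (hk : IsPrimitive k)
    {C : Finset (Finset (Fin n → ℕ))} (hC : IsSimplicialSubdivision (spannedCone {k}) C) :
    ∃ K ∈ C, k ∈ K := by
  have hmem : natVec k ∈ ⋃ K ∈ C, spannedCone K := by
    rw [hC.cover, mem_spannedCone_singleton]
    exact ⟨1, one_pos, (one_smul _ _).symm⟩
  obtain ⟨K, hK, hkK⟩ := mem_iUnion₂.1 hmem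
  have hne : K.Nonempty := by
    rw [Finset.nonempty_iff_ne_empty]
    rintro rfl
    obtain ⟨c, -, h⟩ := hkK
    exact natVec_ne_zero_of_isPrimitive hk (by simpa using h)
  obtain ⟨l, hl⟩ := hne
  have h1 := add_smul_mem_spannedCone hkK hl zero_le_one
  have h2 : natVec k + (1 : ℝ) • natVec l ∈ spannedCone {k} := by
    rw [← hC.cover]
    exact mem_biUnion hK h1
  obtain ⟨t, -, ht⟩ := mem_spannedCone_singleton.1 h2
  have h3 : natVec l = (t - 1) • natVec k := by
    rw [sub_smul, ← ht, one_smul, one_smul, add_sub_cancel_left]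
  exact ⟨K, hK, eq_of_natVec_eq_smul hk (hC.primitive K hK l hl) h3 ▸ hl⟩

end Rays

/-! ### Linearity of `m_f` on the cones of a subdivision -/

section Linearity

variable {R : Type*} [CommRing R] {n : ℕ}

/-- The first meet locus is constant on the open cone, so one exponent is minimal throughout.
Minimality passes to the generators, hence to combinations with some coefficients zero, which is
needed for box points. -/
theorem exists_mf_eq_dotProduct_of_spannedCone_subset {f : MvPolynomial (Fin n) R} (hf : f ≠ 0)
    {τ : Set (Fin n → ℝ)} {K : Finset (Fin n → ℕ)} (hK : spannedCone K ⊆ coneOf f τ) :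
    ∃ ω₀ ∈ f.support, ∀ c : (Fin n → ℕ) → ℝ, (∀ k ∈ K, 0 ≤ c k) →
      mf f (∑ k ∈ K, c k • natVec k) = (∑ k ∈ K, c k • natVec k) ⬝ᵥ expVec ω₀ := by
  obtain ⟨x₀, hx₀⟩ := spannedCone_nonempty K
  obtain ⟨ω₀, hω₀, hm, -⟩ := exists_mf_eq hf (hK hx₀).1
  have hmin : ∀ x ∈ spannedCone K, x ⬝ᵥ expVec ω₀ = mf f x := fun x hx => by
    have : expVec ω₀ ∈ firstMeetLocus f x := by
      rw [(hK hx).2, ← (hK hx₀).2]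
      exact (mem_firstMeetLocus_expVec hω₀).2 hm.symm
    exact this.2
  have hle : ∀ k ∈ K, ∀ ω ∈ f.support, natVec k ⬝ᵥ expVec ω₀ ≤ natVec k ⬝ᵥ expVec ω := by
    intro k hk ω hω
    by_contra! hlt
    have hlt' := sub_pos.2 hlt
    have hx₀' : 0 ≤ x₀ ⬝ᵥ expVec ω - x₀ ⬝ᵥ expVec ω₀ := by
      rw [hmin x₀ hx₀]
      exact sub_nonneg.2 (mf_le (hK hx₀).1 hω)
    -- If `ω` were strictly better at the generator `k`, going this far along `k` from `x₀` would
    -- make it better inside the cone.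
    obtain ⟨t, ht, h⟩ : ∃ t : ℝ, 0 ≤ t ∧ x₀ ⬝ᵥ expVec ω - x₀ ⬝ᵥ expVec ω₀ <
        t * (natVec k ⬝ᵥ expVec ω₀ - natVec k ⬝ᵥ expVec ω) := by
      refine ⟨(x₀ ⬝ᵥ expVec ω - x₀ ⬝ᵥ expVec ω₀ + 1) /
        (natVec k ⬝ᵥ expVec ω₀ - natVec k ⬝ᵥ expVec ω), by positivity, ?_⟩
      rw [div_mul_cancel₀ _ hlt'.ne']
      linarith
    have hmem := add_smul_mem_spannedCone hx₀ hk ht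
    have h1 := mf_le (hK hmem).1 hω
    rw [← hmin _ hmem] at h1
    simp only [add_dotProduct, smul_dotProduct, smul_eq_mul] at h1
    linarith
  refine ⟨ω₀, hω₀, fun c hc => mf_eq_of_forall_le (fun i => ?_) hω₀ fun ω hω => ?_⟩
  · rw [Finset.sum_apply]
    exact Finset.sum_nonneg fun k hk => mul_nonneg (hc k hk) (natVec_nonneg k i)
  · simp only [sum_dotProduct, smul_dotProduct, smul_eq_mul]
    exact Finset.sum_le_sum fun k hk => mul_le_mul_of_nonneg_left (hle k hk ω hω) (hc k hk)

variable {p : ℕ} [Fact p.Prime]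

theorem coneExponent_sum_smul {f g : MvPolynomial (Fin n) ℤ_[p]} (hf : f ≠ 0) (hg : g ≠ 0)
    {δ : Set (Fin n → ℝ)} (hδ : δ ∈ conePartition f g) {K : Finset (Fin n → ℕ)}
    (hK : spannedCone K ⊆ δ) {c : (Fin n → ℕ) → ℝ} (hc : ∀ k ∈ K, 0 ≤ c k) (s : ℂ) :
    coneExponent f g (∑ k ∈ K, c k • natVec k) s =
      ∑ k ∈ K, (c k : ℂ) * coneExponent f g (natVec k) s := by
  classical
  obtain ⟨τ, τ', -, -, rfl, -⟩ := hδ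
  obtain ⟨ω, -, hω⟩ :=
    exists_mf_eq_dotProduct_of_spannedCone_subset hf (hK.trans inter_subset_left)
  obtain ⟨ω', -, hω'⟩ :=
    exists_mf_eq_dotProduct_of_spannedCone_subset hg (hK.trans inter_subset_right)
  have hsingle : ∀ k ∈ K, (∑ l ∈ K, (if l = k then (1 : ℝ) else 0) • natVec l) = natVec k :=
    fun k hk => by simp [hk]
  have hk0 : ∀ k : Fin n → ℕ, ∀ l ∈ K, (0 : ℝ) ≤ if l = k then 1 else 0 := fun k l _ => by
    split_ifs <;> simp
  have h1 : ∀ k ∈ K, mf f (natVec k) = natVec k ⬝ᵥ expVec ω := fun k hk => by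
    have := hω _ (hk0 k)
    rwa [hsingle k hk] at this
  have h2 : ∀ k ∈ K, mf g (natVec k) = natVec k ⬝ᵥ expVec ω' := fun k hk => by
    have := hω' _ (hk0 k)
    rwa [hsingle k hk] at this
  have hσ : sigma (∑ k ∈ K, c k • natVec k) = ∑ k ∈ K, c k * sigma (natVec k) := by
    simp only [sigma, Finset.sum_apply, Pi.smul_apply, smul_eq_mul, Finset.mul_sum]
    rw [Finset.sum_comm]
  rw [coneExponent, hω c hc, hω' c hc, hσ]
  simp only [sum_dotProduct, smul_dotProduct, smul_eq_mul]
  push_cast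
  rw [Finset.sum_mul, ← Finset.sum_add_distrib, ← Finset.sum_add_distrib]
  refine Finset.sum_congr rfl fun k hk => ?_
  rw [coneExponent, h1 k hk, h2 k hk]
  ring

end Linearity

/-! ### Multiple geometric series -/

section MultipleSeries

/-- Induction on the finite index type by adding one point, each step being a product of two
absolutely convergent series; absolute summability is carried along to permit the next step. -/
theorem hasSum_pi_prod {ι β : Type} [Fintype ι] {F : ι → β → ℂ}
    (hF : ∀ i, Summable fun b => ‖F i b‖) :
    HasSum (fun m : ι → β => ∏ i, F i (m i)) (∏ i, ∑' b, F i b) ∧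
      Summable fun m : ι → β => ‖∏ i, F i (m i)‖ := by
  classical
  let P : (α : Type) → [Fintype α] → Prop := fun α _ => ∀ F : α → β → ℂ,
    (∀ i, Summable fun b => ‖F i b‖) →
      HasSum (fun m : α → β => ∏ i, F i (m i)) (∏ i, ∑' b, F i b) ∧
        Summable fun m : α → β => ‖∏ i, F i (m i)‖
  suffices h : P ι from h F hF
  refine Fintype.induction_empty_option (P := P) ?_ ?_ ?_ ι
  · intro α α' _ e h F hF
    let _ := Fintype.ofEquiv _ e.symm
    obtain ⟨h1, h2⟩ := h (fun a => F (e a)) fun a => hF (e a)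
    have key : ∀ m : α' → β, ∏ a, F (e a) ((Equiv.arrowCongr e (Equiv.refl β)).symm m a)
        = ∏ i, F i (m i) := fun m => by
      rw [← Equiv.prod_comp e]
      rfl
    constructor
    · rw [← (Equiv.arrowCongr e (Equiv.refl β)).symm.hasSum_iff] at h1
      rw [← Equiv.prod_comp e]
      convert h1 using 1
      · ext m
        exact (key m).symm
    · rw [← (Equiv.arrowCongr e (Equiv.refl β)).symm.summable_iff] at h2
      convert h2 using 1
      ext m
      exact congr_arg norm (key m).symm
  · intro F _
    refine ⟨?_, ?_⟩
    · simp
    · exact (hasSum_unique _).summable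
  · intro α _ h F hF
    obtain ⟨h1, h2⟩ := h (fun a => F (some a)) fun a => hF (some a)
    let e : (Option α → β) ≃ β × (α → β) := Equiv.piOptionEquivProd (β := fun _ => β)
    have key : ∀ z : β × (α → β), ∏ i, F i (e.symm z i)
        = F none z.1 * ∏ a, F (some a) (z.2 a) := fun z => by
      rw [Fintype.prod_option]
      rfl
    have hs := summable_mul_of_summable_norm (hF none) h2
    have hn := Summable.mul_norm (hF none) h2
    have ht := tsum_mul_tsum_of_summable_norm (hF none) h2
    constructor
    · rw [← e.symm.hasSum_iff, Fintype.prod_option, ← h1.tsum_eq, ht]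
      simp only [Function.comp_def, key]
      exact hs.hasSum
    · rw [← e.symm.summable_iff]
      simp only [Function.comp_def, key]
      exact hn

theorem hasSum_prod_pow_succ {ι : Type} [Fintype ι] {q : ι → ℂ} (hq : ∀ i, ‖q i‖ < 1) :
    HasSum (fun m : ι → ℕ => ∏ i, q i ^ (m i + 1)) (∏ i, q i * (1 - q i)⁻¹) ∧
      Summable fun m : ι → ℕ => ‖∏ i, q i ^ (m i + 1)‖ := by
  have hsum : ∀ i, Summable fun m => ‖q i ^ (m + 1)‖ := fun i => by
    simp only [norm_pow]
    exact (summable_nat_add_iff 1).2 (summable_geometric_of_lt_one (norm_nonneg _) (hq i))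
  have h := hasSum_pi_prod hsum
  have ht : ∀ i, ∑' m, q i ^ (m + 1) = q i * (1 - q i)⁻¹ := fun i => by
    simp only [pow_succ']
    rw [tsum_mul_left, tsum_geometric_of_norm_lt_one (hq i)]
  simpa only [ht] using h

end MultipleSeries

/-! ### The integral points of a simplicial cone -/

section LatticePoints

variable {n : ℕ}

theorem intVec_injective : Function.Injective (intVec (n := n)) := fun x y h => by
  ext i
  exact Int.cast_injective (α := ℝ) (congr_fun h i)

theorem natVec_injective : Function.Injective (natVec (n := n)) := fun x y h => by
  ext i
  exact Nat.cast_injective (R := ℝ) (congr_fun h i)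

theorem eq_of_sum_smul_eq {K : Finset (Fin n → ℕ)}
    (hK : LinearIndependent ℝ fun k : {k // k ∈ K} => natVec k.1) {c d : (Fin n → ℕ) → ℝ}
    (h : ∑ k ∈ K, c k • natVec k = ∑ k ∈ K, d k • natVec k) {k : Fin n → ℕ} (hk : k ∈ K) :
    c k = d k := by
  have h0 : ∑ k : {k // k ∈ K}, (c k.1 - d k.1) • natVec k.1 = 0 := by
    rw [Finset.sum_coe_sort K fun k => (c k - d k) • natVec k]
    simp only [sub_smul, Finset.sum_sub_distrib, h, sub_self]
  exact sub_eq_zero.1 (Fintype.linearIndependent_iff.1 hK (fun k => c k.1 - d k.1) h0 ⟨k, hk⟩)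

theorem finite_boxPoints (K : Finset (Fin n → ℕ)) : (boxPoints K).Finite := by
  refine (Set.finite_Icc (0 : Fin n → ℤ) fun i => ∑ k ∈ K, (k i : ℤ)).subset ?_
  rintro h ⟨c, hc, hh⟩
  have hi : ∀ i, (h i : ℝ) = ∑ k ∈ K, c k * (k i : ℝ) := fun i => by
    have := congr_fun hh i
    rwa [Finset.sum_apply] at this
  constructor
  · intro i
    have : (0 : ℝ) ≤ h i := by
      rw [hi]
      exact Finset.sum_nonneg fun k hk => mul_nonneg (hc k hk).1 (Nat.cast_nonneg _)
    exact_mod_cast this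
  · intro i
    have : (h i : ℝ) ≤ ∑ k ∈ K, (k i : ℝ) := by
      rw [hi]
      exact Finset.sum_le_sum fun k hk =>
        mul_le_of_le_one_left (Nat.cast_nonneg _) (hc k hk).2.le
    exact_mod_cast this

/-- The integral points of the cone strictly positively spanned by `K` are uniquely of the form
`∑ (m_k + 1) k - h` with `m_k ∈ ℕ` and `h` in the half-open parallelepiped. -/
theorem exists_equiv_boxPoints_prod {K : Finset (Fin n → ℕ)}
    (hK : LinearIndependent ℝ fun k : {k // k ∈ K} => natVec k.1) :
    ∃ e : (boxPoints K × (K → ℕ)) ≃ {x : Fin n → ℕ // natVec x ∈ spannedCone K},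
      ∀ z, natVec (e z).1 =
        ∑ k : K, ((z.2 k + 1 : ℕ) : ℝ) • natVec k.1 - intVec z.1.1 := by
  classical
  have hext : ∀ m : K → ℝ, ∃ d : (Fin n → ℕ) → ℝ, ∀ k : K, d k.1 = m k := fun m =>
    ⟨fun k => if h : k ∈ K then m ⟨k, h⟩ else 0, fun k => by simp⟩
  have hmap : ∀ z : boxPoints K × (K → ℕ), ∃ x : {x : Fin n → ℕ // natVec x ∈ spannedCone K},
      natVec x.1 = ∑ k : K, ((z.2 k + 1 : ℕ) : ℝ) • natVec k.1 - intVec z.1.1 := by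
    rintro ⟨⟨h, c, hc, hh⟩, m⟩
    obtain ⟨d, hd⟩ := hext fun k => ((m k + 1 : ℕ) : ℝ)
    have hsum : ∑ k : K, ((m k + 1 : ℕ) : ℝ) • natVec k.1 - intVec h
        = ∑ k ∈ K, (d k - c k) • natVec k := by
      rw [hh]
      simp only [sub_smul, Finset.sum_sub_distrib]
      rw [← Finset.sum_coe_sort K fun k => d k • natVec k]
      simp only [hd]
    have hpos : ∀ k ∈ K, 0 < d k - c k := fun k hk => by
      have h1 := hd ⟨k, hk⟩
      have h2 := (hc k hk).2
      have h3 : (0 : ℝ) ≤ m ⟨k, hk⟩ := Nat.cast_nonneg _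
      push_cast at h1
      linarith
    -- The truncation is harmless: the coefficients `d k - c k` are positive, so each coordinate is
    -- non-negative.
    let x : Fin n → ℕ := fun i => (∑ k : K, ((m k : ℤ) + 1) * (k.1 i : ℤ) - h i).toNat
    have hx : natVec x = ∑ k : K, ((m k + 1 : ℕ) : ℝ) • natVec k.1 - intVec h := by
      ext i
      have hi : ((∑ k : K, ((m k : ℤ) + 1) * (k.1 i : ℤ) - h i : ℤ) : ℝ) =
          (∑ k : K, ((m k + 1 : ℕ) : ℝ) • natVec k.1 - intVec h) i := by
        simp [intVec, natVec, Finset.sum_apply]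
      have hnn : 0 ≤ ∑ k : K, ((m k : ℤ) + 1) * (k.1 i : ℤ) - h i := by
        have : (0 : ℝ) ≤ (∑ k : K, ((m k + 1 : ℕ) : ℝ) • natVec k.1 - intVec h) i := by
          rw [hsum, Finset.sum_apply]
          exact Finset.sum_nonneg fun k hk => mul_nonneg (hpos k hk).le (natVec_nonneg k i)
        rw [← hi] at this
        exact_mod_cast this
      rw [← hi]
      have := Int.toNat_of_nonneg hnn
      simp only [natVec, x]
      exact_mod_cast congr_arg (Int.cast (R := ℝ)) this
    exact ⟨⟨x, fun k => d k - c k, hpos, hx.trans hsum⟩, hx⟩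
  choose Φ hΦ using hmap
  refine ⟨Equiv.ofBijective Φ ⟨?_, ?_⟩, hΦ⟩
  · rintro ⟨⟨h₁, c₁, hc₁, hh₁⟩, m₁⟩ ⟨⟨h₂, c₂, hc₂, hh₂⟩, m₂⟩ heq
    have h := (hΦ _).symm.trans ((congr_arg (fun x => natVec x.1) heq).trans (hΦ _))
    simp only at h
    obtain ⟨d₁, hd₁⟩ := hext fun k => ((m₁ k + 1 : ℕ) : ℝ)
    obtain ⟨d₂, hd₂⟩ := hext fun k => ((m₂ k + 1 : ℕ) : ℝ)
    have hs : ∑ k ∈ K, (d₁ k - c₁ k) • natVec k = ∑ k ∈ K, (d₂ k - c₂ k) • natVec k := by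
      simp only [sub_smul, Finset.sum_sub_distrib]
      rw [← hh₁, ← hh₂, ← Finset.sum_coe_sort K fun k => d₁ k • natVec k,
        ← Finset.sum_coe_sort K fun k => d₂ k • natVec k]
      simpa only [hd₁, hd₂] using h
    -- Linear independence gives equal coefficients `m + 1 - c`; as each `c` lies in `[0, 1)`, the
    -- integers differ by less than one.
    have hm : m₁ = m₂ := by
      funext k
      have h1 := eq_of_sum_smul_eq hK hs k.2
      rw [hd₁ k, hd₂ k] at h1
      obtain ⟨a1, b1⟩ := hc₁ k.1 k.2
      obtain ⟨a2, b2⟩ := hc₂ k.1 k.2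
      push_cast at h1
      have l1 : (m₁ k : ℝ) < m₂ k + 1 := by linarith
      have l2 : (m₂ k : ℝ) < m₁ k + 1 := by linarith
      have l1' : m₁ k < m₂ k + 1 := by exact_mod_cast l1
      have l2' : m₂ k < m₁ k + 1 := by exact_mod_cast l2
      omega
    subst hm
    have hh : intVec h₁ = intVec h₂ := sub_right_injective h
    have := intVec_injective hh
    subst this
    rfl
  · rintro ⟨x, c, hc, hx⟩
    -- For a coefficient `c > 0` take `m = ⌈c⌉ - 1`, leaving `⌈c⌉ - c ∈ [0, 1)` as box coefficient.
    -- Rounding up, with the shift by one, matches the strictly positive cone.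
    have hceil : ∀ k ∈ K, ∃ m : ℕ, (⌈c k⌉ : ℝ) = ((m + 1 : ℕ) : ℝ) := fun k hk => by
      have : 0 < ⌈c k⌉ := Int.ceil_pos.2 (hc k hk)
      refine ⟨(⌈c k⌉ - 1).toNat, ?_⟩
      have h : ((⌈c k⌉ - 1).toNat : ℤ) = ⌈c k⌉ - 1 := Int.toNat_of_nonneg (by omega)
      have h' : ((⌈c k⌉ - 1).toNat : ℝ) = ⌈c k⌉ - 1 := by
        exact_mod_cast congr_arg (Int.cast (R := ℝ)) h
      push_cast
      rw [h']
      ring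
    choose m hm using hceil
    let h : Fin n → ℤ := fun i => ∑ k ∈ K, ⌈c k⌉ * (k i : ℤ) - x i
    have hh : intVec h = ∑ k ∈ K, ((⌈c k⌉ : ℝ) - c k) • natVec k := by
      have h1 : intVec h = ∑ k ∈ K, (⌈c k⌉ : ℝ) • natVec k - natVec x := by
        ext i
        simp [intVec, natVec, h, Finset.sum_apply]
      rw [h1, hx]
      simp only [sub_smul, Finset.sum_sub_distrib]
    refine ⟨⟨⟨h, fun k => ⌈c k⌉ - c k, fun k _ => ⟨sub_nonneg.2 (Int.le_ceil _), ?_⟩, hh⟩,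
      fun k => m k.1 k.2⟩, ?_⟩
    · linarith [Int.ceil_lt_add_one (c k)]
    · refine Subtype.ext (natVec_injective ?_)
      rw [hΦ]
      simp only
      rw [hh, hx]
      simp only [← hm, sub_smul, Finset.sum_sub_distrib]
      rw [Finset.sum_coe_sort K fun k => (⌈c k⌉ : ℝ) • natVec k]
      abel

end LatticePoints

/-! ### The series of a cone and its closed form -/

section ClosedForm

variable {p : ℕ} [Fact p.Prime] {n : ℕ} {f g : MvPolynomial (Fin n) ℤ_[p]}

theorem natCast_prime_cpow_ne_zero (z : ℂ) : (p : ℂ) ^ z ≠ 0 := by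
  rw [Ne, Complex.cpow_eq_zero_iff]
  exact fun h => natCast_prime_complex_ne_zero h.1

theorem natCast_prime_cpow_sum {ι : Type*} (t : Finset ι) (z : ι → ℂ) :
    (p : ℂ) ^ (∑ i ∈ t, z i) = ∏ i ∈ t, (p : ℂ) ^ z i := by
  induction t using Finset.cons_induction with
  | empty => simp
  | cons a t ha ih =>
    rw [Finset.sum_cons, Finset.prod_cons, Complex.cpow_add _ _ natCast_prime_complex_ne_zero, ih]

theorem sigma_natVec (k : Fin n → ℕ) : sigma (natVec k) = ((∑ i, k i : ℕ) : ℝ) := by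
  simp [sigma, natVec]

theorem sigma_pos_of_isPrimitive {k : Fin n → ℕ} (hk : IsPrimitive k) : 0 < sigma (natVec k) := by
  obtain ⟨i, hi⟩ := Function.ne_iff.1 (natVec_ne_zero_of_isPrimitive hk)
  exact Finset.sum_pos' (fun j _ => natVec_nonneg k j)
    ⟨i, Finset.mem_univ i, lt_of_le_of_ne (natVec_nonneg k i) (Ne.symm hi)⟩

theorem re_coneExponent (f g : MvPolynomial (Fin n) ℤ_[p]) (k : Fin n → ℝ) (s : ℂ) :
    (coneExponent f g k s).re = mf f k * s.re + mf g k + sigma k := by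
  simp [coneExponent]

theorem sigma_le_re_coneExponent (hf : f ≠ 0) (hg : g ≠ 0) (k : Fin n → ℕ) {s : ℂ}
    (hs : 0 ≤ s.re) : sigma (natVec k) ≤ (coneExponent f g (natVec k) s).re := by
  rw [re_coneExponent]
  have h1 := mul_nonneg (mf_nonneg hf (natVec_nonneg k)) hs
  have h2 := mf_nonneg hg (natVec_nonneg k)
  linarith

/-- For `Re s ≥ 0` the contributions of `m_f` and `m_g` only shrink the term, leaving the product of
geometric terms coming from `σ`. -/
theorem norm_coneTerm_le (hf : f ≠ 0) (hg : g ≠ 0) (k : Fin n → ℕ) {s : ℂ} (hs : 0 ≤ s.re) :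
    ‖coneTerm f g (natVec k) s‖ ≤ ‖∏ i, ((p : ℂ)⁻¹) ^ k i‖ := by
  have hp : (1 : ℝ) ≤ p := Nat.one_le_cast.2 (Fact.out : p.Prime).one_lt.le
  rw [coneTerm, Complex.norm_natCast_cpow_of_pos (Fact.out : p.Prime).pos,
    Finset.prod_pow_eq_pow_sum, norm_pow, norm_inv, Complex.norm_natCast, inv_pow,
    ← Real.rpow_natCast, ← sigma_natVec, ← Real.rpow_neg (by positivity), Complex.neg_re]
  exact Real.rpow_le_rpow_of_exponent_le hp
    (neg_le_neg (sigma_le_re_coneExponent hf hg k hs))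

theorem summable_coneTerm (hf : f ≠ 0) (hg : g ≠ 0) {s : ℂ} (hs : 0 ≤ s.re) :
    Summable fun k : Fin n → ℕ => coneTerm f g (natVec k) s := by
  have hp : (1 : ℝ) < p := Nat.one_lt_cast.2 (Fact.out : p.Prime).one_lt
  have h := (hasSum_pi_prod (ι := Fin n) (F := fun _ m => ((p : ℂ)⁻¹) ^ m) fun _ => by
    simp only [norm_pow, norm_inv, Complex.norm_natCast]
    exact summable_geometric_of_lt_one (by positivity) (inv_lt_one_of_one_lt₀ hp)).2
  exact Summable.of_norm_bounded h fun k => norm_coneTerm_le hf hg k hs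

theorem summable_coneTerm_subtype (hf : f ≠ 0) (hg : g ≠ 0) (δ : Set (Fin n → ℝ)) {s : ℂ}
    (hs : 0 ≤ s.re) :
    Summable fun k : {k : Fin n → ℕ // natVec k ∈ δ} => coneTerm f g (natVec k.1) s :=
  (summable_coneTerm hf hg hs).subtype {k | natVec k ∈ δ}

theorem norm_cpow_neg_coneExponent_lt_one (hf : f ≠ 0) (hg : g ≠ 0) {k : Fin n → ℕ}
    (hk : IsPrimitive k) {s : ℂ} (hs : 0 ≤ s.re) :
    ‖(p : ℂ) ^ (-coneExponent f g (natVec k) s)‖ < 1 := by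
  have hp : (1 : ℝ) < p := Nat.one_lt_cast.2 (Fact.out : p.Prime).one_lt
  rw [Complex.norm_natCast_cpow_of_pos (Fact.out : p.Prime).pos, Complex.neg_re]
  refine Real.rpow_lt_one_of_one_lt_of_neg hp (neg_lt_zero.2 ?_)
  exact (sigma_pos_of_isPrimitive hk).trans_le (sigma_le_re_coneExponent hf hg k hs)

theorem cpow_coneExponent_sub_one_ne_zero (hf : f ≠ 0) (hg : g ≠ 0) {k : Fin n → ℕ}
    (hk : IsPrimitive k) {s : ℂ} (hs : 0 ≤ s.re) :
    (p : ℂ) ^ coneExponent f g (natVec k) s - 1 ≠ 0 := by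
  intro h
  have h1 := natCast_prime_cpow_eq_one_imp (sub_eq_zero.1 h)
  have h2 := sigma_le_re_coneExponent hf hg k hs
  have h3 := sigma_pos_of_isPrimitive hk
  linarith

/-- Linearity of the exponent splits the term at `∑ (m_k + 1) k - h` into a factor depending only on
`h` and powers of the ratios `q k`, so the series is a finite sum times a multiple geometric series.
-/
theorem hasSum_coneTerm_spannedCone (hf : f ≠ 0) (hg : g ≠ 0) {δ : Set (Fin n → ℝ)}
    (hδ : δ ∈ conePartition f g) {K : Finset (Fin n → ℕ)} (hKδ : spannedCone K ⊆ δ)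
    (hprim : ∀ k ∈ K, IsPrimitive k)
    (hK : LinearIndependent ℝ fun k : {k // k ∈ K} => natVec k.1) {s : ℂ} (hs : 0 ≤ s.re) :
    HasSum (fun x : {x : Fin n → ℕ // natVec x ∈ spannedCone K} => coneTerm f g (natVec x.1) s)
      ((∑ᶠ h ∈ boxPoints K, (p : ℂ) ^ coneExponent f g (intVec h) s) /
        ∏ k ∈ K, ((p : ℂ) ^ coneExponent f g (natVec k) s - 1)) := by
  classical
  have hp0 : (p : ℂ) ≠ 0 := natCast_prime_complex_ne_zero
  obtain ⟨e, he⟩ := exists_equiv_boxPoints_prod hK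
  let _ : Fintype (boxPoints K) := (finite_boxPoints K).fintype
  let q : K → ℂ := fun k => (p : ℂ) ^ (-coneExponent f g (natVec k.1) s)
  have hq : ∀ k, ‖q k‖ < 1 := fun k => norm_cpow_neg_coneExponent_lt_one hf hg (hprim k.1 k.2) hs
  have hterm : ∀ z : boxPoints K × (K → ℕ), coneTerm f g (natVec (e z).1) s =
      (p : ℂ) ^ coneExponent f g (intVec z.1.1) s * ∏ k, q k ^ (z.2 k + 1) := by
    rintro ⟨⟨h, c, hc, hh⟩, m⟩
    let d : (Fin n → ℕ) → ℝ := fun k => if hk : k ∈ K then ((m ⟨k, hk⟩ + 1 : ℕ) : ℝ) else 0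
    have hd : ∀ k : K, d k.1 = ((m k + 1 : ℕ) : ℝ) := fun k => by simp [d]
    have hx : natVec (e (⟨h, c, hc, hh⟩, m)).1 = ∑ k ∈ K, (d k - c k) • natVec k := by
      rw [he]
      simp only
      rw [hh]
      simp only [sub_smul, Finset.sum_sub_distrib]
      rw [← Finset.sum_coe_sort K fun k => d k • natVec k]
      simp only [hd]
    have hpos : ∀ k ∈ K, 0 ≤ d k - c k := fun k hk => by
      have h1 := hd ⟨k, hk⟩
      have h2 := (hc k hk).2
      have h3 : (0 : ℝ) ≤ m ⟨k, hk⟩ := Nat.cast_nonneg _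
      push_cast at h1
      linarith
    have hprod : ∏ k, q k ^ (m k + 1) =
        (p : ℂ) ^ (-∑ k ∈ K, (d k : ℂ) * coneExponent f g (natVec k) s) := by
      rw [← Finset.sum_coe_sort K fun k => (d k : ℂ) * coneExponent f g (natVec k) s,
        ← Finset.sum_neg_distrib, natCast_prime_cpow_sum]
      refine Finset.prod_congr rfl fun k _ => ?_
      rw [← Complex.cpow_nat_mul, hd]
      push_cast
      ring_nf
    simp only
    rw [coneTerm, hx, coneExponent_sum_smul hf hg hδ hKδ hpos, hh,
      coneExponent_sum_smul hf hg hδ hKδ fun k hk => (hc k hk).1, hprod,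
      ← Complex.cpow_add _ _ hp0]
    congr 1
    push_cast
    simp only [sub_mul, Finset.sum_sub_distrib]
    ring
  obtain ⟨hB, hBn⟩ := hasSum_prod_pow_succ hq
  have hA : Summable fun h : boxPoints K => ‖(p : ℂ) ^ coneExponent f g (intVec h.1) s‖ :=
    (hasSum_fintype _).summable
  have hsum := (summable_mul_of_summable_norm hA hBn).hasSum
  rw [← tsum_mul_tsum_of_summable_norm hA hBn, hB.tsum_eq, tsum_fintype] at hsum
  rw [← e.hasSum_iff]
  simp only [Function.comp_def, hterm]
  -- The identity `q / (1 - q) = 1 / (q⁻¹ - 1)` turns the geometric sums into the stated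
  -- denominators.
  have hinv : ∀ k, q k * (1 - q k)⁻¹ =
      ((p : ℂ) ^ coneExponent f g (natVec k.1) s - 1)⁻¹ := fun k => by
    have hqk : q k = ((p : ℂ) ^ coneExponent f g (natVec k.1) s)⁻¹ := Complex.cpow_neg _ _
    rw [hqk, ← mul_inv, mul_sub, mul_one, mul_inv_cancel₀ (natCast_prime_cpow_ne_zero _)]
  simp only [hinv] at hsum
  rw [div_eq_mul_inv, ← finsum_set_coe_eq_finsum_mem
    (f := fun h => (p : ℂ) ^ coneExponent f g (intVec h) s), finsum_eq_sum_of_fintype,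
    ← Finset.prod_inv_distrib, ← Finset.prod_coe_sort K]
  exact hsum

theorem coneS_eq_closedS (hf : f ≠ 0) (hg : g ≠ 0) {δ : Set (Fin n → ℝ)}
    (hδ : δ ∈ conePartition f g) {C : Finset (Finset (Fin n → ℕ))}
    (hC : IsSimplicialSubdivision δ C) {s : ℂ} (hs : 0 ≤ s.re) :
    coneS f g δ s = closedS f g C s := by
  have hsub : ∀ K ∈ C, spannedCone K ⊆ δ := fun K hK => by
    rw [← hC.cover]
    exact subset_biUnion_of_mem (u := spannedCone) hK
  have h := hasSum_sum_disjoint (f := fun x : Fin n → ℕ => coneTerm f g (natVec x) s) C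
    (t := fun K => natVec ⁻¹' spannedCone K)
    (fun K hK K' hK' hne => (hC.disjoint hK hK' hne).preimage natVec)
    (fun K hK => hasSum_coneTerm_spannedCone hf hg hδ (hsub K hK) (hC.primitive K hK)
      (hC.linearIndependent K hK) hs)
  have hcover : ⋃ K ∈ C, natVec ⁻¹' spannedCone K = (natVec (n := n)) ⁻¹' δ := by
    rw [← hC.cover, preimage_iUnion₂]
  rw [hcover] at h
  exact h.tsum_eq

end ClosedForm

/-! ### Reduction of the rescaled polynomials -/

section Rescaling

variable {p : ℕ} [Fact p.Prime] {n : ℕ}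

/-- The polynomial `p ^ (-a) f(p ^ k x)`, if `a` is at most `k · ω` for all exponents `ω`. -/
def rescaledPoly (f : MvPolynomial (Fin n) ℤ_[p]) (k : Fin n → ℕ) (a : ℕ) :
    MvPolynomial (Fin n) ℤ_[p] :=
  ∑ ω ∈ f.support, MvPolynomial.monomial ω (f.coeff ω * (p : ℤ_[p]) ^ (∑ i, k i * ω i - a))

theorem le_of_mf_eq {f : MvPolynomial (Fin n) ℤ_[p]} {k : Fin n → ℕ} {a : ℕ}
    (ha : mf f (natVec k) = a) {ω : Fin n →₀ ℕ} (hω : ω ∈ f.support) : a ≤ ∑ i, k i * ω i := by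
  have h := mf_le (natVec_nonneg k) hω
  rw [ha, natVec_dotProduct_expVec] at h
  exact_mod_cast h

theorem eval_scaleHom {f : MvPolynomial (Fin n) ℤ_[p]} {k : Fin n → ℕ} {a : ℕ}
    (ha : mf f (natVec k) = a) (u : Fin n → ℤ_[p]) :
    MvPolynomial.eval (scaleHom p n k u) f =
      (p : ℤ_[p]) ^ a * MvPolynomial.eval u (rescaledPoly f k a) := by
  rw [MvPolynomial.eval_eq', rescaledPoly, map_sum, Finset.mul_sum]
  refine Finset.sum_congr rfl fun ω hω => ?_
  have h1 : ∏ i, scaleHom p n k u i ^ ω i = (p : ℤ_[p]) ^ (∑ i, k i * ω i) * ∏ i, u i ^ ω i := by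
    simp only [scaleHom_apply, mul_pow, ← pow_mul]
    rw [Finset.prod_mul_distrib, Finset.prod_pow_eq_pow_sum]
  have h2 : (p : ℤ_[p]) ^ (∑ i, k i * ω i) =
      (p : ℤ_[p]) ^ a * (p : ℤ_[p]) ^ (∑ i, k i * ω i - a) := by
    rw [← pow_add, Nat.add_sub_of_le (le_of_mf_eq ha hω)]
  rw [MvPolynomial.eval_monomial, Finsupp.prod_fintype _ _ fun i => pow_zero _, h1, h2]
  ring

/-- Exponents outside the first meet locus keep a positive power of `p` in their coefficient and
vanish modulo `p`; those inside keep their coefficient. -/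
theorem redPoly_rescaledPoly {f : MvPolynomial (Fin n) ℤ_[p]} {k : Fin n → ℕ} {a : ℕ}
    (ha : mf f (natVec k) = a) :
    redPoly (rescaledPoly f k a) = redPoly (facePoly f (firstMeetLocus f (natVec k))) := by
  classical
  rw [redPoly, redPoly, rescaledPoly, facePoly, map_sum, map_sum, Finset.sum_filter]
  refine Finset.sum_congr rfl fun ω hω => ?_
  have hmem : natVec (ω : Fin n → ℕ) ∈ firstMeetLocus f (natVec k) ↔ ∑ i, k i * ω i = a := by
    rw [mem_firstMeetLocus_expVec hω, ha, natVec_dotProduct_expVec, Nat.cast_inj]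
  rw [MvPolynomial.map_monomial, MvPolynomial.map_monomial]
  split_ifs with h
  · rw [hmem.1 h, Nat.sub_self, pow_zero, mul_one]
  · have hlt : a < ∑ i, k i * ω i :=
      lt_of_le_of_ne (le_of_mf_eq ha hω) fun h' => h (hmem.2 h'.symm)
    rw [map_mul, map_pow, map_natCast, CharP.cast_eq_zero, zero_pow (by omega), mul_zero, map_zero]

theorem evalTorus_redPoly (F : MvPolynomial (Fin n) ℤ_[p]) (α : Fin n → (ZMod p)ˣ)
    {a : Fin n → ℤ_[p]} (ha : ∀ i, PadicInt.toZMod (a i) = α i) :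
    evalTorus (redPoly F) α = PadicInt.toZMod (MvPolynomial.eval a F) := by
  rw [evalTorus, redPoly, MvPolynomial.map_eval]
  congr 2
  funext i
  exact (ha i).symm

theorem evalTorus_pderiv_redPoly (F : MvPolynomial (Fin n) ℤ_[p]) (α : Fin n → (ZMod p)ˣ)
    {a : Fin n → ℤ_[p]} (ha : ∀ i, PadicInt.toZMod (a i) = α i) (i : Fin n) :
    evalTorus (MvPolynomial.pderiv i (redPoly F)) α =
      PadicInt.toZMod (MvPolynomial.eval a (MvPolynomial.pderiv i F)) := by
  rw [← evalTorus_redPoly _ α ha, redPoly, redPoly, MvPolynomial.pderiv_map]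

theorem exists_minor_ne_zero_of_rank_jacobian {F G : MvPolynomial (Fin n) (ZMod p)}
    {α : Fin n → (ZMod p)ˣ} (h : (jacobian F G α).rank = 2) :
    ∃ i j, i ≠ j ∧ evalTorus (MvPolynomial.pderiv i F) α * evalTorus (MvPolynomial.pderiv j G) α -
      evalTorus (MvPolynomial.pderiv j F) α * evalTorus (MvPolynomial.pderiv i G) α ≠ 0 := by
  have hli : LinearIndependent (ZMod p) (jacobian F G α).row := by
    rw [linearIndependent_iff_card_eq_finrank_span, Set.finrank, ← Matrix.rank_eq_finrank_span_row,
      h, Fintype.card_fin]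
  have hli' := LinearIndependent.pair_iff.1 ((show (jacobian F G α).row =
    ![fun j => evalTorus (MvPolynomial.pderiv j F) α,
      fun j => evalTorus (MvPolynomial.pderiv j G) α] from rfl) ▸ hli)
  by_contra! hall
  -- If all minors vanish, `(∂G/∂x_i) · row F - (∂F/∂x_i) · row G` is zero, and independence of the
  -- rows forces `∂F/∂x_i = 0`.
  have hzero : ∀ i, evalTorus (MvPolynomial.pderiv i F) α = 0 := by
    intro i
    have := (hli' (evalTorus (MvPolynomial.pderiv i G) α)
      (-evalTorus (MvPolynomial.pderiv i F) α) ?_).2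
    · exact neg_eq_zero.1 this
    · funext j
      simp only [Pi.add_apply, Pi.smul_apply, smul_eq_mul, Pi.zero_apply]
      rcases eq_or_ne i j with rfl | hij
      · ring
      · linear_combination -hall i j hij
  have := (hli' 1 0 (by funext j; simp [hzero])).1
  exact one_ne_zero this

end Rescaling

/-! ### The integral over a residue class -/

section ResidueClass

variable {p : ℕ} [Fact p.Prime] {n : ℕ}

/-- The residue class modulo `p` of a point of the torus. -/
def residueClass (α : Fin n → (ZMod p)ˣ) : Set (Fin n → ℤ_[p]) :=
  {x | ∀ i, PadicInt.toZMod (x i) = α i}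

/-- The points of `ℤ_pⁿ` all of whose coordinates are units. -/
def unitTorus (p : ℕ) [Fact p.Prime] (n : ℕ) : Set (Fin n → ℤ_[p]) :=
  {x | ∀ i, ‖x i‖ = 1}

theorem iUnion_residueClass : ⋃ α, residueClass α = unitTorus p n := by
  ext x
  rw [mem_iUnion]
  constructor
  · rintro ⟨α, hα⟩ i
    rw [← toZMod_ne_zero_iff_norm, hα i]
    exact (α i).ne_zero
  · intro hx
    exact ⟨fun i => Units.mk0 _ (toZMod_ne_zero_iff_norm.2 (hx i)), fun i => rfl⟩

theorem pairwise_disjoint_residueClass :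
    Pairwise (Function.onFun Disjoint (residueClass (p := p) (n := n))) := by
  intro α β h
  refine Set.disjoint_left.2 fun x hα hβ => h ?_
  funext i
  exact Units.ext ((hα i).symm.trans (hβ i))

theorem exists_lift_torus (α : Fin n → (ZMod p)ˣ) :
    ∃ a : Fin n → ℤ_[p], ∀ i, PadicInt.toZMod (a i) = α i :=
  ⟨fun i => ((α i : ZMod p).val : ℤ_[p]), fun i => by simp⟩

theorem residueClass_eq_preimage {α : Fin n → (ZMod p)ˣ} {a : Fin n → ℤ_[p]}
    (ha : ∀ i, PadicInt.toZMod (a i) = α i) :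
    residueClass α = (fun x => -a + x) ⁻¹' range (scaleHom p n fun _ => 1) := by
  ext x
  simp only [residueClass, mem_ofPred_eq, mem_preimage, range_scaleHom, mem_univ_pi, mem_range,
    pow_one]
  refine forall_congr' fun i => ?_
  rw [← ha i, ← sub_eq_zero, ← map_sub, toZMod_eq_zero_iff_dvd, dvd_def]
  simp only [Pi.add_apply, Pi.neg_apply, neg_add_eq_sub, eq_comm]

theorem measurableSet_range_scaleHom (k : Fin n → ℕ) :
    MeasurableSet (range (scaleHom p n k)) :=
  (measurableEmbedding_scaleHom k).measurableSet_range

theorem measurableSet_residueClass (α : Fin n → (ZMod p)ˣ) : MeasurableSet (residueClass α) := by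
  obtain ⟨a, ha⟩ := exists_lift_torus α
  rw [residueClass_eq_preimage ha]
  exact measurable_const_add (-a) (measurableSet_range_scaleHom _)

theorem setIntegral_residueClass {α : Fin n → (ZMod p)ˣ} {a : Fin n → ℤ_[p]}
    (ha : ∀ i, PadicInt.toZMod (a i) = α i) (h : (Fin n → ℤ_[p]) → ℂ) :
    ∫ x in residueClass α, h x ∂haar p n =
      ((p : ℂ) ^ n)⁻¹ * ∫ u, h (fun i => a i + p * u i) ∂haar p n := by
  have h1 := (measurePreserving_add_left (haar p n) (-a)).setIntegral_preimage_emb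
    (measurableEmbedding_addLeft (-a)) (fun y => h (a + y)) (range (scaleHom p n fun _ => 1))
  rw [← residueClass_eq_preimage ha, setIntegral_range_scaleHom] at h1
  simp only [add_neg_cancel_left] at h1
  rw [h1]
  have h2 : ∀ u : Fin n → ℤ_[p], a + scaleHom p n (fun _ => 1) u = fun i => a i + p * u i :=
    fun u => by
      funext i
      rw [Pi.add_apply, scaleHom_apply, pow_one]
  simp [h2]

/-- The factor of a residue class in the local integral: `∫_{pℤ_p} |y|^s |dy|`, suitably
normalized, if the polynomial vanishes at the point and `1` otherwise. -/
def residueFactor (c : ZMod p) (s : ℂ) : ℂ :=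
  if c = 0 then ((p : ℂ) - 1) / ((p : ℂ) ^ (s + 1) - 1) else 1

/-- A polynomial non-zero modulo `p` at the class has norm 1 on it; the vanishing ones become
coordinates by non-degeneracy. The factor of `G` is taken at exponent 1 because `|g|` occurs to the
first power. -/
theorem setIntegral_residueClass_norm_mul_norm (F G : MvPolynomial (Fin n) ℤ_[p])
    (α : Fin n → (ZMod p)ˣ) {s : ℂ} (hs : 0 < s.re)
    (hF : evalTorus (redPoly F) α = 0 →
      ∃ i, evalTorus (MvPolynomial.pderiv i (redPoly F)) α ≠ 0)
    (hG : evalTorus (redPoly G) α = 0 →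
      ∃ i, evalTorus (MvPolynomial.pderiv i (redPoly G)) α ≠ 0)
    (hFG : evalTorus (redPoly F) α = 0 → evalTorus (redPoly G) α = 0 →
      (jacobian (redPoly F) (redPoly G) α).rank = 2) :
    ∫ x in residueClass α, igusaIntegrand F G s x ∂haar p n =
      ((p : ℂ) ^ n)⁻¹ * (residueFactor (evalTorus (redPoly F) α) s *
        residueFactor (evalTorus (redPoly G) α) 1) := by
  obtain ⟨a, ha⟩ := exists_lift_torus α
  rw [setIntegral_residueClass ha]
  congr 1
  have hone : ∀ H : MvPolynomial (Fin n) ℤ_[p], evalTorus (redPoly H) α ≠ 0 →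
      ∀ u : Fin n → ℤ_[p], ‖MvPolynomial.eval (fun i => a i + p * u i) H‖ = 1 := by
    intro H hH u
    rw [← toZMod_ne_zero_iff_norm, ← evalTorus_redPoly H α fun i => by simp [ha i]]
    exact hH
  have hint1 : ∫ y, ((‖(p : ℤ_[p]) * y‖ : ℝ) : ℂ) ∂haarOne p =
      ((p : ℂ) - 1) / ((p : ℂ) ^ ((1 : ℂ) + 1) - 1) := by
    rw [← integral_norm_p_mul_cpow (p := p) (s := 1) (by simp)]
    simp only [Complex.cpow_one]
  have hc1 : Continuous fun y : ℤ_[p] => ((‖y‖ : ℝ) : ℂ) :=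
    Complex.continuous_ofReal.comp continuous_norm
  simp only [igusaIntegrand]
  by_cases hF0 : evalTorus (redPoly F) α = 0 <;> by_cases hG0 : evalTorus (redPoly G) α = 0
  · obtain ⟨i, j, hij, hdet⟩ := exists_minor_ne_zero_of_rank_jacobian (hFG hF0 hG0)
    simp only [evalTorus_pderiv_redPoly _ α ha] at hdet
    rw [integral_comp_poly_mul_comp_poly F G a (evalTorus_redPoly F α ha ▸ hF0)
      (evalTorus_redPoly G α ha ▸ hG0) hij hdet (fun y => ((‖y‖ : ℝ) : ℂ) ^ s)
      (fun y => ((‖y‖ : ℝ) : ℂ)), integral_norm_p_mul_cpow hs, hint1, residueFactor, residueFactor,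
      if_pos hF0, if_pos hG0]
  · obtain ⟨i, hi⟩ := hF hF0
    rw [evalTorus_pderiv_redPoly _ α ha] at hi
    simp only [hone G hG0, Complex.ofReal_one, mul_one]
    rw [integral_comp_poly F a (evalTorus_redPoly F α ha ▸ hF0) hi (fun y => ((‖y‖ : ℝ) : ℂ) ^ s)
      (continuous_norm_cpow hs), integral_norm_p_mul_cpow hs, residueFactor, residueFactor,
      if_pos hF0, if_neg hG0, mul_one]
  · obtain ⟨i, hi⟩ := hG hG0
    rw [evalTorus_pderiv_redPoly _ α ha] at hi
    simp only [hone F hF0, Complex.ofReal_one, Complex.one_cpow, one_mul]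
    rw [integral_comp_poly G a (evalTorus_redPoly G α ha ▸ hG0) hi (fun y => ((‖y‖ : ℝ) : ℂ))
      hc1, hint1, residueFactor, residueFactor, if_neg hF0, if_pos hG0, one_mul]
  · simp [hone F hF0, hone G hG0, residueFactor, hF0, hG0]

end ResidueClass

/-! ### The zeta function as a sum over cones -/

section Zeta

variable {p : ℕ} [Fact p.Prime] {n : ℕ}

theorem continuous_igusaIntegrand (f g : MvPolynomial (Fin n) ℤ_[p]) {s : ℂ} (hs : 0 < s.re) :
    Continuous (igusaIntegrand f g s) :=
  ((continuous_norm_cpow hs).comp (MvPolynomial.continuous_eval f)).mul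
    (Complex.continuous_ofReal.comp (continuous_norm.comp (MvPolynomial.continuous_eval g)))

theorem integrable_igusaIntegrand (f g : MvPolynomial (Fin n) ℤ_[p]) {s : ℂ} (hs : 0 < s.re) :
    Integrable (igusaIntegrand f g s) (haar p n) :=
  (continuous_igusaIntegrand f g hs).integrable_of_hasCompactSupport
    (HasCompactSupport.of_compactSpace _)

open Classical in
/-- Evaluation of a sum over the torus in terms of the numbers of zeros. -/
theorem sum_residueFactor_mul (F G : MvPolynomial (Fin n) (ZMod p)) (A B : ℂ) :
    ∑ α : Fin n → (ZMod p)ˣ, (if evalTorus F α = 0 then A else 1) *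
        (if evalTorus G α = 0 then B else 1) =
      ((p : ℂ) - 1) ^ n
        - ({α : Fin n → (ZMod p)ˣ | evalTorus F α = 0 ∧ evalTorus G α ≠ 0}.ncard : ℂ) * (1 - A)
        - ({α : Fin n → (ZMod p)ˣ | evalTorus F α ≠ 0 ∧ evalTorus G α = 0}.ncard : ℂ) * (1 - B)
        - ({α : Fin n → (ZMod p)ˣ | evalTorus F α = 0 ∧ evalTorus G α = 0}.ncard : ℂ)
          * (1 - A * B) := by
  have hcard : ∀ (P : (Fin n → (ZMod p)ˣ) → Prop) (c : ℂ),
      (({α | P α} : Set (Fin n → (ZMod p)ˣ)).ncard : ℂ) * c = ∑ α, if P α then c else 0 := by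
    intro P c
    rw [Set.ncard_eq_toFinset_card', Finset.sum_ite, Finset.sum_const, Finset.sum_const_zero,
      add_zero, nsmul_eq_mul, Set.toFinset_ofPred]
  have hone : ((p : ℂ) - 1) ^ n = ∑ _α : Fin n → (ZMod p)ˣ, (1 : ℂ) := by
    have : Fintype.card (ZMod p)ˣ = p - 1 := ZMod.card_units p
    rw [Finset.sum_const, Finset.card_univ, Fintype.card_fun, this, Fintype.card_fin, nsmul_eq_mul,
      mul_one, Nat.cast_pow, Nat.cast_sub (Fact.out : p.Prime).one_lt.le, Nat.cast_one]
  rw [hcard, hcard, hcard, hone, ← Finset.sum_sub_distrib, ← Finset.sum_sub_distrib,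
    ← Finset.sum_sub_distrib]
  refine Finset.sum_congr rfl fun α _ => ?_
  by_cases h1 : evalTorus F α = 0 <;> by_cases h2 : evalTorus G α = 0 <;> simp [h1, h2]

theorem cpow_add_one_sub_one_ne_zero {s : ℂ} (hs : s.re ≠ -1) : (p : ℂ) ^ (s + 1) - 1 ≠ 0 := by
  intro h
  have := natCast_prime_cpow_eq_one_imp (sub_eq_zero.1 h)
  rw [Complex.add_re, Complex.one_re] at this
  exact hs (by linarith)

theorem sum_torus_eq_coneL (f g : MvPolynomial (Fin n) ℤ_[p]) (δ : Set (Fin n → ℝ)) {s : ℂ}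
    (hs : s.re ≠ -1) :
    ∑ α : Fin n → (ZMod p)ˣ, ((p : ℂ) ^ n)⁻¹ * (residueFactor (evalTorus (conePoly f δ) α) s *
      residueFactor (evalTorus (conePoly g δ) α) 1) = coneL f g δ s := by
  classical
  have hp1 : (p : ℂ) + 1 ≠ 0 := by exact_mod_cast Nat.succ_ne_zero p
  have hp0 : (p : ℂ) ≠ 0 := natCast_prime_complex_ne_zero
  have hpm : (p : ℂ) - 1 ≠ 0 := by
    rw [sub_ne_zero]
    exact_mod_cast (Fact.out : p.Prime).one_lt.ne'
  have hd := cpow_add_one_sub_one_ne_zero (p := p) hs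
  have hps : (p : ℂ) ^ (s + 1) = (p : ℂ) ^ s * p := by
    rw [Complex.cpow_add _ _ hp0, Complex.cpow_one]
  -- The residue factor at `s = 1` is `(p - 1) / (p² - 1)`, the source of every `p + 1` in `L_δ`.
  have hB : ((p : ℂ) - 1) / ((p : ℂ) ^ ((1 : ℂ) + 1) - 1) = 1 / ((p : ℂ) + 1) := by
    rw [Complex.cpow_add _ _ hp0, Complex.cpow_one,
      show (p : ℂ) * p - 1 = (p - 1) * (p + 1) by ring]
    field_simp
  rw [← Finset.mul_sum]
  have h := sum_residueFactor_mul (conePoly f δ) (conePoly g δ)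
    (((p : ℂ) - 1) / ((p : ℂ) ^ (s + 1) - 1)) (1 / ((p : ℂ) + 1))
  simp only [residueFactor, hB]
  rw [h, coneL, countN, countP, countQ]
  congr 1
  rw [hps] at hd ⊢
  generalize (p : ℂ) ^ s = z at hd ⊢
  have hd' : (p : ℂ) * z - 1 ≠ 0 := by rwa [mul_comm]
  have e1 : 1 - ((p : ℂ) - 1) / (z * p - 1) =
      p * ((z - 1) / (z * p - 1)) := by
    field_simp
    ring
  have e2 : 1 - 1 / ((p : ℂ) + 1) = p / ((p : ℂ) + 1) := by
    field_simp
    ring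
  have e3 : 1 - ((p : ℂ) - 1) / (z * p - 1) * (1 / ((p : ℂ) + 1)) =
      p * ((z * (p + 1) - 2) / ((z * p - 1) * (p + 1))) := by
    field_simp
    ring
  rw [e1, e2, e3]
  ring

theorem norm_pow_mul_cpow (a : ℕ) (y : ℤ_[p]) (s : ℂ) :
    ((‖(p : ℤ_[p]) ^ a * y‖ : ℝ) : ℂ) ^ s = (p : ℂ) ^ (-(a * s)) * ((‖y‖ : ℝ) : ℂ) ^ s := by
  induction a with
  | zero => simp
  | succ a ih =>
    rw [pow_succ', mul_assoc, norm_p_mul_cpow, ih, ← mul_assoc,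
      ← Complex.cpow_add _ _ natCast_prime_complex_ne_zero]
    push_cast
    ring_nf

theorem measurableSet_unitTorus : MeasurableSet (unitTorus p n) := by
  rw [← iUnion_residueClass]
  exact MeasurableSet.iUnion measurableSet_residueClass

theorem setIntegral_image_scaleHom (k : Fin n → ℕ) (h : (Fin n → ℤ_[p]) → ℂ) :
    ∫ x in scaleHom p n k '' unitTorus p n, h x ∂haar p n =
      ((p : ℂ) ^ ∑ i, k i)⁻¹ * ∫ u in unitTorus p n, h (scaleHom p n k u) ∂haar p n := by
  have hmeas : MeasurableSet (scaleHom p n k '' unitTorus p n) :=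
    (measurableEmbedding_scaleHom k).measurableSet_image.2 measurableSet_unitTorus
  have h1 := setIntegral_range_scaleHom k ((scaleHom p n k '' unitTorus p n).indicator h)
  rw [setIntegral_indicator hmeas, inter_eq_right.2 (image_subset_range _ _)] at h1
  rw [h1, ← integral_indicator measurableSet_unitTorus]
  congr 2
  funext u
  by_cases hu : u ∈ unitTorus p n
  · rw [indicator_of_mem hu, indicator_of_mem (mem_image_of_mem _ hu)]
  · rw [indicator_of_notMem hu, indicator_of_notMem]
    rwa [(scaleHom_injective k).mem_set_image]

/-- The residue factors see only the reductions of the rescaled polynomials, which are the face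
polynomials of the cone of `k`; thus the value depends on `k` only through that cone. -/
theorem setIntegral_unitTorus_rescaledPoly {f g : MvPolynomial (Fin n) ℤ_[p]} (hf : f ≠ 0)
    (hg : g ≠ 0) (hfnd : NonDegenerate f) (hgnd : NonDegenerate g) (hfg : PairNonDegenerate f g)
    {k : Fin n → ℕ} {a b : ℕ} (ha : mf f (natVec k) = a) (hb : mf g (natVec k) = b) {s : ℂ}
    (hs : 0 < s.re) :
    ∫ u in unitTorus p n, igusaIntegrand (rescaledPoly f k a) (rescaledPoly g k b) s u ∂haar p n =
      coneL f g (coneClass f g (natVec k)) s := by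
  have hk := natVec_nonneg k
  have hδ := coneClass_mem_conePartition hf hg hk
  have hmem := self_mem_coneClass (f := f) (g := g) hk
  have hF : redPoly (rescaledPoly f k a) = conePoly f (coneClass f g (natVec k)) := by
    rw [redPoly_rescaledPoly ha, conePoly, faceOf_left_eq_firstMeetLocus hδ hmem]
  have hG : redPoly (rescaledPoly g k b) = conePoly g (coneClass f g (natVec k)) := by
    rw [redPoly_rescaledPoly hb, conePoly, faceOf_right_eq_firstMeetLocus hδ hmem]
  rw [← iUnion_residueClass, integral_iUnion_fintype measurableSet_residueClass
    pairwise_disjoint_residueClass fun α => (integrable_igusaIntegrand _ _ hs).integrableOn,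
    ← sum_torus_eq_coneL f g _ (by linarith)]
  refine Finset.sum_congr rfl fun α _ => ?_
  rw [setIntegral_residueClass_norm_mul_norm _ _ α hs, hF, hG]
  · intro h0
    rw [redPoly_rescaledPoly ha] at h0 ⊢
    have := hfnd _ (isFace_firstMeetLocus hf hk) α
    push Not at this
    exact this h0
  · intro h0
    rw [redPoly_rescaledPoly hb] at h0 ⊢
    have := hgnd _ (isFace_firstMeetLocus hg hk) α
    push Not at this
    exact this h0
  · rw [hF, hG]
    exact hfg _ hδ α

theorem setIntegral_image_scaleHom_igusaIntegrand {f g : MvPolynomial (Fin n) ℤ_[p]} (hf : f ≠ 0)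
    (hg : g ≠ 0) (hfnd : NonDegenerate f) (hgnd : NonDegenerate g) (hfg : PairNonDegenerate f g)
    (k : Fin n → ℕ) {s : ℂ} (hs : 0 < s.re) :
    ∫ x in scaleHom p n k '' unitTorus p n, igusaIntegrand f g s x ∂haar p n =
      coneL f g (coneClass f g (natVec k)) s * coneTerm f g (natVec k) s := by
  have hp0 : (p : ℂ) ≠ 0 := natCast_prime_complex_ne_zero
  obtain ⟨a, ha⟩ := exists_nat_mf_eq hf k
  obtain ⟨b, hb⟩ := exists_nat_mf_eq hg k
  have hint : ∀ u, igusaIntegrand f g s (scaleHom p n k u) = (p : ℂ) ^ (-(a * s)) *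
      (p : ℂ) ^ (-(b : ℂ)) * igusaIntegrand (rescaledPoly f k a) (rescaledPoly g k b) s u := by
    intro u
    have h1 := norm_pow_mul_cpow b (MvPolynomial.eval u (rescaledPoly g k b)) 1
    rw [Complex.cpow_one, Complex.cpow_one, mul_one] at h1
    rw [igusaIntegrand, igusaIntegrand, eval_scaleHom ha, eval_scaleHom hb, norm_pow_mul_cpow, h1]
    ring
  rw [setIntegral_image_scaleHom]
  simp only [hint]
  rw [integral_const_mul, setIntegral_unitTorus_rescaledPoly hf hg hfnd hgnd hfg ha hb hs,
    ← Complex.cpow_natCast, ← Complex.cpow_neg, coneTerm, coneExponent, ha, hb, sigma_natVec]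
  rw [show -(((a : ℝ) : ℂ) * s + ((b : ℝ) : ℂ) + ((((∑ i, k i : ℕ) : ℝ)) : ℂ)) =
    -((∑ i, k i : ℕ) : ℂ) + (-(a * s) + -(b : ℂ)) by push_cast; ring,
    Complex.cpow_add _ _ hp0, Complex.cpow_add _ _ hp0]
  ring

theorem pairwise_disjoint_image_scaleHom : Pairwise (Function.onFun Disjoint
    fun k : Fin n → ℕ => scaleHom p n k '' unitTorus p n) := by
  intro k l hkl
  refine Set.disjoint_left.2 ?_
  rintro _ ⟨u, hu, rfl⟩ ⟨v, hv, h⟩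
  refine hkl (funext fun i => ?_)
  have h1 := congr_arg norm (congr_fun h i)
  rw [scaleHom_apply, scaleHom_apply, norm_mul, norm_mul, hu i, hv i, mul_one, mul_one,
    PadicInt.norm_p_pow, PadicInt.norm_p_pow] at h1
  have hp : (1 : ℝ) < p := Nat.one_lt_cast.2 (Fact.out : p.Prime).one_lt
  have := zpow_right_injective₀ (by positivity) hp.ne' h1
  omega

theorem iUnion_image_scaleHom :
    ⋃ k : Fin n → ℕ, scaleHom p n k '' unitTorus p n = {x | ∀ i, x i ≠ 0} := by
  ext x
  rw [mem_iUnion]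
  constructor
  · rintro ⟨k, u, hu, rfl⟩ i
    refine mul_ne_zero (pow_ne_zero _ natCast_prime_ne_zero) fun h => ?_
    have := hu i
    rw [h, norm_zero] at this
    exact zero_ne_one this
  · intro hx
    refine ⟨fun i => (x i).valuation, fun i => PadicInt.unitCoeff (hx i), fun i => ?_, ?_⟩
    · exact PadicInt.norm_units _
    · funext i
      rw [scaleHom_apply, mul_comm, ← PadicInt.unitCoeff_spec]

theorem haarOne_singleton_zero : haarOne p {0} = 0 := by
  have hp : (1 : ENNReal) < p := by exact_mod_cast (Fact.out : p.Prime).one_lt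
  have hlim : Filter.Tendsto (fun k : ℕ => ((p : ENNReal)⁻¹) ^ k) Filter.atTop (nhds 0) :=
    ENNReal.tendsto_pow_atTop_nhds_zero_of_lt_one (ENNReal.inv_lt_one.2 hp)
  refine le_antisymm (ge_of_tendsto' hlim fun k => ?_) zero_le
  rw [← ENNReal.inv_pow, ← haarOne_range_pow_mul]
  exact measure_mono (singleton_subset_iff.2 ⟨0, mul_zero _⟩)

/-- The complement lies in the finitely many coordinate hyperplanes, each of measure zero. -/
theorem ae_mem_iUnion_image_scaleHom :
    (⋃ k : Fin n → ℕ, scaleHom p n k '' unitTorus p n) =ᵐ[haar p n] univ := by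
  rw [iUnion_image_scaleHom, ae_eq_univ]
  have hsub : ({x : Fin n → ℤ_[p] | ∀ i, x i ≠ 0})ᶜ ⊆
      ⋃ i, Function.eval i ⁻¹' ({0} : Set ℤ_[p]) := by
    intro x hx
    rw [mem_compl_iff, mem_ofPred_eq] at hx
    push Not at hx
    exact mem_iUnion.2 hx
  refine measure_mono_null hsub (measure_iUnion_null fun i => ?_)
  rw [haar_eq_pi, (measurePreserving_eval (fun _ : Fin n => haarOne p) i).measure_preimage
    (measurableSet_singleton 0).nullMeasurableSet]
  exact haarOne_singleton_zero

/-- Countable additivity over the pieces `p ^ k u`, before the vectors `k` are grouped by cones. -/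
theorem hasSum_igusaZeta {f g : MvPolynomial (Fin n) ℤ_[p]} (hf : f ≠ 0) (hg : g ≠ 0)
    (hfnd : NonDegenerate f) (hgnd : NonDegenerate g) (hfg : PairNonDegenerate f g) {s : ℂ}
    (hs : 0 < s.re) :
    HasSum (fun k : Fin n → ℕ =>
      coneL f g (coneClass f g (natVec k)) s * coneTerm f g (natVec k) s) (igusaZeta f g s) := by
  have h := hasSum_integral_iUnion (μ := haar p n) (f := igusaIntegrand f g s)
    (s := fun k : Fin n → ℕ => scaleHom p n k '' unitTorus p n)
    (fun k => (measurableEmbedding_scaleHom k).measurableSet_image.2 measurableSet_unitTorus)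
    pairwise_disjoint_image_scaleHom (integrable_igusaIntegrand f g hs).integrableOn
  rw [setIntegral_congr_set ae_mem_iUnion_image_scaleHom, setIntegral_univ] at h
  rw [igusaZeta]
  simpa only [setIntegral_image_scaleHom_igusaIntegrand hf hg hfnd hgnd hfg _ hs] using h

theorem igusaZeta_eq_finsum {f g : MvPolynomial (Fin n) ℤ_[p]} (hf : f ≠ 0) (hg : g ≠ 0)
    (hfnd : NonDegenerate f) (hgnd : NonDegenerate g) (hfg : PairNonDegenerate f g) {s : ℂ}
    (hs : 0 < s.re) :
    igusaZeta f g s = ∑ᶠ δ ∈ conePartition f g, coneL f g δ s * coneS f g δ s := by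
  have hfin := finite_conePartition hf hg
  rw [finsum_mem_eq_finite_toFinset_sum _ hfin]
  have hcone : ∀ δ ∈ hfin.toFinset, HasSum
      ((fun k : Fin n → ℕ => coneL f g (coneClass f g (natVec k)) s * coneTerm f g (natVec k) s) ∘
        ((↑) : natVec ⁻¹' δ → (Fin n → ℕ))) (coneL f g δ s * coneS f g δ s) := by
    intro δ hδ
    have h := (summable_coneTerm_subtype hf hg δ hs.le).hasSum.mul_left (coneL f g δ s)
    have hfun : ((fun k : Fin n → ℕ =>
        coneL f g (coneClass f g (natVec k)) s * coneTerm f g (natVec k) s) ∘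
        ((↑) : natVec ⁻¹' δ → (Fin n → ℕ))) =
        fun k => coneL f g δ s * coneTerm f g (natVec k.1) s := funext fun k => by
      rw [Function.comp_apply, ← eq_coneClass_of_mem (hfin.mem_toFinset.1 hδ) k.2]
    rw [hfun]
    exact h
  have hunion : ⋃ δ ∈ hfin.toFinset, natVec ⁻¹' δ = (univ : Set (Fin n → ℕ)) := by
    refine eq_univ_of_forall fun k => mem_iUnion₂.2 ⟨coneClass f g (natVec k), ?_,
      self_mem_coneClass (natVec_nonneg k)⟩
    exact hfin.mem_toFinset.2 (coneClass_mem_conePartition hf hg (natVec_nonneg k))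
  have h := hasSum_sum_disjoint hfin.toFinset (t := fun δ => natVec ⁻¹' δ) ?_ hcone
  · rw [hunion, hasSum_subtype_iff_indicator, indicator_univ] at h
    exact (hasSum_igusaZeta hf hg hfnd hgnd hfg hs).unique h
  · intro δ hδ ε hε hne
    refine Set.disjoint_left.2 fun k h1 h2 => hne ?_
    rw [eq_coneClass_of_mem (hfin.mem_toFinset.1 hδ) h1,
      eq_coneClass_of_mem (hfin.mem_toFinset.1 hε) h2]

end Zeta

/-! ### The meromorphic continuation -/

section Continuation

variable {p : ℕ} [Fact p.Prime] {n : ℕ} {f g : MvPolynomial (Fin n) ℤ_[p]}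

theorem analyticAt_prime_cpow {e : ℂ → ℂ} {s : ℂ} (he : AnalyticAt ℂ e s) :
    AnalyticAt ℂ (fun z => (p : ℂ) ^ e z) s := by
  have : (fun z => (p : ℂ) ^ e z) = fun z => Complex.exp (Complex.log p * e z) := by
    funext z
    rw [Complex.cpow_def_of_ne_zero natCast_prime_complex_ne_zero]
  rw [this]
  fun_prop

theorem analyticAt_coneExponent (k : Fin n → ℝ) (s : ℂ) :
    AnalyticAt ℂ (coneExponent f g k) s := by
  unfold coneExponent
  fun_prop

theorem analyticAt_finsum_boxPoints (K : Finset (Fin n → ℕ)) (s : ℂ) :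
    AnalyticAt ℂ (fun z => ∑ᶠ h ∈ boxPoints K, (p : ℂ) ^ coneExponent f g (intVec h) z) s := by
  simp only [finsum_mem_eq_finite_toFinset_sum _ (finite_boxPoints K)]
  exact Finset.analyticAt_fun_sum _ fun h _ => analyticAt_prime_cpow (analyticAt_coneExponent _ _)

theorem analyticAt_prod_denominators (K : Finset (Fin n → ℕ)) (s : ℂ) :
    AnalyticAt ℂ (fun z => ∏ k ∈ K, ((p : ℂ) ^ coneExponent f g (natVec k) z - 1)) s :=
  Finset.analyticAt_fun_prod _ fun _ _ =>
    (analyticAt_prime_cpow (analyticAt_coneExponent _ _)).sub analyticAt_const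

theorem meromorphicAt_coneL (δ : Set (Fin n → ℝ)) (s : ℂ) :
    MeromorphicAt (coneL f g δ) s := by
  have h1 : MeromorphicAt (fun z => (p : ℂ) ^ z) s :=
    (analyticAt_prime_cpow analyticAt_id).meromorphicAt
  have h2 : MeromorphicAt (fun z => (p : ℂ) ^ (z + 1)) s :=
    (analyticAt_prime_cpow (analyticAt_id.add analyticAt_const)).meromorphicAt
  unfold coneL
  fun_prop

theorem analyticAt_coneL (δ : Set (Fin n → ℝ)) {s : ℂ} (hs : s.re ≠ -1) :
    AnalyticAt ℂ (coneL f g δ) s := by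
  have h1 : AnalyticAt ℂ (fun z => (p : ℂ) ^ z) s := analyticAt_prime_cpow analyticAt_id
  have h2 : AnalyticAt ℂ (fun z => (p : ℂ) ^ (z + 1)) s :=
    analyticAt_prime_cpow (analyticAt_id.add analyticAt_const)
  have hd := cpow_add_one_sub_one_ne_zero (p := p) hs
  have hp1 : (p : ℂ) + 1 ≠ 0 := by exact_mod_cast Nat.succ_ne_zero p
  have hd' : ((p : ℂ) ^ (s + 1) - 1) * ((p : ℂ) + 1) ≠ 0 := mul_ne_zero hd hp1
  have h3 : AnalyticAt ℂ (fun z => ((p : ℂ) ^ z - 1) / ((p : ℂ) ^ (z + 1) - 1)) s :=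
    (h1.sub analyticAt_const).div (h2.sub analyticAt_const) hd
  have h4 : AnalyticAt ℂ (fun z => ((p : ℂ) ^ z * ((p : ℂ) + 1) - 2) /
      (((p : ℂ) ^ (z + 1) - 1) * ((p : ℂ) + 1))) s :=
    ((h1.mul analyticAt_const).sub analyticAt_const).div
      ((h2.sub analyticAt_const).mul analyticAt_const) hd'
  unfold coneL
  fun_prop

theorem meromorphicAt_closedS (C : Finset (Finset (Fin n → ℕ))) (s : ℂ) :
    MeromorphicAt (closedS f g C) s :=
  MeromorphicAt.fun_sum fun K _ => (analyticAt_finsum_boxPoints K s).meromorphicAt.fun_div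
    (analyticAt_prod_denominators K s).meromorphicAt

theorem analyticAt_closedS {C : Finset (Finset (Fin n → ℕ))} {s : ℂ}
    (hC : ∀ K ∈ C, ∀ k ∈ K, (p : ℂ) ^ coneExponent f g (natVec k) s - 1 ≠ 0) :
    AnalyticAt ℂ (closedS f g C) s :=
  Finset.analyticAt_fun_sum _ fun K hK => (analyticAt_finsum_boxPoints K s).div
    (analyticAt_prod_denominators K s) (Finset.prod_ne_zero_iff.2 (hC K hK))

theorem closedZeta_eq_sum (hf : f ≠ 0) (hg : g ≠ 0)
    (C : Set (Fin n → ℝ) → Finset (Finset (Fin n → ℕ))) : closedZeta f g C =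
      fun s => ∑ δ ∈ (finite_conePartition hf hg).toFinset,
        coneL f g δ s * closedS f g (C δ) s := by
  funext s
  rw [closedZeta, finsum_mem_eq_finite_toFinset_sum _ (finite_conePartition hf hg)]

theorem re_mem_candidateRealParts (hg : g ≠ 0) {k : Fin n → ℕ} (hk : IsRayGenerator f g k) {s : ℂ}
    (h : (p : ℂ) ^ coneExponent f g (natVec k) s - 1 = 0) : s.re ∈ candidateRealParts f g := by
  have h1 := natCast_prime_cpow_eq_one_imp (sub_eq_zero.1 h)
  rw [re_coneExponent] at h1
  have h2 := sigma_pos_of_isPrimitive hk.1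
  have h3 := mf_nonneg hg (natVec_nonneg k)
  -- With `m_f(k) = 0` the exponent has real part `m_g(k) + σ(k) > 0`, so that denominator never
  -- vanishes.
  have hm : mf f (natVec k) ≠ 0 := by
    intro h0
    rw [h0, zero_mul] at h1
    linarith
  refine Or.inr ⟨k, hk, hm, ?_⟩
  rw [← neg_div, eq_div_iff hm]
  linarith

theorem coneExponent_candidate_eq_zero {k : Fin n → ℕ} (hm : mf f (natVec k) ≠ 0) :
    coneExponent f g (natVec k)
      ((-((mf g (natVec k) + sigma (natVec k)) / mf f (natVec k)) : ℝ) : ℂ) = 0 := by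
  have hm' : ((mf f (natVec k) : ℝ) : ℂ) ≠ 0 := Complex.ofReal_ne_zero.2 hm
  rw [coneExponent]
  push_cast
  field_simp
  ring

end Continuation

end IgusaNewton

end

/-! ### The main theorem -/

theorem mainTheorem1 (p : ℕ) [Fact p.Prime] (n : ℕ) (hn : 2 ≤ n)
    (f g : MvPolynomial (Fin n) ℤ_[p]) (hf : f ≠ 0) (hg : g ≠ 0)
    (hf0 : MvPolynomial.eval 0 f = 0) (hg0 : MvPolynomial.eval 0 g = 0)
    (hfnd : IgusaNewton.NonDegenerate f) (hgnd : IgusaNewton.NonDegenerate g)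
    (hfg : IgusaNewton.PairNonDegenerate f g) :
    -- the main formula, on the domain of definition of the zeta function
    (IgusaNewton.conePartition f g).Finite ∧
    (∀ s : ℂ, 0 < s.re →
      MeasureTheory.Integrable (IgusaNewton.igusaIntegrand f g s) (IgusaNewton.haar p n) ∧
      (∀ δ ∈ IgusaNewton.conePartition f g,
        Summable fun k : {k : Fin n → ℕ // IgusaNewton.natVec k ∈ δ} =>
          IgusaNewton.coneTerm f g (IgusaNewton.natVec k.1) s) ∧
      IgusaNewton.igusaZeta f g s =
        ∑ᶠ δ ∈ IgusaNewton.conePartition f g,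
          IgusaNewton.coneL f g δ s * IgusaNewton.coneS f g δ s) ∧
    -- every cone has a simplicial subdivision without new rays
    (∀ δ ∈ IgusaNewton.conePartition f g, ∃ C : Finset (Finset (Fin n → ℕ)),
      IgusaNewton.IsSimplicialSubdivision δ C ∧ IgusaNewton.NoNewRays f g C) ∧
    -- the closed formula for the series of a cone; it is rational in `p ^ (-s)`
    (∀ k : Fin n → ℕ, ∃ a b : ℕ, IgusaNewton.mf f (IgusaNewton.natVec k) = a ∧
      IgusaNewton.mf g (IgusaNewton.natVec k) = b) ∧
    (∀ δ ∈ IgusaNewton.conePartition f g, ∀ C : Finset (Finset (Fin n → ℕ)),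
      IgusaNewton.IsSimplicialSubdivision δ C → ∀ s : ℂ, 0 < s.re →
        (∀ K ∈ C, ∀ k ∈ K,
          (p : ℂ) ^ IgusaNewton.coneExponent f g (IgusaNewton.natVec k) s - 1 ≠ 0) ∧
        IgusaNewton.coneS f g δ s = IgusaNewton.closedS f g C s) ∧
    -- the meromorphic continuation and its candidate poles
    (∀ C : Set (Fin n → ℝ) → Finset (Finset (Fin n → ℕ)),
      (∀ δ ∈ IgusaNewton.conePartition f g,
        IgusaNewton.IsSimplicialSubdivision δ (C δ) ∧ IgusaNewton.NoNewRays f g (C δ)) →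
      (∀ s : ℂ, 0 < s.re → IgusaNewton.igusaZeta f g s = IgusaNewton.closedZeta f g C s) ∧
      MeromorphicOn (IgusaNewton.closedZeta f g C) Set.univ ∧
      (∀ s : ℂ, s.re ∉ IgusaNewton.candidateRealParts f g →
        AnalyticAt ℂ (IgusaNewton.closedZeta f g C) s) ∧
      -- the zeros of the denominators have exactly the candidate real parts
      ∀ r : ℝ, r ∈ IgusaNewton.candidateRealParts f g ↔
        ∃ s : ℂ, s.re = r ∧ ((p : ℂ) ^ (s + 1) - 1 = 0 ∨
          ∃ δ ∈ IgusaNewton.conePartition f g, ∃ K ∈ C δ, ∃ k ∈ K,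
            (p : ℂ) ^ IgusaNewton.coneExponent f g (IgusaNewton.natVec k) s - 1 = 0)) := by

  classical
  have hfin := IgusaNewton.finite_conePartition hf hg
  have hmain := fun (s : ℂ) (hs : 0 < s.re) =>
    IgusaNewton.igusaZeta_eq_finsum hf hg hfnd hgnd hfg hs
  refine ⟨hfin, fun s hs => ⟨IgusaNewton.integrable_igusaIntegrand f g hs,
    fun δ _ => IgusaNewton.summable_coneTerm_subtype hf hg δ hs.le, hmain s hs⟩,
    fun δ hδ => IgusaNewton.exists_subdivision_noNewRays hf hg hδ, fun k => ?_,
    fun δ hδ C hC s hs => ⟨fun K hK k hk => IgusaNewton.cpow_coneExponent_sub_one_ne_zero hf hg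
      (hC.primitive K hK k hk) hs.le, IgusaNewton.coneS_eq_closedS hf hg hδ hC hs.le⟩,
    fun C hC => ⟨fun s hs => ?_, fun s _ => ?_, fun s hs => ?_, fun r => ⟨?_, ?_⟩⟩⟩
  · obtain ⟨a, ha⟩ := IgusaNewton.exists_nat_mf_eq hf k
    obtain ⟨b, hb⟩ := IgusaNewton.exists_nat_mf_eq hg k
    exact ⟨a, b, ha, hb⟩
  · rw [hmain s hs, IgusaNewton.closedZeta]
    exact finsum_mem_congr rfl fun δ hδ => by
      rw [IgusaNewton.coneS_eq_closedS hf hg hδ (hC δ hδ).1 hs.le]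
  · rw [IgusaNewton.closedZeta_eq_sum hf hg]
    exact MeromorphicAt.fun_sum fun δ _ => (IgusaNewton.meromorphicAt_coneL δ s).fun_mul
      (IgusaNewton.meromorphicAt_closedS (C δ) s)
  · rw [IgusaNewton.closedZeta_eq_sum hf hg]
    refine Finset.analyticAt_fun_sum _ fun δ hδ => ?_
    refine (IgusaNewton.analyticAt_coneL δ fun h => hs (Or.inl h)).mul
      (IgusaNewton.analyticAt_closedS fun K hK k hk h => hs ?_)
    exact IgusaNewton.re_mem_candidateRealParts hg
      ((hC δ (hfin.mem_toFinset.1 hδ)).2 K hK k hk) h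
  · rintro (rfl | ⟨k, hk, hm, rfl⟩)
    · exact ⟨-1, by simp, Or.inl (by simp)⟩
    · obtain ⟨K, hK, hkK⟩ := IgusaNewton.exists_mem_of_subdivision_spannedCone_singleton hk.1
        (hC _ hk.2).1
      refine ⟨_, Complex.ofReal_re _, Or.inr ⟨_, hk.2, K, hK, k, hkK, ?_⟩⟩
      rw [IgusaNewton.coneExponent_candidate_eq_zero hm, Complex.cpow_zero, sub_self]
  · rintro ⟨s, rfl, h | ⟨δ, hδ, K, hK, k, hk, h⟩⟩
    · refine Or.inl ?_
      by_contra hne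
      exact IgusaNewton.cpow_add_one_sub_one_ne_zero hne h
    · exact IgusaNewton.re_mem_candidateRealParts hg ((hC δ hδ).2 K hK k hk) h
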